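/- Let $\mathfrak g$ be a finite-dimensional simple complex Lie algebra of type $ADE$ with Cartan subalgebra $\mathfrak h$, and let $(\ ,\ )$ be its invariant symmetric bilinear form, normalized so that $(\alpha,\alpha)=2$ for every (long) root $\alpha$. Let $V=L_{\widehat{\mathfrak g}}(1,0)$ be the affine vertex operator algebra of level $1$, i.e. the irreducible level-$1$ module for $\widehat{\mathfrak g}=\mathfrak g\otimes\mathbf C[t,t^{-1}]\oplus\mathbf CK$ with a nonzero vacuum vector $\mathbf 1$ killed by all $x(n)=x\otimes t^n$ with $n\ge 0$; its subspace $V_1=\{x(-1)\mathbf 1: x\in\mathfrak g\}$ of conformal weight one is a Lie algebra isomorphic to $\mathfrak g$ under $[u,v]=u(0)v$. Let $\theta$ be an inverting involution: an automorphism of $\mathfrak g$ with $\theta(h)=-h$ for all $h\in\mathfrak h$, extended to $V$ by $\theta(\mathbf 1)=\mathbf 1$ and $\theta(x(n)v)=(\theta x)(n)\theta(v)$. Let $\mathfrak g^+=(V^+)_1$ be the Lie algebra of $\theta$-fixed states of conformal weight one. If $\mathfrak g=A_1$, then $\mathfrak g^+$ is abelian of dimension one, $\mathfrak g^+=\mathbf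 C$. In all other cases $\mathfrak g^+$ is semisimple, and its simple components and their levels are as follows, where $m\ge 2$, $X_{\ell,k}$ denotes a component of type $X_\ell$ and level $k$, a power denotes the number of copies, and $D_{2,k}=A_{1,k}^2$, $D_{3,k}=A_{3,k}$: - $A_2\mapsto A_{1,4}$; - $A_{2m}\mapsto B_{m,2}$; - $A_{2m-1}\mapsto D_{m,2}$; - $D_{2m}\mapsto D_{m,1}^2$; - $D_{2m+1}\mapsto B_{m,1}^2$; - $E_6\mapsto C_{4,1}$; - $E_7\mapsto A_{7,1}$; - $E_8\mapsto D_{8,1}$. Here a simple component $\mathfrak s$ of $\mathfrak g^+$ has level $k$ if, with $(\ ,\ )_{\mathfrak s}$ the invariant form on $\mathfrak s$ for which long roots have norm $2$, the modes satisfy $[x(p),y(q)]=[x,y](p+q)+k\,(x,y)_{\mathfrak s}\,p\,\delta_{p,-q}$ on $V$ for all $x,y\in\mathfrak s$ and $p,q\in\mathbf Z$, i.e. $\mathfrak s$ acts on $V$ through its affine Lie algebra at level $k$. -/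

import Mathlib

noncomputable section

namespace AffineFixedPoints

open LieAlgebra LieAlgebra.IsKilling

/-! ### Simple Lie algebras by type, and normalized invariant forms -/

/-- Types of connected Dynkin diagrams (the ones needed here); the number is the Lie rank. -/
inductive DynkinType : Type
  | A (n : ℕ)
  | B (n : ℕ)
  | C (n : ℕ)
  | D (n : ℕ)
  | E₆
  | E₇
  | E₈

namespace DynkinType

/-- The Lie rank. -/
def rank : DynkinType → ℕ
  | A n => n
  | B n => n
  | C n => n
  | D n => n
  | E₆ => 6
  | E₇ => 7
  | E₈ => 8

/-- The Cartan matrix, whose `(i, j)` entry is the integer `⟨αᵢ, αⱼ^∨⟩`. -/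
def cartanMatrix : (T : DynkinType) → Matrix (Fin T.rank) (Fin T.rank) ℤ
  | A n => CartanMatrix.A n
  | B n => CartanMatrix.B n
  | C n => CartanMatrix.C n
  | D n => CartanMatrix.D n
  | E₆ => CartanMatrix.E₆
  | E₇ => CartanMatrix.E₇
  | E₈ => CartanMatrix.E₈

end DynkinType

section Lie

variable {L : Type*} [LieRing L] [LieAlgebra ℂ L] [FiniteDimensional ℂ L] [IsKilling ℂ L]
  (H : LieSubalgebra ℂ L) [H.IsCartanSubalgebra]

/-- The root system of `(L, H)` is of type `T`: for some base, the Cartan matrix is that of `T`,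
up to the numbering of the simple roots. -/
def IsOfType (T : DynkinType) : Prop :=
  ∃ (b : (rootSystem H).Base) (e : b.support ≃ Fin T.rank),
    ∀ i j : b.support, b.cartanMatrix i j = T.cartanMatrix (e i) (e j)

/-- A root `α` of an irreducible root system is long if no root is longer. As
`⟨α, β^∨⟩ / ⟨β, α^∨⟩ = (α, α) / (β, β)` for roots `α, β` that are not orthogonal, and as a short
root is not orthogonal to all long roots, this can be read off from the Cartan integers. -/
def IsLongRoot (α : H.root) : Prop :=
  ∀ β : H.root,
    ((rootSystem H).pairingIn ℤ β α).natAbs ≤ ((rootSystem H).pairingIn ℤ α β).natAbs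

/-- The normalized invariant symmetric bilinear form of a simple Lie algebra: `(α, α) = 2` for
every long root `α`. As `α^∨` corresponds to `2 α / (α, α)` under the identification of `H` with
its dual given by the form, `(α, α) = 2` says the same as `(α^∨, α^∨) = 2`. -/
structure IsNormalizedForm (B : LinearMap.BilinForm ℂ L) : Prop where
  symm : B.IsSymm
  invariant : ∀ x y z : L, B ⁅x, y⁆ z = B x ⁅y, z⁆
  long : ∀ α : H.root, IsLongRoot H α →
    B ((rootSystem H).coroot α : L) ((rootSystem H).coroot α : L) = 2

end Lie

/-! ### Modules over affine Lie algebras, and the affine algebra `L_𝔤(k, 0)` -/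

/-- A module `V` of level `k` over the affine Lie algebra `𝔤 ⊗ ℂ[t, t⁻¹] ⊕ ℂ K` that belongs to
the invariant form `B` on `𝔤`: the element `x ⊗ tⁿ` acts by the mode `x(n) = mode n x`, the
central element `K` acts by the scalar `k`, and
`[x(m), y(n)] = [x, y](m + n) + m δ_{m, -n} B(x, y) k`. -/
structure AffineModule (𝔤 : Type*) [LieRing 𝔤] [LieAlgebra ℂ 𝔤] (B : LinearMap.BilinForm ℂ 𝔤)
    (k : ℂ) (V : Type*) [AddCommGroup V] [Module ℂ V] where
  mode : ℤ → 𝔤 →ₗ[ℂ] Module.End ℂ V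
  mode_comm : ∀ (m n : ℤ) (x y : 𝔤) (v : V),
    mode m x (mode n y v) - mode n y (mode m x v) =
      mode (m + n) ⁅x, y⁆ v + (if m + n = 0 then (m : ℂ) * B x y * k else 0) • v

/-- A realization of the affine algebra (WZW model) `L_𝔤(k, 0)`: the irreducible module of level
`k` that has a nonzero vacuum vector, that is, one killed by all `x(n)` with `n ≥ 0`. These
conditions determine it up to isomorphism. As a vertex operator algebra, it is generated by the
states `x(-1)𝟏`, which make up its subspace of conformal weight one, and the `n`-th mode of the
state `x(-1)𝟏` is `x(n)`. -/
structure AffineAlgebra (𝔤 : Type*) [LieRing 𝔤] [LieAlgebra ℂ 𝔤] (B : LinearMap.BilinForm ℂ 𝔤)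
    (k : ℂ) (V : Type*) [AddCommGroup V] [Module ℂ V] extends AffineModule 𝔤 B k V where
  vac : V
  vac_ne_zero : vac ≠ 0
  mode_vac : ∀ (n : ℤ) (x : 𝔤), 0 ≤ n → mode n x vac = 0
  irreducible : ∀ W : Submodule ℂ V,
    (∀ (n : ℤ) (x : 𝔤) (v : V), v ∈ W → mode n x v ∈ W) → W = ⊥ ∨ W = ⊤

namespace AffineAlgebra

variable {𝔤 : Type*} [LieRing 𝔤] [LieAlgebra ℂ 𝔤] {B : LinearMap.BilinForm ℂ 𝔤} {k : ℂ}
  {V : Type*} [AddCommGroup V] [Module ℂ V] (R : AffineAlgebra 𝔤 B k V)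

/-- The state `x(-1)𝟏` of conformal weight one that belongs to `x ∈ 𝔤`. -/
def state : 𝔤 →ₗ[ℂ] V :=
  (LinearMap.applyₗ R.vac) ∘ₗ R.mode (-1)

theorem state_apply (x : 𝔤) : R.state x = R.mode (-1) x R.vac := rfl

/-- The bracket `[u, v] = u(0)v` on the states of weight one is the bracket of `𝔤`. -/
theorem mode_zero_state (x y : 𝔤) : R.mode 0 x (R.state y) = R.state ⁅x, y⁆ := by
  have h := R.mode_comm 0 (-1) x y R.vac
  simpa [state_apply, R.mode_vac 0 x le_rfl] using h

/-- The form `u(1)v = ⟨u, v⟩𝟏` on the states of weight one is `k` times the form `B`. -/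
theorem mode_one_state (x y : 𝔤) : R.mode 1 x (R.state y) = (k * B x y) • R.vac := by
  have h := R.mode_comm 1 (-1) x y R.vac
  simpa [state_apply, R.mode_vac 0 _ le_rfl, R.mode_vac 1 x zero_le_one, mul_comm] using h

/-- The subspace `V₁` of conformal weight one. -/
def weightOne : Submodule ℂ V := LinearMap.range R.state

/-- `Θ` is the automorphism of `L_𝔤(k, 0)` that is induced by the automorphism `θ` of `𝔤`. -/
structure IsInducedBy (Θ : V →ₗ[ℂ] V) (θ : 𝔤 ≃ₗ⁅ℂ⁆ 𝔤) : Prop where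
  map_vac : Θ R.vac = R.vac
  map_mode : ∀ (n : ℤ) (x : 𝔤) (v : V), Θ (R.mode n x v) = R.mode n (θ x) (Θ v)

/-- The subspace `(V⁺)₁` of conformal weight one of the space `V⁺` of fixed points of `Θ`. -/
def fixedWeightOne (Θ : V →ₗ[ℂ] V) : Submodule ℂ V :=
  R.weightOne ⊓ LinearMap.eqLocus Θ LinearMap.id

/-- The subalgebra `𝔰` of `𝔤` is a simple Lie algebra of type `T`, and it has level `l` in `V`:
with respect to the normalized form of `𝔰`, the modes `x(n)` with `x ∈ 𝔰` make `V` a module of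
level `l` over the affine Lie algebra of `𝔰`. -/
def IsComponent (𝔰 : LieSubalgebra ℂ 𝔤) (T : DynkinType) (l : ℕ) : Prop :=
  ∃ (_ : FiniteDimensional ℂ 𝔰) (_ : IsKilling ℂ 𝔰)
    (H : LieSubalgebra ℂ 𝔰) (_ : H.IsCartanSubalgebra) (B' : LinearMap.BilinForm ℂ 𝔰)
    (M : AffineModule 𝔰 B' (l : ℂ) V),
    IsOfType H T ∧ IsNormalizedForm H B' ∧ ∀ (n : ℤ) (x : 𝔰), M.mode n x = R.mode n (x : 𝔤)

/-- The subspace `U` of `V₁` is, as a Lie algebra with levels, the direct sum of an abelian Lie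
algebra of dimension `f` and of simple components whose types and levels are those in the list
`Φ`: it has the extended root system `O^f Φ_{1, k₁} ⋯ Φ_{n, kₙ}`. Here `V₁` is identified with `𝔤`
through `x ↦ x(-1)𝟏`; the summand with index `none` is the abelian one. -/
def HasRootSystem (U : Submodule ℂ V) (f : ℕ) (Φ : List (DynkinType × ℕ)) : Prop :=
  ∃ 𝔰 : Option (Fin Φ.length) → LieSubalgebra ℂ 𝔤,
    (∀ i j, i ≠ j → ∀ x ∈ 𝔰 i, ∀ y ∈ 𝔰 j, ⁅x, y⁆ = 0) ∧
    (∀ x ∈ 𝔰 none, ∀ y ∈ 𝔰 none, ⁅x, y⁆ = 0) ∧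
    FiniteDimensional ℂ (𝔰 none) ∧ Module.finrank ℂ (𝔰 none) = f ∧
    (∀ j : Fin Φ.length, R.IsComponent (𝔰 (some j)) Φ[j].1 Φ[j].2) ∧
    iSupIndep (fun i => (𝔰 i).toSubmodule.map R.state) ∧
    U = ⨆ i, (𝔰 i).toSubmodule.map R.state

end AffineAlgebra

/-- The root system `D_{m, l}`, with the conventions `D₂ = A₁²` and `D₃ = A₃`. -/
def typeD (m l : ℕ) : List (DynkinType × ℕ) :=
  if m = 2 then [(.A 1, l), (.A 1, l)] else if m = 3 then [(.A 3, l)] else [(.D m, l)]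

end AffineFixedPoints

end

noncomputable section

namespace AffineFixedPoints

open LieAlgebra LieAlgebra.IsKilling

/-! ### Recognition of semisimple Lie algebras by their Chevalley generators -/

/-! The form `B` is nondegenerate, so `x ↦ x(-1)𝟏` is injective and the fixed states of weight one
are the image of the fixed subalgebra of `θ` (`state_injective`, `fixedWeightOne_eq`). If `B`
restricts to `l` times the normalized form of a simple subalgebra, the same modes make `V` a module
of level `l` over its affine algebra. So everything is a question about the fixed subalgebra
together with `B`.

Simple subalgebras are recognized by Chevalley generators. The Serre relations need not be checked:
in finite dimension, the relations among `h`, `e`, `f` and Vinberg's positivity of the Cartan matrix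
exclude nonzero abelian ideals (`hasTrivialRadical_of_basis`), and long coroots then give the level
(`ChevalleySystem.isComponent_of_long`).

For types `A` and `D`, the fixed subalgebra is generated by the Berman elements `xᵢ = eᵢ + θ eᵢ`,
which satisfy `[xᵢ, [xᵢ, xⱼ]] = -xⱼ` for neighbours and commute otherwise
(`SimplyLacedFrame.fixedSubalgebra_eq_lieSpan`). On a chain these are the relations of the elements
`Y_{i,i+1}` of an orthogonal Lie algebra, so `A_n` gives `so(n+1)`. On the diagram of `D_N`, the
long chain gives `so(N-1)`, and each of the two end nodes adds a vector `a`, respectively `b`. The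
brackets `[aᵢ, bⱼ]` multiply like the `Yᵢⱼ`, and half sums and half differences give two commuting
copies of `so(N)`. The generators have `B`-norm `-2` in the first case and `-1` in the halves,
whence the levels.

For type `E`, Cayley transforms in pairwise orthogonal roots replace the Cartan subalgebra by one on
which `θ` acts as minus the product of the reflections (`SimplyLacedFrame.exists_cayley_list`). For
`E₇` and `E₈` there are as many orthogonal roots as the rank, and `θ` fixes the new Cartan
subalgebra. It then acts on root vectors by signs, which Weyl reflections bring to the parity of one
coefficient of the root. The roots of even parity form `A₇` and `D₈`, as in Borel–de Siebenthal
theory. For `E₆`, four orthogonal roots turn `θ` into the diagram automorphism with a sign `-1` on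
some fixed roots, and folding gives `C₄`. -/

/-- A generalized Cartan matrix of finite type, in Vinberg's characterization. -/
def IsFiniteTypeMatrix {ι : Type*} [Fintype ι] (A : Matrix ι ι ℤ) : Prop :=
  (∀ i, A i i = 2) ∧ (∀ i j, i ≠ j → A i j ≤ 0) ∧
    ∃ u : ι → ℤ, (∀ i, 0 < u i) ∧ ∀ j, 0 < ∑ i, A j i * u i

/-- Scaling the columns by `u` makes the matrix strictly diagonally dominant by rows: positivity of
`A u` says precisely that the diagonal entry outweighs the others. -/
theorem IsFiniteTypeMatrix.det_ne_zero {ι : Type*} [Fintype ι] [DecidableEq ι]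
    {A : Matrix ι ι ℤ} (hA : IsFiniteTypeMatrix A) : A.det ≠ 0 := by
  obtain ⟨hdiag, hoff, u, hu, hAu⟩ := hA
  have key : ((A * Matrix.diagonal u).map (Int.castRingHom ℝ)).det ≠ 0 := by
    apply det_ne_zero_of_sum_row_lt_diag
    intro k
    simp only [Matrix.map_apply, Matrix.mul_diagonal, hdiag, eq_intCast, Int.norm_cast_real]
    have h1 : ∀ j ∈ Finset.univ.erase k, ‖A k j * u j‖ = ((-(A k j * u j) : ℤ) : ℝ) := by
      intro j hj
      rw [Int.norm_eq_abs]
      have := mul_nonpos_of_nonpos_of_nonneg (hoff k j (Finset.ne_of_mem_erase hj).symm) (hu j).le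
      rw [← Int.cast_abs, abs_of_nonpos this]
    rw [Finset.sum_congr rfl h1, ← Int.cast_sum, Int.norm_eq_abs, ← Int.cast_abs,
      abs_of_pos (by have := hu k; positivity), Int.cast_lt]
    have := hAu k
    rw [← Finset.add_sum_erase _ _ (Finset.mem_univ k), hdiag] at this
    rw [Finset.sum_neg_distrib]
    linarith
  intro h0
  apply key
  have h := RingHom.map_det (Int.castRingHom ℝ) (A * Matrix.diagonal u)
  rw [RingHom.mapMatrix_apply] at h
  rw [← h, Matrix.det_mul, h0]
  simp

/-! ### Vanishing of the radical from Vinberg's positivity -/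

section TrivialRadical

open LieModule

variable {ι L : Type*} [Fintype ι] [LieRing L] [LieAlgebra ℂ L]
  [FiniteDimensional ℂ L] {H : LieSubalgebra ℂ L} (b : LieAlgebra.Basis ι H)

/-- The spaces of these weights already span `L` by the triangular decomposition, and generalized
weight spaces are independent, so no other weight can occur. -/
theorem weight_eq_sum_baseSupp {x : L} (hx0 : x ≠ 0) (χ : Module.Dual ℂ H)
    (hx : ∀ h : H, ⁅(h : L), x⁆ = χ h • x) :
    χ = 0 ∨ (∃ n : ι → ℕ, n ≠ 0 ∧ χ = ∑ i, n i • b.baseSupp i) ∨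
      (∃ n : ι → ℕ, n ≠ 0 ∧ χ = -∑ i, n i • b.baseSupp i) := by
  have _ := b.isCartanSubalgebra
  have _ := b.isLieAbelian_cartan
  let s : Set (H → ℂ) := {0} ∪
    {f | ∃ n : ι → ℕ, n ≠ 0 ∧ f = -∑ i, n i • b.baseSupp i} ∪
    {f | ∃ n : ι → ℕ, n ≠ 0 ∧ f =  ∑ i, n i • b.baseSupp i}
  have hs : ⨆ α ∈ s, rootSpace H α = ⊤ := by
    have := b.iSup_cartan_borelLower_borelUpper_eq_top
    rw [b.borelLower_eq, b.borelUpper_eq, b.cartan_eq] at this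
    rw [iSup_union, iSup_union]
    simpa [iSup_and, iSup_comm (ι := H → ℂ)] using this
  have hne : rootSpace H (χ : H → ℂ) ≠ ⊥ := by
    intro h
    apply hx0
    have : x ∈ rootSpace H (χ : H → ℂ) := by
      rw [mem_genWeightSpace]
      intro y
      refine ⟨1, ?_⟩
      simp [hx]
    rw [h] at this
    simpa using this
  have := (iSupIndep_genWeightSpace ℂ H L).mem_of_biSup_eq_top hs hne
  rcases this with (h | ⟨n, hn, h⟩) | ⟨n, hn, h⟩
  · left
    ext y
    exact congrFun h y
  · right; right
    refine ⟨n, hn, ?_⟩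
    ext y
    simpa using congrFun h y
  · right; left
    refine ⟨n, hn, ?_⟩
    ext y
    simpa using congrFun h y

include b in
theorem mem_of_forall_lie_eq_zero {x : L} (hx : ∀ h : H, ⁅(h : L), x⁆ = 0) : x ∈ H := by
  have _ := b.isCartanSubalgebra
  have _ := b.isLieAbelian_cartan
  have : x ∈ rootSpace H (0 : H → ℂ) := by
    rw [mem_genWeightSpace]
    intro y
    refine ⟨1, ?_⟩
    simp [hx]
  rw [← b.cartan_eq] at this
  simpa using this

omit [FiniteDimensional ℂ L] in
theorem lie_h_eq {x : L} (χ : Module.Dual ℂ H)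
    (hx : ∀ h : H, ⁅(h : L), x⁆ = χ h • x) (i : ι) : ⁅b.h i, x⁆ = χ (b.h' i) • x :=
  hx (b.h' i)

/-- A vector of least height is killed by all `f i`, since lowering it lands in weight zero, hence
in `I ∩ H = 0`, or at smaller height. As a lowest weight vector it pairs nonpositively with all
simple coroots, which positivity of `A u` forbids for a positive weight. -/
theorem positive_weight_not_mem_ideal (hA : IsFiniteTypeMatrix b.A) (I : LieIdeal ℂ L)
    (hI : ∀ x ∈ I, x ∈ H → x = 0) (n : ι → ℕ) (hn : n ≠ 0) {x : L} (hxI : x ∈ I)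
    (hx : ∀ h : H, ⁅(h : L), x⁆ = (∑ i, n i • b.baseSupp i) h • x) : x = 0 := by
  classical
  have _ := b.isCartanSubalgebra
  have _ := b.isLieAbelian_cartan
  induction hN : ∑ i, n i using Nat.strong_induction_on generalizing n x with
  | _ N ih =>
  subst hN
  by_contra hx0
  have hf : ∀ i, ⁅b.f i, x⁆ = 0 := by
    intro i
    by_contra hy0
    have hyI : ⁅b.f i, x⁆ ∈ I := lie_mem_right ℂ L I _ _ hxI
    have hy : ∀ h : H, ⁅(h : L), ⁅b.f i, x⁆⁆ =
        (∑ j, n j • b.baseSupp j - b.baseSupp i) h • ⁅b.f i, x⁆ := by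
      intro h
      have h2 : ⁅(h : L), b.f i⁆ = -(b.baseSupp i h • b.f i) := by
        rw [b.baseSupp_apply_smul_f, neg_neg]; rfl
      rw [leibniz_lie, h2, hx h]
      simp only [neg_lie, smul_lie, lie_smul, LinearMap.sub_apply, sub_smul]
      abel
    have hli := Fintype.linearIndependent_iff.mp b.linearIndependent_baseSupp
    have hsingle : b.baseSupp i = ∑ j, (Pi.single i 1 : ι → ℕ) j • b.baseSupp j := by
      simp [Pi.single_apply, ite_smul]
    rcases weight_eq_sum_baseSupp b hy0 _ hy with h | ⟨m, hm, h⟩ | ⟨m, hm, h⟩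
    · apply hy0
      refine hI _ hyI (mem_of_forall_lie_eq_zero b fun t ↦ ?_)
      rw [hy t, h]; simp
    · refine hy0 (ih (∑ j, m j) ?_ m hm hyI (fun t ↦ by rw [hy t, h]) rfl)
      have : ∀ j, n j = m j + (Pi.single i 1 : ι → ℕ) j := by
        intro j
        have h3 := hli (fun j ↦ (n j : ℂ) - m j - ((Pi.single i 1 : ι → ℕ) j : ℕ)) (by
          simp only [sub_smul, Finset.sum_sub_distrib, Nat.cast_smul_eq_nsmul]
          rw [← hsingle, ← h]; abel) j
        have h4 : (n j : ℂ) = (m j + (Pi.single i 1 : ι → ℕ) j : ℕ) := by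
          push_cast; linear_combination h3
        exact_mod_cast h4
      simp_rw [this, Finset.sum_add_distrib]
      simp
    -- A negative weight would give `n + m = eᵢ` with `n` and `m` both nonzero.
    · have : ∀ j, n j + m j = (Pi.single i 1 : ι → ℕ) j := by
        intro j
        have h3 := hli (fun j ↦ (n j : ℂ) + m j - ((Pi.single i 1 : ι → ℕ) j : ℕ)) (by
          simp only [sub_smul, add_smul, Finset.sum_add_distrib, Finset.sum_sub_distrib,
            Nat.cast_smul_eq_nsmul]
          rw [← hsingle, ← sub_eq_zero.mpr h]; abel) j
        have h4 : ((n j + m j : ℕ) : ℂ) = ((Pi.single i 1 : ι → ℕ) j : ℕ) := by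
          push_cast; linear_combination h3
        exact_mod_cast h4
      obtain ⟨j, hj⟩ := Function.ne_iff.mp hn
      obtain ⟨k, hk⟩ := Function.ne_iff.mp hm
      have h1 := this j
      have h2 := this k
      simp only [Pi.zero_apply, Pi.single_apply] at *
      split_ifs at h1 h2 with e1 e2
      · subst e1 e2; omega
      all_goals omega
  obtain ⟨hdiag, hoff, u, hu, hAu⟩ := hA
  have hle : ∀ i, ∑ j, (n j : ℤ) * b.A j i ≤ 0 := by
    intro i
    have t := (b.sl2 i).symm
    -- In the reversed triple `(-h, f, e)` the vector `x` is primitive, so minus its pairing with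
    -- the coroot is a natural number.
    have hp : t.HasPrimitiveVectorWith x (-((∑ j, n j • b.baseSupp j) (b.h' i)) : ℂ) :=
      ⟨hx0, by rw [neg_lie, lie_h_eq b _ hx, neg_smul], hf i⟩
    obtain ⟨k, hk⟩ := hp.exists_nat
    have h1 : (((∑ j, (n j : ℤ) * b.A j i : ℤ)) : ℂ) = ((-k : ℤ) : ℂ) := by
      push_cast
      rw [← hk]
      simp
    have h2 : ∑ j, (n j : ℤ) * b.A j i = -k := by exact_mod_cast h1
    omega
  -- Weighted by `u`, the inequalities add up to `∑ nⱼ (A u)ⱼ ≤ 0`, while every `(A u)ⱼ` is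
  -- positive.
  have h1 : ∑ i, u i * ∑ j, (n j : ℤ) * b.A j i ≤ 0 :=
    Finset.sum_nonpos fun i _ ↦ mul_nonpos_of_nonneg_of_nonpos (hu i).le (hle i)
  have h2 : ∑ i, u i * ∑ j, (n j : ℤ) * b.A j i = ∑ j, (n j : ℤ) * ∑ i, b.A j i * u i := by
    simp_rw [Finset.mul_sum]
    rw [Finset.sum_comm]
    refine Finset.sum_congr rfl fun _ _ ↦ Finset.sum_congr rfl fun _ _ ↦ by ring
  have h3 : 0 < ∑ j, (n j : ℤ) * ∑ i, b.A j i * u i := by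
    obtain ⟨j, hj⟩ := Function.ne_iff.mp hn
    refine Finset.sum_pos' (fun i _ ↦ mul_nonneg (by positivity) (hAu i).le)
      ⟨j, Finset.mem_univ _, ?_⟩
    exact mul_pos (by simpa [Nat.pos_iff_ne_zero] using hj) (hAu j)
  omega

/-- An abelian ideal meets `H` trivially: an element on which `αⱼ` does not vanish would put `eⱼ`
and `fⱼ` into the ideal, although `[eⱼ, fⱼ] = hⱼ ≠ 0`. A nonzero ideal also contains a weight vector
for `H`, which is then excluded sign by sign. -/
theorem hasTrivialRadical_of_basis (hA : IsFiniteTypeMatrix b.A) : HasTrivialRadical ℂ L := by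
  rw [hasTrivialRadical_iff_no_abelian_ideals]
  intro I hI
  have _ := b.isCartanSubalgebra
  have _ := b.isLieAbelian_cartan
  have hab : ∀ x ∈ I, ∀ y ∈ I, ⁅x, y⁆ = 0 := by
    intro x hx y hy
    have := hI.trivial ⟨x, hx⟩ ⟨y, hy⟩
    simpa using congrArg (Subtype.val) this
  have hIH : ∀ x ∈ I, x ∈ H → x = 0 := by
    intro x hx hxH
    have h0 : ∀ j, b.baseSupp j ⟨x, hxH⟩ = 0 := by
      intro j
      by_contra hj
      have he : b.e j ∈ I := by
        have h1 : ⁅x, b.e j⁆ ∈ I := lie_mem_left ℂ L I _ _ hx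
        have h2 := b.baseSupp_apply_smul_e j ⟨x, hxH⟩
        have h3 : b.e j = (b.baseSupp j ⟨x, hxH⟩)⁻¹ • ⁅x, b.e j⁆ := by
          rw [show ⁅x, b.e j⁆ = _ from h2.symm, smul_smul, inv_mul_cancel₀ hj, one_smul]
        rw [h3]
        exact I.smul_mem _ h1
      have hf : b.f j ∈ I := by
        have h1 : ⁅x, b.f j⁆ ∈ I := lie_mem_left ℂ L I _ _ hx
        have h2 := b.baseSupp_apply_smul_f j ⟨x, hxH⟩
        have h3 : b.f j = -(b.baseSupp j ⟨x, hxH⟩)⁻¹ • ⁅x, b.f j⁆ := by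
          rw [show ⁅x, b.f j⁆ = -_ from (neg_eq_iff_eq_neg.mpr h2).symm, neg_smul_neg,
            smul_smul, inv_mul_cancel₀ hj, one_smul]
        rw [h3]
        exact I.smul_mem _ h1
      have := hab _ he _ hf
      rw [(b.sl2 j).lie_e_f] at this
      exact (b.sl2 j).h_ne_zero this
    -- The simple roots are independent and there are as many of them as the dimension of `H`, so
    -- they span its dual.
    have hspan : ⊤ ≤ Submodule.span ℂ (Set.range b.baseSupp) := by
      rw [b.linearIndependent_baseSupp.span_eq_top_of_card_eq_finrank' ?_]
      rw [Subspace.dual_finrank_eq]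
      have := finrank_span_eq_card b.linInd
      rw [← this, ← b.coe_cartan_eq_span]
      rfl
    have hz : (⟨x, hxH⟩ : H) = 0 := by
      rw [← Module.forall_dual_apply_eq_zero_iff ℂ]
      intro φ
      have hφ := hspan (Submodule.mem_top (x := φ))
      induction hφ using Submodule.span_induction with
      | mem u hu => obtain ⟨i, rfl⟩ := hu; exact h0 i
      | zero => rfl
      | add u v _ _ hu hv => simp [hu, hv]
      | smul t u _ hu => simp [hu]
    simpa using congrArg Subtype.val hz
  by_contra hne
  have _ : Nontrivial I := (LieSubmodule.nontrivial_iff_ne_bot ℂ L L).mpr hne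
  obtain ⟨χ, hχ⟩ := LieModule.exists_nontrivial_weightSpace_of_isNilpotent ℂ H I
  obtain ⟨⟨⟨x, hxI⟩, hxχ⟩, hx0⟩ := exists_ne (0 : weightSpace I χ)
  have hx0 : x ≠ 0 := by
    rintro rfl
    exact hx0 rfl
  have hx : ∀ h : H, ⁅(h : L), x⁆ = χ h • x := by
    intro h
    rw [mem_weightSpace] at hxχ
    simpa using congrArg Subtype.val (hxχ h)
  rcases weight_eq_sum_baseSupp b hx0 χ hx with h | ⟨m, hm, h⟩ | ⟨m, hm, h⟩
  · exact hx0 (hIH x hxI (mem_of_forall_lie_eq_zero b fun t ↦ by rw [hx t, h]; simp))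
  · exact hx0 (positive_weight_not_mem_ideal b hA I hIH m hm hxI fun t ↦ by rw [hx t, h])
  -- Exchanging the `e i` and the `f i` turns negative weights into positive ones.
  · refine hx0 (positive_weight_not_mem_ideal b.symm hA I hIH m hm hxI fun t ↦ ?_)
    rw [hx t, h]
    simp

end TrivialRadical

/-! ### Chevalley generators without the Serre relations -/

section Recognition

variable {𝔤 : Type*} [LieRing 𝔤] [LieAlgebra ℂ 𝔤]

/-- Chevalley generators for the Cartan matrix `A`, without the Serre relations. -/
structure ChevalleySystem {ι : Type*} (A : Matrix ι ι ℤ) (h e f : ι → 𝔤) : Prop where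
  h_ne_zero : ∀ i, h i ≠ 0
  lie_e_f : ∀ i, ⁅e i, f i⁆ = h i
  lie_e_f_ne : ∀ i j, i ≠ j → ⁅e i, f j⁆ = 0
  lie_h_h : ∀ i j, ⁅h i, h j⁆ = 0
  lie_h_e : ∀ i j, ⁅h j, e i⁆ = A i j • e i
  lie_h_f : ∀ i j, ⁅h j, f i⁆ = -A i j • f i

namespace ChevalleySystem

variable {ι : Type*} {A : Matrix ι ι ℤ} {h e f : ι → 𝔤}

omit [LieAlgebra ℂ 𝔤] in
theorem sl2 (S : ChevalleySystem A h e f) (hA : ∀ i, A i i = 2) (i : ι) :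
    IsSl2Triple (h i) (e i) (f i) where
  h_ne_zero := S.h_ne_zero i
  lie_e_f := S.lie_e_f i
  lie_h_e_nsmul := by rw [S.lie_h_e, hA]; simp [two_smul]
  lie_h_f_nsmul := by rw [S.lie_h_f, hA]; simp [two_smul]

/-- The subalgebra generated by a Chevalley system. -/
def subalgebra (_ : ChevalleySystem A h e f) : LieSubalgebra ℂ 𝔤 :=
  LieSubalgebra.lieSpan ℂ 𝔤 (Set.range e ∪ Set.range f)

theorem e_mem (S : ChevalleySystem A h e f) (i : ι) : e i ∈ S.subalgebra :=
  LieSubalgebra.subset_lieSpan (Or.inl ⟨i, rfl⟩)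

theorem f_mem (S : ChevalleySystem A h e f) (i : ι) : f i ∈ S.subalgebra :=
  LieSubalgebra.subset_lieSpan (Or.inr ⟨i, rfl⟩)

theorem h_mem (S : ChevalleySystem A h e f) (i : ι) : h i ∈ S.subalgebra := by
  rw [← S.lie_e_f]
  exact LieSubalgebra.lie_mem _ (S.e_mem i) (S.f_mem i)

/-- Applying a linear relation among the `h i` to each `e j` puts its coefficients into the kernel
of the invertible matrix `A`. -/
theorem linearIndependent_h [Fintype ι] (S : ChevalleySystem A h e f)
    (hA : IsFiniteTypeMatrix A) : LinearIndependent ℂ h := by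
  classical
  rw [Fintype.linearIndependent_iff]
  intro g hg
  have h1 : ((Int.castRingHom ℂ).mapMatrix A).mulVec g = 0 := by
    ext j
    have h2 : ⁅∑ i, g i • h i, e j⁆ = 0 := by rw [hg, zero_lie]
    have h3 : ⁅∑ i, g i • h i, e j⁆ = (∑ i, (A j i : ℂ) * g i) • e j := by
      rw [sum_lie, Finset.sum_smul]
      refine Finset.sum_congr rfl fun i _ ↦ ?_
      rw [smul_lie, S.lie_h_e, ← Int.cast_smul_eq_zsmul ℂ, smul_smul, mul_comm]
    rw [h3] at h2
    have h4 := (smul_eq_zero.mp h2).resolve_right (S.sl2 hA.1 j).e_ne_zero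
    simpa [Matrix.mulVec, dotProduct] using h4
  have hdet : ((Int.castRingHom ℂ).mapMatrix A).det ≠ 0 := by
    rw [← RingHom.map_det]
    simpa using hA.det_ne_zero
  have := Matrix.eq_zero_of_mulVec_eq_zero hdet h1
  intro i
  rw [this]; rfl

/-- The Cartan subalgebra of the subalgebra generated by a Chevalley system. -/
def cartan (S : ChevalleySystem A h e f) : LieSubalgebra ℂ S.subalgebra :=
  LieSubalgebra.lieSpan ℂ S.subalgebra (Set.range fun i ↦ ⟨h i, S.h_mem i⟩)

/-- A Chevalley system is a basis, in the sense of Geck, of the subalgebra it generates. -/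
def basis [Fintype ι] (S : ChevalleySystem A h e f) (hA : IsFiniteTypeMatrix A) :
    LieAlgebra.Basis ι S.cartan where
  A := A
  h i := ⟨h i, S.h_mem i⟩
  e i := ⟨e i, S.e_mem i⟩
  f i := ⟨f i, S.f_mem i⟩
  cartan_eq_lieSpan := rfl
  span_ef := by
    set s : Set S.subalgebra := (Set.range fun i ↦ ⟨e i, S.e_mem i⟩) ∪
      (Set.range fun i ↦ ⟨f i, S.f_mem i⟩) with hs
    rw [eq_top_iff]
    rintro ⟨x, hx⟩ -
    have hle : S.subalgebra ≤ (LieSubalgebra.lieSpan ℂ S.subalgebra s).map S.subalgebra.incl := by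
      refine LieSubalgebra.lieSpan_le.mpr ?_
      rintro _ (⟨i, rfl⟩ | ⟨i, rfl⟩)
      · exact ⟨⟨e i, S.e_mem i⟩, LieSubalgebra.subset_lieSpan (Or.inl ⟨i, rfl⟩), rfl⟩
      · exact ⟨⟨f i, S.f_mem i⟩, LieSubalgebra.subset_lieSpan (Or.inr ⟨i, rfl⟩), rfl⟩
    obtain ⟨y, hy, hyx⟩ := hle hx
    have : y = ⟨x, hx⟩ := Subtype.ext hyx
    exact this ▸ hy
  linInd := by
    have := S.linearIndependent_h hA
    exact LinearIndependent.of_comp S.subalgebra.toSubmodule.subtype this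
  nondegen := by
    classical
    exact Matrix.nondegenerate_iff_det_ne_zero.mpr hA.det_ne_zero
  sl2 i :=
    { h_ne_zero := fun h0 ↦ S.h_ne_zero i (congrArg Subtype.val h0)
      lie_e_f := Subtype.ext (S.lie_e_f i)
      lie_h_e_nsmul := Subtype.ext (S.sl2 hA.1 i).lie_h_e_nsmul
      lie_h_f_nsmul := Subtype.ext (S.sl2 hA.1 i).lie_h_f_nsmul }
  lie_h_h i j := Subtype.ext (S.lie_h_h i j)
  lie_h_e i j := Subtype.ext (S.lie_h_e i j)
  lie_h_f i j := Subtype.ext (S.lie_h_f i j)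
  lie_e_f_ne i j hij := Subtype.ext (S.lie_e_f_ne i j hij)

end ChevalleySystem

/-! ### Normalization of invariant forms, tested on simple coroots -/

section Form

variable {L : Type*} [LieRing L] [LieAlgebra ℂ L] [FiniteDimensional ℂ L] [IsKilling ℂ L]
  {ι : Type*} [Fintype ι] {H : LieSubalgebra ℂ L} (b : LieAlgebra.Basis ι H)

-- Invariance gives `B(hᵢ, t) = αᵢ(t) B(eᵢ, fᵢ)`, and `t = hᵢ` expresses the constant through the
-- norm of `hᵢ`. This makes `B` invariant under simple reflections.
omit [IsKilling ℂ L] [FiniteDimensional ℂ L] in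
theorem form_h_eq (B : LinearMap.BilinForm ℂ L)
    (hinv : ∀ x y z : L, B ⁅x, y⁆ z = B x ⁅y, z⁆) (i : ι) (t : H) :
    2 * B (b.h i) (t : L) = b.baseSupp i t * B (b.h i) (b.h i) := by
  have h1 : ∀ t : H, B (b.h i) (t : L) = b.baseSupp i t * B (b.e i) (b.f i) := by
    intro t
    have h2 : ⁅b.f i, (t : L)⁆ = b.baseSupp i t • b.f i := by
      rw [← lie_skew, b.baseSupp_apply_smul_f]; rfl
    rw [← (b.sl2 i).lie_e_f, hinv, h2, map_smul, smul_eq_mul]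
  have h3 := h1 (b.h' i)
  have h4 : B (b.h i) (b.h i) = 2 * B (b.e i) (b.f i) := by
    have _ : IsAddTorsionFree L := .of_isTorsionFree ℂ L
    rw [b.baseSupp_apply_h', b.A_diag_eq_two i] at h3
    exact_mod_cast h3
  rw [h1 t, h4]; ring

/-- The predicates `P` in the hypothesis `hlong` are satisfied by the predicate of being long. -/
theorem isNormalizedForm_of_basis [hH : H.IsCartanSubalgebra] (B : LinearMap.BilinForm ℂ L)
    (hinv : ∀ x y z : L, B ⁅x, y⁆ z = B x ⁅y, z⁆) (hs : B.IsSymm)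
    (hlong : ∀ P : ι → Prop, (∀ i j, P i → (b.A j i).natAbs ≤ (b.A i j).natAbs) →
      (∀ i j, b.A i j = -1 → b.A j i = -1 → P i → P j) → ∀ i, P i → B (b.h i) (b.h i) = 2) :
    IsNormalizedForm H B := by
  refine ⟨hs, hinv, fun α ↦ ?_⟩
  have hcm : ∀ i j : ι, (rootSystem H).pairingIn ℤ (b.baseSupportEquiv i) (b.baseSupportEquiv j) =
      b.A i j := by
    intro i j
    have := congrFun (congrFun b.cartanMatrix_base_eq (b.baseSupportEquiv i)) (b.baseSupportEquiv j)
    rw [Matrix.reindex_apply, Matrix.submatrix_apply, Equiv.symm_apply_apply,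
      Equiv.symm_apply_apply] at this
    exact this
  have hrefl : ∀ (α : H.root) (i : ι),
      B ((rootSystem H).coroot ((rootSystem H).reflectionPerm (b.baseSupportEquiv i) α) : L)
        ((rootSystem H).coroot ((rootSystem H).reflectionPerm (b.baseSupportEquiv i) α) : L) =
      B ((rootSystem H).coroot α : L) ((rootSystem H).coroot α : L) := by
    intro α i
    rw [RootPairing.coroot_reflectionPerm, RootPairing.coreflection_apply]
    set t := (rootSystem H).coroot α
    have h1 : ((rootSystem H).coroot (b.baseSupportEquiv i) : L) = b.h i :=
      congrArg Subtype.val (b.coroot_eq_h' i)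
    have h2 := form_h_eq b B hinv i t
    have h3 : ((rootSystem H).toLinearMap ((rootSystem H).root (b.baseSupportEquiv i)) t) =
      b.baseSupp i t := rfl
    have h4 : B (t : L) (b.h i) = B (b.h i) (t : L) := hs.eq _ _
    rw [show (rootSystem H).root' (b.baseSupportEquiv i) t = b.baseSupp i t from rfl]
    simp only [AddSubgroupClass.coe_sub, SetLike.val_smul, h1, map_sub, map_smul,
      LinearMap.sub_apply, LinearMap.smul_apply, smul_eq_mul, h4]
    linear_combination (-(b.baseSupp i t)) * h2
  have hlrefl : ∀ (α : H.root) (i : ι), IsLongRoot H α →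
      IsLongRoot H ((rootSystem H).reflectionPerm (b.baseSupportEquiv i) α) := by
    intro α i hl β
    have := hl ((rootSystem H).reflectionPerm (b.baseSupportEquiv i) β)
    rwa [RootPairing.pairingIn_reflectionPerm, ← RootPairing.pairingIn_reflectionPerm] at this
  have hladj : ∀ i j, b.A i j = -1 → b.A j i = -1 → IsLongRoot H (b.baseSupportEquiv i) →
      IsLongRoot H (b.baseSupportEquiv j) := by
    intro i j hij hji hl
    have h1 := hlrefl _ i (hlrefl _ j hl)
    -- For simple roots joined by a simple edge, `sᵢ sⱼ αᵢ = αⱼ`, so length is carried along the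
    -- edge.
    have h2 : (rootSystem H).reflectionPerm (b.baseSupportEquiv i)
        ((rootSystem H).reflectionPerm (b.baseSupportEquiv j) (b.baseSupportEquiv i)) =
        (b.baseSupportEquiv j : H.root) := by
      apply (rootSystem H).root.injective
      have e1 : (rootSystem H).pairing (b.baseSupportEquiv i) (b.baseSupportEquiv j) = -1 := by
        rw [← (rootSystem H).algebraMap_pairingIn ℤ, hcm, hij]; simp
      have e2 : (rootSystem H).pairing (b.baseSupportEquiv j) (b.baseSupportEquiv i) = -1 := by
        rw [← (rootSystem H).algebraMap_pairingIn ℤ, hcm, hji]; simp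
      rw [RootPairing.root_reflectionPerm, RootPairing.root_reflectionPerm,
        RootPairing.reflection_apply_root, map_sub, map_smul, RootPairing.reflection_apply_root,
        RootPairing.reflection_apply_root, e1, e2, RootPairing.pairing_same]
      module
    rwa [h2] at h1
  induction α using b.base.induction_reflect with
  | h₀ α ih =>
    intro hl
    rw [RootPairing.coroot_reflectionPerm, RootPairing.coreflection_apply_self]
    simp only [NegMemClass.coe_neg, map_neg, LinearMap.neg_apply, neg_neg]
    refine ih fun β ↦ ?_
    have := hl β
    rw [RootPairing.pairingIn_reflectionPerm_self_right,
      RootPairing.pairingIn_reflectionPerm_self_left] at this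
    simpa using this
  | h₁ α hα =>
    intro hl
    obtain ⟨i, hi⟩ := b.baseSupportEquiv.surjective ⟨α, hα⟩
    have hi' : α = (b.baseSupportEquiv i : H.root) := by rw [hi]
    subst hi'
    have h1 : ((rootSystem H).coroot (b.baseSupportEquiv i) : L) = b.h i :=
      congrArg Subtype.val (b.coroot_eq_h' i)
    rw [h1]
    refine hlong (fun i ↦ IsLongRoot H (b.baseSupportEquiv i)) (fun i j hl ↦ ?_) hladj i hl
    have := hl (b.baseSupportEquiv j)
    rwa [hcm, hcm] at this
  | h₂ α j ih hj =>
    intro hl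
    obtain ⟨i, hi⟩ := b.baseSupportEquiv.surjective ⟨j, hj⟩
    have hi' : j = (b.baseSupportEquiv i : H.root) := by rw [hi]
    subst hi'
    rw [hrefl]
    refine ih fun β ↦ ?_
    have := hl ((rootSystem H).reflectionPerm (b.baseSupportEquiv i) β)
    rw [← RootPairing.pairingIn_reflectionPerm, ← RootPairing.pairingIn_reflectionPerm] at this
    simpa using this

end Form

variable {B : LinearMap.BilinForm ℂ 𝔤} {V : Type*} [AddCommGroup V] [Module ℂ V]
  (R : AffineAlgebra 𝔤 B 1 V)

/-- With `B' = l⁻¹ B` on the subalgebra, the central term `m B(x, y)` equals `m B'(x, y) l`. Thus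
the level is `l` exactly for the rescaled form, and `B'` is normalized because long simple coroots
have `B`-norm `2 l`. -/
theorem ChevalleySystem.isComponent_of_long [FiniteDimensional ℂ 𝔤] {ι : Type*} [Fintype ι]
    {A : Matrix ι ι ℤ} {h e f : ι → 𝔤} (S : ChevalleySystem A h e f) (hA : IsFiniteTypeMatrix A)
    (hinv : ∀ x y z : 𝔤, B ⁅x, y⁆ z = B x ⁅y, z⁆) (hs : B.IsSymm)
    (T : DynkinType) (ε : ι ≃ Fin T.rank) (hT : ∀ i j, A i j = T.cartanMatrix (ε i) (ε j))
    (l : ℕ) (hl : l ≠ 0)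
    (hlong : ∀ P : ι → Prop, (∀ i j, P i → (A j i).natAbs ≤ (A i j).natAbs) →
      (∀ i j, A i j = -1 → A j i = -1 → P i → P j) → ∀ i, P i → B (h i) (h i) = 2 * l) :
    R.IsComponent S.subalgebra T l := by
  have hl' : (l : ℂ) ≠ 0 := by exact_mod_cast hl
  let b := S.basis hA
  have _ : HasTrivialRadical ℂ S.subalgebra := hasTrivialRadical_of_basis b hA
  have _ : IsKilling ℂ S.subalgebra := inferInstance
  let _ := b.isCartanSubalgebra
  let B' : LinearMap.BilinForm ℂ S.subalgebra := (l : ℂ)⁻¹ • B.restrict S.subalgebra.toSubmodule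
  have hB' : ∀ x y, B' x y = (l : ℂ)⁻¹ * B (x : 𝔤) (y : 𝔤) := fun x y ↦ rfl
  refine ⟨inferInstance, inferInstance, S.cartan, inferInstance, B',
    ⟨fun n ↦ (R.mode n) ∘ₗ S.subalgebra.toSubmodule.subtype, fun m n x y v ↦ ?_⟩, ?_, ?_,
    fun n x ↦ rfl⟩
  · have := R.mode_comm m n x y v
    simp only [LinearMap.comp_apply]
    refine this.trans ?_
    rw [hB']
    congr 2
    have : (m : ℂ) * ((l : ℂ)⁻¹ * B (x : 𝔤) (y : 𝔤)) * l = m * B (x : 𝔤) (y : 𝔤) * 1 := by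
      field_simp
    rw [this]
  · refine ⟨b.base, b.baseSupportEquiv.symm.trans ε, fun i j ↦ ?_⟩
    rw [b.cartanMatrix_base_eq]
    exact hT _ _
  · refine isNormalizedForm_of_basis b B' (fun x y z ↦ ?_) ⟨fun x y ↦ ?_⟩ fun P h1 h2 i hi ↦ ?_
    · rw [hB', hB']
      exact congrArg _ (hinv _ _ _)
    · rw [hB', hB']
      exact congrArg _ (hs.eq _ _)
    · rw [hB']
      have := hlong P h1 h2 i hi
      change (l : ℂ)⁻¹ * B (h i) (h i) = 2
      rw [this]
      field_simp

/-- This version compares a simple root only with its neighbours. It is enough when no short simple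
root passes that test, as in types `B` and the simply laced ones. In `C₄` a short root with only
short neighbours passes it, so the propagating predicate is needed there. -/
theorem ChevalleySystem.isComponent [FiniteDimensional ℂ 𝔤] {ι : Type*} [Fintype ι]
    {A : Matrix ι ι ℤ} {h e f : ι → 𝔤} (S : ChevalleySystem A h e f) (hA : IsFiniteTypeMatrix A)
    (hinv : ∀ x y z : 𝔤, B ⁅x, y⁆ z = B x ⁅y, z⁆) (hs : B.IsSymm)
    (T : DynkinType) (ε : ι ≃ Fin T.rank) (hT : ∀ i j, A i j = T.cartanMatrix (ε i) (ε j))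
    (l : ℕ) (hl : l ≠ 0)
    (hlong : ∀ i, (∀ j, (A j i).natAbs ≤ (A i j).natAbs) → B (h i) (h i) = 2 * l) :
    R.IsComponent S.subalgebra T l :=
  S.isComponent_of_long R hA hinv hs T ε hT l hl fun _ h1 _ i hi ↦ hlong i fun j ↦ h1 i j hi

end Recognition

/-! ### From decompositions of the fixed subalgebra to root systems -/

section Decomposition

variable {𝔤 : Type*} [LieRing 𝔤] [LieAlgebra ℂ 𝔤]

/-- The subalgebra of fixed points of an automorphism. -/
def fixedSubalgebra (θ : 𝔤 ≃ₗ⁅ℂ⁆ 𝔤) : LieSubalgebra ℂ 𝔤 where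
  __ := LinearMap.eqLocus (θ : 𝔤 →ₗ[ℂ] 𝔤) LinearMap.id
  lie_mem' {x y} hx hy := by
    have hx' : θ x = x := hx
    have hy' : θ y = y := hy
    change θ ⁅x, y⁆ = ⁅x, y⁆
    rw [LieEquiv.map_lie, hx', hy']

theorem mem_fixedSubalgebra {θ : 𝔤 ≃ₗ⁅ℂ⁆ 𝔤} {x : 𝔤} : x ∈ fixedSubalgebra θ ↔ θ x = x :=
  Iff.rfl

/-- Two subalgebras commute elementwise. -/
def LieCommute (s t : LieSubalgebra ℂ 𝔤) : Prop := ∀ x ∈ s, ∀ y ∈ t, ⁅x, y⁆ = 0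

theorem LieCommute.symm {s t : LieSubalgebra ℂ 𝔤} (h : LieCommute s t) : LieCommute t s := by
  intro x hx y hy
  rw [← lie_skew, h y hy x hx, neg_zero]

theorem lieCommute_lieSpan {s t : Set 𝔤} (h : ∀ x ∈ s, ∀ y ∈ t, ⁅x, y⁆ = 0) :
    LieCommute (LieSubalgebra.lieSpan ℂ 𝔤 s) (LieSubalgebra.lieSpan ℂ 𝔤 t) := by
  have h1 : ∀ x ∈ s, ∀ y ∈ LieSubalgebra.lieSpan ℂ 𝔤 t, ⁅x, y⁆ = 0 := by
    intro x hx y hy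
    induction hy using LieSubalgebra.lieSpan_induction with
    | mem u hu => exact h x hx u hu
    | zero => simp
    | add u v _ _ hu hv => rw [lie_add, hu, hv, add_zero]
    | smul c u _ hu => rw [lie_smul, hu, smul_zero]
    | lie u v _ _ hu hv => rw [leibniz_lie, hu, hv, zero_lie, lie_zero, add_zero]
  intro x hx y hy
  induction hx using LieSubalgebra.lieSpan_induction with
  | mem u hu => exact h1 u hu y hy
  | zero => simp
  | add u v _ _ hu hv => rw [add_lie, hu, hv, add_zero]
  | smul c u _ hu => rw [smul_lie, hu, smul_zero]
  | lie u v _ _ hu hv => rw [lie_lie, hu, hv, lie_zero, lie_zero, sub_zero]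

/-- If two subalgebras commute, then the subalgebra generated by both is their sum. -/
theorem toSubmodule_sup_eq_of_lieCommute {s t : LieSubalgebra ℂ 𝔤} (h : LieCommute s t) :
    (s ⊔ t).toSubmodule = s.toSubmodule ⊔ t.toSubmodule := by
  let K : LieSubalgebra ℂ 𝔤 :=
    { __ := s.toSubmodule ⊔ t.toSubmodule
      lie_mem' := by
        intro x y hx hy
        obtain ⟨a, ha, b, hb, rfl⟩ := Submodule.mem_sup.mp hx
        obtain ⟨c, hc, d, hd, rfl⟩ := Submodule.mem_sup.mp hy
        refine Submodule.mem_sup.mpr ⟨⁅a, c⁆, s.lie_mem ha hc, ⁅b, d⁆, t.lie_mem hb hd, ?_⟩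
        rw [lie_add, add_lie, add_lie, h a ha d hd, h.symm b hb c hc]
        abel }
  apply le_antisymm
  · have h1 : s ≤ K := fun x hx ↦
      Submodule.mem_sup_left (S := s.toSubmodule) (T := t.toSubmodule) hx
    have h2 : t ≤ K := fun x hx ↦
      Submodule.mem_sup_right (S := s.toSubmodule) (T := t.toSubmodule) hx
    exact fun x hx ↦ (sup_le h1 h2 : s ⊔ t ≤ K) hx
  · exact sup_le (fun x hx ↦ (le_sup_left : s ≤ s ⊔ t) hx)
      (fun x hx ↦ (le_sup_right : t ≤ s ⊔ t) hx)

variable {B : LinearMap.BilinForm ℂ 𝔤} {V : Type*} [AddCommGroup V] [Module ℂ V]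
  (R : AffineAlgebra 𝔤 B 1 V)

/-- The subalgebra `K` is the direct sum of simple components whose types and levels are listed
in `Φ`. -/
def HasDecomposition (K : LieSubalgebra ℂ 𝔤) (Φ : List (DynkinType × ℕ)) : Prop :=
  ∃ S : List (LieSubalgebra ℂ 𝔤), List.Forall₂ (fun s t ↦ R.IsComponent s t.1 t.2) S Φ ∧
    S.Pairwise LieCommute ∧ K.toSubmodule = ⨆ s ∈ S, s.toSubmodule

variable {R}

theorem HasDecomposition.of_isComponent {K : LieSubalgebra ℂ 𝔤} {T : DynkinType} {l : ℕ}
    (h : R.IsComponent K T l) : HasDecomposition R K [(T, l)] :=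
  ⟨[K], .cons h .nil, List.pairwise_singleton _ _, by simp⟩

theorem HasDecomposition.sup {K₁ K₂ : LieSubalgebra ℂ 𝔤} {Φ₁ Φ₂ : List (DynkinType × ℕ)}
    (h₁ : HasDecomposition R K₁ Φ₁) (h₂ : HasDecomposition R K₂ Φ₂) (h : LieCommute K₁ K₂) :
    HasDecomposition R (K₁ ⊔ K₂) (Φ₁ ++ Φ₂) := by
  obtain ⟨S₁, hS₁, hp₁, he₁⟩ := h₁
  obtain ⟨S₂, hS₂, hp₂, he₂⟩ := h₂
  refine ⟨S₁ ++ S₂, List.rel_append hS₁ hS₂, List.pairwise_append.mpr ⟨hp₁, hp₂, ?_⟩, ?_⟩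
  · intro s hs t ht x hx y hy
    refine h x ?_ y ?_
    · rw [← LieSubalgebra.mem_toSubmodule, he₁]
      exact Submodule.mem_iSup_of_mem s (Submodule.mem_iSup_of_mem hs hx)
    · rw [← LieSubalgebra.mem_toSubmodule, he₂]
      exact Submodule.mem_iSup_of_mem t (Submodule.mem_iSup_of_mem ht hy)
  · rw [toSubmodule_sup_eq_of_lieCommute h, he₁, he₂]
    simp only [List.mem_append, iSup_or, iSup_sup_eq]

/-- The commutator of `x(-1)` and `y(1)` on the vacuum produces `-B(x, y)𝟏`, so a vanishing state
forces `x` into the radical of `B`. -/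
theorem state_injective (hB : ∀ x, (∀ y, B x y = 0) → x = 0) : Function.Injective R.state := by
  rw [injective_iff_map_eq_zero]
  intro x hx
  refine hB x fun y ↦ ?_
  have h5 := R.mode_comm (-1) 1 x y R.vac
  have hx' : R.mode (-1) x R.vac = 0 := hx
  rw [R.mode_vac 1 y zero_le_one, map_zero, hx', map_zero] at h5
  simp only [sub_self, neg_add_cancel, R.mode_vac 0 _ le_rfl, zero_add, if_true] at h5
  have h6 := (smul_eq_zero.mp h5.symm).resolve_right R.vac_ne_zero
  push_cast at h6
  linear_combination -h6

theorem fixedWeightOne_eq (hinj : Function.Injective R.state) {θ : 𝔤 ≃ₗ⁅ℂ⁆ 𝔤} {Θ : V →ₗ[ℂ] V}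
    (hΘ : R.IsInducedBy Θ θ) :
    R.fixedWeightOne Θ = (fixedSubalgebra θ).toSubmodule.map R.state := by
  have key : ∀ x, Θ (R.state x) = R.state (θ x) := by
    intro x
    rw [R.state_apply, hΘ.map_mode, hΘ.map_vac, R.state_apply]
  ext v
  constructor
  · rintro ⟨⟨x, rfl⟩, hx⟩
    have hx' : Θ (R.state x) = R.state x := hx
    exact ⟨x, hinj ((key x).symm.trans hx'), rfl⟩
  · rintro ⟨x, hx, rfl⟩
    have hx' : θ x = x := hx
    refine ⟨⟨x, rfl⟩, ?_⟩
    change Θ (R.state x) = R.state x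
    rw [key, hx']

/-- Independence is automatic: an element shared by one component and the sum of the others commutes
with that component, hence is central in a Lie algebra with nondegenerate Killing form and vanishes.
The abelian summand is taken to be zero. -/
theorem HasDecomposition.hasRootSystem (hinj : Function.Injective R.state) {θ : 𝔤 ≃ₗ⁅ℂ⁆ 𝔤}
    {Θ : V →ₗ[ℂ] V} (hΘ : R.IsInducedBy Θ θ) {Φ : List (DynkinType × ℕ)}
    (h : HasDecomposition R (fixedSubalgebra θ) Φ) :
    R.HasRootSystem (R.fixedWeightOne Θ) 0 Φ := by
  obtain ⟨S, hS, hp, he⟩ := h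
  have hlen : S.length = Φ.length := hS.length_eq
  let 𝔰 : Option (Fin Φ.length) → LieSubalgebra ℂ 𝔤 := fun i ↦
    i.elim ⊥ fun j ↦ S.get (j.cast hlen.symm)
  have hcomm : ∀ i j, i ≠ j → ∀ x ∈ 𝔰 i, ∀ y ∈ 𝔰 j, ⁅x, y⁆ = 0 := by
    rintro (_ | i) (_ | j) hij x hx y hy
    · exact absurd rfl hij
    · rw [(LieSubalgebra.mem_bot x).mp hx, zero_lie]
    · rw [(LieSubalgebra.mem_bot y).mp hy, lie_zero]
    · rw [List.pairwise_iff_get] at hp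
      rcases lt_trichotomy i j with hlt | heq | hgt
      · exact hp (i.cast hlen.symm) (j.cast hlen.symm) hlt x hx y hy
      · exact absurd (congrArg some heq) hij
      · exact (hp (j.cast hlen.symm) (i.cast hlen.symm) hgt).symm x hx y hy
  have hcomp : ∀ j : Fin Φ.length, R.IsComponent (𝔰 (some j)) Φ[j].1 Φ[j].2 := by
    intro j
    exact (List.forall₂_iff_get.mp hS).2 j (j.2.trans_eq hlen.symm) j.2
  have hind : iSupIndep fun i ↦ (𝔰 i).toSubmodule := by
    intro i
    rw [Submodule.disjoint_def]
    intro x hx hx'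
    match i, hx, hx' with
    | none, hx, _ => exact (LieSubalgebra.mem_bot x).mp hx
    | some j, hx, hx' =>
      have hz : ∀ y ∈ 𝔰 (some j), ⁅y, x⁆ = 0 := by
        intro y hy
        have hle : (⨆ k, ⨆ (_ : k ≠ some j), (𝔰 k).toSubmodule) ≤
            LinearMap.ker (LieAlgebra.ad ℂ 𝔤 y : 𝔤 →ₗ[ℂ] 𝔤) :=
          iSup₂_le fun k hk z hz ↦ hcomm (some j) k hk.symm y hy z hz
        exact hle hx'
      obtain ⟨_, _, _⟩ := hcomp j
      have hc : (⟨x, hx⟩ : 𝔰 (some j)) ∈ LieAlgebra.center ℂ (𝔰 (some j)) := by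
        rw [LieModule.mem_maxTrivSubmodule]
        intro y
        exact Subtype.ext (hz y y.2)
      rw [LieAlgebra.center_eq_bot] at hc
      exact congrArg Subtype.val ((LieSubmodule.mem_bot _).mp hc)
  refine ⟨𝔰, hcomm, ?_, ?_, ?_, hcomp, ?_, ?_⟩
  · intro x hx y _
    rw [(LieSubalgebra.mem_bot x).mp hx, zero_lie]
  · change FiniteDimensional ℂ (⊥ : Submodule ℂ 𝔤)
    infer_instance
  · exact finrank_bot ℂ 𝔤
  · intro i
    simp only [← Submodule.map_iSup]
    rw [disjoint_iff, ← Submodule.map_inf _ hinj, (hind i).eq_bot, Submodule.map_bot]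
  · rw [fixedWeightOne_eq hinj hΘ, he, ← Submodule.map_iSup]
    congr 1
    apply le_antisymm
    · refine iSup₂_le fun s hs ↦ ?_
      obtain ⟨n, rfl⟩ := List.mem_iff_get.mp hs
      exact le_iSup (fun i ↦ (𝔰 i).toSubmodule) (some (n.cast hlen))
    · refine iSup_le ?_
      rintro (_ | j)
      · exact bot_le
      · exact le_iSup₂_of_le (S.get (j.cast hlen.symm)) (List.get_mem _ _) le_rfl

theorem hasRootSystem_of_abelian (hinj : Function.Injective R.state) {θ : 𝔤 ≃ₗ⁅ℂ⁆ 𝔤}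
    {Θ : V →ₗ[ℂ] V} (hΘ : R.IsInducedBy Θ θ) (x : 𝔤) (hx : x ≠ 0)
    (hspan : (fixedSubalgebra θ).toSubmodule = Submodule.span ℂ {x}) :
    R.HasRootSystem (R.fixedWeightOne Θ) 1 [] := by
  have hmem : ∀ {y}, y ∈ fixedSubalgebra θ → ∃ c : ℂ, c • x = y := by
    intro y hy
    rw [← LieSubalgebra.mem_toSubmodule, hspan] at hy
    exact Submodule.mem_span_singleton.mp hy
  have hno : ∀ i : Option (Fin ([] : List (DynkinType × ℕ)).length), i = none := by
    rintro (_ | ⟨j, hj⟩)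
    · rfl
    · simp at hj
  refine ⟨fun _ ↦ fixedSubalgebra θ, ?_, ?_, ?_, ?_, fun j ↦ absurd j.2 (by simp), ?_, ?_⟩
  · intro i j hij
    exact absurd ((hno i).trans (hno j).symm) hij
  · intro y hy z hz
    obtain ⟨c, rfl⟩ := hmem hy
    obtain ⟨d, rfl⟩ := hmem hz
    simp
  · change FiniteDimensional ℂ (fixedSubalgebra θ).toSubmodule
    rw [hspan]
    infer_instance
  · change Module.finrank ℂ (fixedSubalgebra θ).toSubmodule = 1
    rw [hspan]
    exact finrank_span_singleton hx
  · intro i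
    have h1 : (⨆ j, ⨆ (_ : j ≠ i), (fixedSubalgebra θ).toSubmodule.map R.state) = ⊥ := by
      refine iSup₂_eq_bot.mpr fun j hj ↦ absurd ((hno j).trans (hno i).symm) hj
    rw [h1]
    exact disjoint_bot_right
  · rw [fixedWeightOne_eq hinj hΘ]
    have : Nonempty (Option (Fin ([] : List (DynkinType × ℕ)).length)) := ⟨none⟩
    rw [ciSup_const]

end Decomposition

/-! ### Families of elements that satisfy the relations of an orthogonal Lie algebra -/

section Orthogonal

variable {𝔤 : Type*} [LieRing 𝔤] [LieAlgebra ℂ 𝔤] {ι : Type*} [DecidableEq ι]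

/-- The Kronecker symbol. -/
def kron (i j : ι) : ℂ := if i = j then 1 else 0

@[simp] theorem kron_self (i : ι) : kron i i = 1 := if_pos rfl

theorem kron_of_ne {i j : ι} (h : i ≠ j) : kron i j = 0 := if_neg h

theorem kron_comm (i j : ι) : kron i j = kron j i := by simp only [kron, eq_comm]

/-- The elements `Y i j` satisfy the relations of the standard basis of the Lie algebra of
skew-symmetric matrices. -/
structure SoFamily (Y : ι → ι → 𝔤) : Prop where
  skew : ∀ i j, Y i j = -Y j i
  lie : ∀ i j k l, ⁅Y i j, Y k l⁆ =
    kron j k • Y i l - kron i k • Y j l - kron j l • Y i k + kron i l • Y j k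

/-- The elements `v i` form a vector under the family `Y`, by which `Y` is enlarged to a family
with one more index. -/
structure SoVector (Y : ι → ι → 𝔤) (v : ι → 𝔤) : Prop where
  lie : ∀ i j k, ⁅Y i j, v k⁆ = kron j k • v i - kron i k • v j
  lie_self : ∀ i j, ⁅v i, v j⁆ = -Y i j

theorem SoFamily.apply_self {Y : ι → ι → 𝔤} (hY : SoFamily Y) (i : ι) : Y i i = 0 := by
  have h : (2 : ℂ) • Y i i = 0 := by
    rw [two_smul]
    nth_rw 2 [hY.skew i i]
    exact add_neg_cancel _
  exact (smul_eq_zero.mp h).resolve_left two_ne_zero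

/-- The family with one more index that is given by a vector. -/
def extendFamily (Y : ι → ι → 𝔤) (v : ι → 𝔤) : Option ι → Option ι → 𝔤
  | some i, some j => Y i j
  | some i, none => v i
  | none, some j => -v j
  | none, none => 0

/-- The vector plays the part of the entries `Y i ∞` for the new index, and `lie_self` is the
relation in which `∞` is contracted with itself. -/
theorem SoFamily.extend {Y : ι → ι → 𝔤} (hY : SoFamily Y) {v : ι → 𝔤} (hv : SoVector Y v) :
    SoFamily (extendFamily Y v) where
  skew i j := by
    rcases i with _ | i <;> rcases j with _ | j <;> simp [extendFamily]
    exact hY.skew i j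
  lie i j k l := by
    have hsome : ∀ i j : ι, kron (some i) (some j) = kron i j := fun i j ↦ by simp [kron]
    have hn : ∀ i : ι, kron none (some i) = 0 := fun i ↦ by simp [kron]
    have hn' : ∀ i : ι, kron (some i) none = 0 := fun i ↦ by simp [kron]
    have hlv : ∀ i j k, ⁅v k, Y i j⁆ = kron k i • v j - kron k j • v i := by
      intro i j k
      rw [← lie_skew, hv.lie, kron_comm k i, kron_comm k j]
      abel
    rcases i with _ | i <;> rcases j with _ | j <;> rcases k with _ | k <;> rcases l with _ | l <;>
      simp only [extendFamily, hsome, hn, hn', kron_self, hY.lie, hv.lie, hv.lie_self, lie_neg,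
        neg_lie, lie_zero, zero_lie, hlv] <;> module

theorem SoFamily.comp {Y : ι → ι → 𝔤} (hY : SoFamily Y) {κ : Type*} [DecidableEq κ] (ε : κ ≃ ι) :
    SoFamily fun i j ↦ Y (ε i) (ε j) where
  skew i j := hY.skew _ _
  lie i j k l := by
    have : ∀ i j, kron i j = kron (ε i) (ε j) := fun i j ↦ by simp [kron]
    simp only [hY.lie, this]

/-! ### One further Berman generator gives one further orthogonal index -/

section Vector

variable {Y : ι → ι → 𝔤} (hY : SoFamily Y) {l m : ι} (hlm : m ≠ l) {y : 𝔤}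
  (hcomm : ∀ i j, i ≠ l → j ≠ l → ⁅Y i j, y⁆ = 0) (h₁ : ⁅Y m l, ⁅Y m l, y⁆⁆ = -y)
  (h₂ : ⁅y, ⁅y, Y m l⁆⁆ = -Y m l)
include hY hcomm

/-- As `Y a b` annihilates `y`, the Leibniz rule lets it move only the indices `i` and `k`. This
transports the one known double bracket to all pairs of indices. -/
theorem lie_lie_of_commute {a b i k : ι} (ha : a ≠ l) (hb : b ≠ l) :
    ⁅Y a b, ⁅Y i l, ⁅Y k l, y⁆⁆⁆ = kron b i • ⁅Y a l, ⁅Y k l, y⁆⁆ - kron a i • ⁅Y b l, ⁅Y k l, y⁆⁆ +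
      kron b k • ⁅Y i l, ⁅Y a l, y⁆⁆ - kron a k • ⁅Y i l, ⁅Y b l, y⁆⁆ := by
  have h : ∀ i, ⁅Y a b, Y i l⁆ = kron b i • Y a l - kron a i • Y b l := by
    intro i
    rw [hY.lie, kron_of_ne ha, kron_of_ne hb]
    module
  rw [leibniz_lie, leibniz_lie (Y a b) (Y k l), h, h, hcomm a b ha hb]
  simp only [sub_lie, smul_lie, lie_add, lie_sub, lie_smul, lie_zero]
  module

-- The double bracket is symmetric in `i` and `k`, because `[Y i l, Y k l]` is a multiple of `Y i k`
-- and kills `y`. Starting from the pair `(m, m)`, one rotation by `Y i m` gives the mixed pairs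
-- with `m`, and a second one gives the rest.
include hlm h₁ in
theorem lie_lie_eq_kron {i k : ι} (hi : i ≠ l) (hk : k ≠ l) :
    ⁅Y i l, ⁅Y k l, y⁆⁆ = -(kron i k • y) := by
  have hsymm : ∀ i k, i ≠ l → k ≠ l → ⁅Y i l, ⁅Y k l, y⁆⁆ = ⁅Y k l, ⁅Y i l, y⁆⁆ := by
    intro i k hi hk
    rw [leibniz_lie, hY.lie, kron_of_ne hi, kron_of_ne hk.symm, kron_self, hY.apply_self]
    simp [hcomm i k hi hk]
  have him : ∀ i, i ≠ l → i ≠ m → ⁅Y i l, ⁅Y m l, y⁆⁆ = 0 := by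
    intro i hi him
    have h := lie_lie_of_commute hY hcomm (i := m) (k := m) hi hlm
    rw [h₁, lie_neg, hcomm i m hi hlm, kron_self, kron_of_ne him, hsymm m i hlm hi] at h
    have h' : (2 : ℂ) • ⁅Y i l, ⁅Y m l, y⁆⁆ = 0 := by
      rw [neg_zero] at h
      rw [h]; module
    exact (smul_eq_zero.mp h').resolve_left two_ne_zero
  by_cases hik : i = k
  · subst hik
    by_cases hm : i = m
    · subst hm; simpa using h₁
    · have h := lie_lie_of_commute hY hcomm (i := i) (k := m) hi hlm
      rw [him i hi hm, lie_zero, kron_self, kron_self, kron_of_ne hm, kron_of_ne (Ne.symm hm),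
        h₁] at h
      rw [kron_self]
      have h' : ⁅Y i l, ⁅Y i l, y⁆⁆ + y = 0 := by
        rw [h]; module
      rw [one_smul, eq_neg_iff_add_eq_zero, h']
  · rw [kron_of_ne hik, zero_smul, neg_zero]
    by_cases hkm : k = m
    · subst hkm; exact him i hi hik
    · by_cases hm : i = m
      · subst hm; rw [hsymm i k hi hk]; exact him k hk hkm
      · have h := lie_lie_of_commute hY hcomm (i := i) (k := m) hk hlm
        rw [him i hi hm, lie_zero, kron_self, kron_of_ne (Ne.symm hm), kron_of_ne (Ne.symm hik),
          kron_of_ne hkm] at h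
        rw [h]; module

-- The vector is forced by its entry `y` at `l`: the other entries must be `[Y i l, y]`. The first
-- double bracket relation makes it transform correctly, and the second one fixes the brackets of
-- the entries with each other.
include hlm h₁ h₂ in
theorem exists_soVector : ∃ v : ι → 𝔤, SoVector Y v ∧ v l = y ∧ ∀ i, i ≠ l → v i = ⁅Y i l, y⁆ := by
  classical
  let v : ι → 𝔤 := fun i ↦ if i = l then y else ⁅Y i l, y⁆
  have hvl : v l = y := if_pos rfl
  have hv : ∀ i, i ≠ l → v i = ⁅Y i l, y⁆ := fun i hi ↦ if_neg hi
  have hlast : ∀ i k, i ≠ l → ⁅Y i l, v k⁆ = kron l k • v i - kron i k • v l := by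
    intro i k hi
    by_cases hk : k = l
    · subst hk
      rw [kron_self, kron_of_ne hi, hvl, hv i hi]; module
    · rw [kron_of_ne (Ne.symm hk), hv k hk, lie_lie_eq_kron hY hlm hcomm h₁ hi hk, hvl]; module
  have hlie : ∀ i j k, ⁅Y i j, v k⁆ = kron j k • v i - kron i k • v j := by
    intro i j k
    by_cases hi : i = l
    · subst hi
      by_cases hj : j = i
      · subst hj; rw [hY.apply_self, zero_lie, sub_self]
      · rw [hY.skew, neg_lie, hlast j k hj]; abel
    · by_cases hj : j = l
      · subst hj; exact hlast i k hi
      · by_cases hk : k = l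
        · subst hk
          rw [hvl, hcomm i j hi hj, kron_of_ne hi, kron_of_ne hj]; module
        · rw [hv k hk, hv i hi, hv j hj, leibniz_lie, hcomm i j hi hj, hY.lie, kron_of_ne hi,
            kron_of_ne hj]
          simp only [sub_lie, add_lie, smul_lie, lie_zero]
          module
  have hym : ⁅y, v m⁆ = Y m l := by
    rw [hv m hlm, ← lie_skew (Y m l) y, lie_neg, h₂, neg_neg]
  have hyv : ∀ i, ⁅y, v i⁆ = Y i l := by
    intro i
    by_cases hi : i = l
    · subst hi; rw [hvl, lie_self, hY.apply_self]
    · by_cases him : i = m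
      · rw [him, hym]
      · have h := hlie i m m
        rw [kron_self, kron_of_ne him, one_smul, zero_smul, sub_zero] at h
        have hc : ⁅y, Y i m⁆ = 0 := by rw [← lie_skew, hcomm i m hi hlm, neg_zero]
        rw [← h, leibniz_lie, hc, zero_lie, zero_add, hym, hY.lie, kron_self, kron_of_ne him,
          kron_of_ne hlm, kron_of_ne hi]
        module
  refine ⟨v, ⟨hlie, fun i j ↦ ?_⟩, hvl, hv⟩
  by_cases hi : i = l
  · subst hi; rw [hvl, hyv, hY.skew]
  · nth_rw 1 [hv i hi]
    rw [lie_lie, hyv, hlie, lie_sub, lie_smul, lie_smul, hyv, hvl, lie_self, hY.skew j l, lie_neg,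
      hY.lie, kron_self, kron_of_ne hi, hY.apply_self]
    module

end Vector

/-! ### Two vectors over one orthogonal family: splitting into commuting halves -/

section TwoVectors

variable {Y : ι → ι → 𝔤} (hY : SoFamily Y) {a b : ι → 𝔤} (ha : SoVector Y a) (hb : SoVector Y b)
include hY ha hb

omit hY in
theorem lie_lie_vectors (i j k l : ι) : ⁅Y i j, ⁅a k, b l⁆⁆ =
    kron j k • ⁅a i, b l⁆ - kron i k • ⁅a j, b l⁆ + kron j l • ⁅a k, b i⁆ -
      kron i l • ⁅a k, b j⁆ := by
  rw [leibniz_lie, ha.lie, hb.lie]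
  simp only [sub_lie, smul_lie, lie_sub, lie_smul]
  module

-- The array `[aᵢ, bⱼ]` is moved by `Y` in both indices. Rotating the single equation `[a_l, b_l] =
-- 0` once kills the symmetric entries involving `l`, and rotating again kills all the others.
omit hY in
theorem lie_vectors_skew {l : ι} (h0 : ⁅a l, b l⁆ = 0) (i j : ι) : ⁅a i, b j⁆ = -⁅a j, b i⁆ := by
  have hl : ∀ i, i ≠ l → ⁅a i, b l⁆ = -⁅a l, b i⁆ := by
    intro i hi
    have h := lie_lie_vectors ha hb i l l l
    rw [h0, lie_zero, kron_self, kron_of_ne hi] at h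
    rw [eq_neg_iff_add_eq_zero, h]; module
  have hd : ∀ i, i ≠ l → ⁅a i, b i⁆ = 0 := by
    intro i hi
    have h3 := congrArg (fun z ↦ ⁅Y i l, z⁆) (hl i hi)
    simp only [lie_neg, lie_lie_vectors ha hb, kron_self, kron_of_ne hi, kron_of_ne (Ne.symm hi),
      h0] at h3
    have h' : (2 : ℂ) • ⁅a i, b i⁆ = 0 := by
      have h4 : ⁅a i, b i⁆ = -⁅a i, b i⁆ := by
        simpa using h3
      rw [two_smul]
      nth_rw 2 [h4]
      exact add_neg_cancel _
    exact (smul_eq_zero.mp h').resolve_left two_ne_zero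
  by_cases hij : i = j
  · subst hij
    by_cases hi : i = l
    · subst hi; rw [h0, neg_zero]
    · rw [hd i hi, neg_zero]
  · by_cases hi : i = l
    · subst hi; rw [hl j (Ne.symm hij), neg_neg]
    · by_cases hj : j = l
      · subst hj; exact hl i hi
      · have h3 := congrArg (fun z ↦ ⁅Y j l, z⁆) (hl i hi)
        simp only [lie_neg, lie_lie_vectors ha hb, kron_self, kron_of_ne hj,
          kron_of_ne (Ne.symm hi), kron_of_ne (Ne.symm hij)] at h3
        simpa using h3

variable (hc : ∀ i j, ⁅a i, b j⁆ = -⁅a j, b i⁆)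
include hc

-- The double bracket is skew in `i, j`, and symmetric in `k, i` up to known terms. Three skew and
-- three symmetric exchanges return to the start with the opposite sign, which determines twice the
-- expression, as in the uniqueness proof of the Levi-Civita connection.
omit hY in
theorem lie_vector_lie_vectors (k i j : ι) :
    ⁅a k, ⁅a i, b j⁆⁆ = kron j k • b i - kron i k • b j := by
  have hs : ∀ k i j, ⁅a k, ⁅a i, b j⁆⁆ = -⁅a k, ⁅a j, b i⁆⁆ := by
    intro k i j; rw [hc i j, lie_neg]
  have hg : ∀ k i j, ⁅a k, ⁅a i, b j⁆⁆ = ⁅a i, ⁅a k, b j⁆⁆ + (kron k j • b i - kron i j • b k) := by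
    intro k i j
    rw [leibniz_lie, ha.lie_self, neg_lie, hb.lie]
    module
  have e1 := hg k i j
  have e2 := hs i k j
  have e3 := hg i j k
  have e4 := hs j i k
  have e5 := hg j k i
  have e6 := hs k j i
  rw [e2, e3, e4, e5, e6] at e1
  have h' : (2 : ℂ) • ⁅a k, ⁅a i, b j⁆⁆ = (2 : ℂ) • (kron j k • b i - kron i k • b j) := by
    rw [two_smul]
    nth_rw 1 [e1]
    rw [kron_comm k j, kron_comm i j, kron_comm k i]
    module
  exact smul_right_injective 𝔤 (two_ne_zero (α := ℂ)) h'

omit hY in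
theorem lie_vector_lie_vectors' (k i j : ι) :
    ⁅b k, ⁅a i, b j⁆⁆ = kron j k • a i - kron i k • a j := by
  have hc' : ∀ i j, ⁅b i, a j⁆ = -⁅b j, a i⁆ := by
    intro i j
    rw [← lie_skew (b i), ← lie_skew (b j), hc j i]
  have h1 := lie_vector_lie_vectors hb ha hc' k i j
  rwa [← lie_skew (b i), hc j i, neg_neg] at h1

-- The elements `[aᵢ, bⱼ]` thus bracket to the `Y`, and under `Y` they transform as the `Y` do. This
-- grading modulo 2 is what makes half sums and half differences close and commute.
omit hY in
theorem lie_lie_vectors_lie_vectors (i j k l : ι) : ⁅⁅a i, b j⁆, ⁅a k, b l⁆⁆ =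
    kron j k • Y i l - kron i k • Y j l - kron j l • Y i k + kron i l • Y j k := by
  rw [lie_lie, lie_vector_lie_vectors ha hb hc, lie_vector_lie_vectors' ha hb hc]
  simp only [lie_sub, lie_smul, ha.lie_self, hb.lie_self]
  rw [kron_comm l j, kron_comm k j, kron_comm l i, kron_comm k i]
  module

/-- The two commuting families in an orthogonal family that is enlarged by two vectors. -/
theorem soFamily_half (s : ℂ) (hs : s * s = 1) :
    SoFamily (fun i j ↦ (1 / 2 : ℂ) • (Y i j - s • ⁅a i, b j⁆)) where
  skew i j := by rw [hY.skew i j, hc i j]; module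
  lie i j k l := by
    have h1 : ∀ i j k l, ⁅⁅a i, b j⁆, Y k l⁆ = -(
        kron l i • ⁅a k, b j⁆ - kron k i • ⁅a l, b j⁆ + kron l j • ⁅a i, b k⁆ -
          kron k j • ⁅a i, b l⁆) := by
      intro i j k l
      rw [← lie_skew, lie_lie_vectors ha hb]
    simp only [smul_lie, lie_smul, sub_lie, lie_sub, hY.lie, lie_lie_vectors ha hb,
      lie_lie_vectors_lie_vectors ha hb hc, h1]
    rw [kron_comm l j, kron_comm k j, kron_comm l i, kron_comm k i, hc k j, hc l j, hc k i]
    -- The brackets of two elements `[aᵢ, bⱼ]` enter with the factor `s²/4`, so `s² = 1` merges them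
    -- with those of two `Y`.
    linear_combination (norm := module) (1 / 4 : ℂ) • hs • (kron j k • Y i l - kron i k • Y j l -
      kron j l • Y i k + kron i l • Y j k)

omit hY in
theorem soVector_half (s : ℂ) (hs : s * s = 1) :
    SoVector (fun i j ↦ (1 / 2 : ℂ) • (Y i j - s • ⁅a i, b j⁆))
      (fun i ↦ (1 / 2 : ℂ) • (a i + s • b i)) where
  lie i j k := by
    have h1 : ⁅⁅a i, b j⁆, a k⁆ = -(kron j k • b i - kron i k • b j) := by
      rw [← lie_skew, lie_vector_lie_vectors ha hb hc]
    have h2 : ⁅⁅a i, b j⁆, b k⁆ = -(kron j k • a i - kron i k • a j) := by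
      rw [← lie_skew, lie_vector_lie_vectors' ha hb hc]
    simp only [smul_lie, lie_smul, sub_lie, lie_add, ha.lie, hb.lie, h1, h2]
    linear_combination (norm := module) (1 / 4 : ℂ) • hs • (kron j k • a i - kron i k • a j)
  lie_self i j := by
    have h1 : ⁅b i, a j⁆ = ⁅a i, b j⁆ := by rw [← lie_skew, hc i j]
    simp only [smul_lie, lie_smul, add_lie, lie_add, ha.lie_self, hb.lie_self, h1]
    linear_combination (norm := module) (-1 / 4 : ℂ) • hs • (Y i j)

/-- In a bracket of opposite halves, the contributions of the `Y`-part and of the `[aᵢ, bⱼ]`-part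
agree up to sign and cancel. -/
theorem extendFamily_half_commute (i j k l : Option ι) :
    ⁅extendFamily (fun i j ↦ (1 / 2 : ℂ) • (Y i j - (1 : ℂ) • ⁅a i, b j⁆))
        (fun i ↦ (1 / 2 : ℂ) • (a i + (1 : ℂ) • b i)) i j,
      extendFamily (fun i j ↦ (1 / 2 : ℂ) • (Y i j - (-1 : ℂ) • ⁅a i, b j⁆))
        (fun i ↦ (1 / 2 : ℂ) • (a i + (-1 : ℂ) • b i)) k l⁆ = 0 := by
  have h1 : ∀ i j k l, ⁅⁅a i, b j⁆, Y k l⁆ = -(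
      kron l i • ⁅a k, b j⁆ - kron k i • ⁅a l, b j⁆ + kron l j • ⁅a i, b k⁆ -
        kron k j • ⁅a i, b l⁆) := by
    intro i j k l
    rw [← lie_skew, lie_lie_vectors ha hb]
  have h2 : ∀ i j k, ⁅⁅a i, b j⁆, a k⁆ = -(kron j k • b i - kron i k • b j) := by
    intro i j k
    rw [← lie_skew, lie_vector_lie_vectors ha hb hc]
  have h3 : ∀ i j k, ⁅⁅a i, b j⁆, b k⁆ = -(kron j k • a i - kron i k • a j) := by
    intro i j k
    rw [← lie_skew, lie_vector_lie_vectors' ha hb hc]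
  have h4 : ∀ i j, ⁅b i, a j⁆ = ⁅a i, b j⁆ := by
    intro i j
    rw [← lie_skew, hc i j]
  have e1 : ∀ i j k l, ⁅(1 / 2 : ℂ) • (Y i j - (1 : ℂ) • ⁅a i, b j⁆),
      (1 / 2 : ℂ) • (Y k l - (-1 : ℂ) • ⁅a k, b l⁆)⁆ = 0 := by
    intro i j k l
    simp only [smul_lie, lie_smul, sub_lie, lie_sub, hY.lie, lie_lie_vectors ha hb,
      lie_lie_vectors_lie_vectors ha hb hc, h1]
    rw [kron_comm l j, kron_comm k j, kron_comm l i, kron_comm k i, hc k j, hc l j, hc k i]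
    module
  have e2 : ∀ i j k, ⁅(1 / 2 : ℂ) • (Y i j - (1 : ℂ) • ⁅a i, b j⁆),
      (1 / 2 : ℂ) • (a k + (-1 : ℂ) • b k)⁆ = 0 := by
    intro i j k
    simp only [smul_lie, lie_smul, sub_lie, lie_add, ha.lie, hb.lie, h2, h3]
    module
  have e3 : ∀ i j k, ⁅(1 / 2 : ℂ) • (a k + (1 : ℂ) • b k),
      (1 / 2 : ℂ) • (Y i j - (-1 : ℂ) • ⁅a i, b j⁆)⁆ = 0 := by
    intro i j k
    rw [← lie_skew]
    simp only [smul_lie, lie_smul, sub_lie, lie_add, ha.lie, hb.lie, h2, h3]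
    module
  have e4 : ∀ i j, ⁅(1 / 2 : ℂ) • (a i + (1 : ℂ) • b i), (1 / 2 : ℂ) • (a j + (-1 : ℂ) • b j)⁆ =
      0 := by
    intro i j
    simp only [smul_lie, lie_smul, add_lie, lie_add, ha.lie_self, hb.lie_self, h4]
    module
  rcases i with _ | i <;> rcases j with _ | j <;> rcases k with _ | k <;> rcases l with _ | l <;>
    simp only [extendFamily, lie_zero, zero_lie, lie_neg, neg_lie, e1, e2, e3, e4, neg_zero]

end TwoVectors

end Orthogonal

/-! ### Orthogonal families as alternating bilinear maps; hyperbolic bases -/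

section SoForm

variable {𝔤 : Type*} [LieRing 𝔤] [LieAlgebra ℂ 𝔤] {ι : Type*} [DecidableEq ι] [Fintype ι]

/-- The bilinear extension `(u, v) ↦ ∑ uᵢ vⱼ Yᵢⱼ` of a family. -/
def soForm (Y : ι → ι → 𝔤) : (ι → ℂ) →ₗ[ℂ] (ι → ℂ) →ₗ[ℂ] 𝔤 :=
  LinearMap.mk₂ ℂ (fun u v ↦ ∑ i, ∑ j, (u i * v j) • Y i j)
    (fun u u' v ↦ by simp only [Pi.add_apply, add_mul, add_smul, Finset.sum_add_distrib])
    (fun c u v ↦ by simp only [Pi.smul_apply, smul_eq_mul, Finset.smul_sum, smul_smul, mul_assoc])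
    (fun u v v' ↦ by simp only [Pi.add_apply, mul_add, add_smul, Finset.sum_add_distrib])
    (fun c u v ↦ by
      simp only [Pi.smul_apply, smul_eq_mul, Finset.smul_sum, smul_smul, mul_left_comm])

omit [DecidableEq ι] in
theorem soForm_apply (Y : ι → ι → 𝔤) (u v : ι → ℂ) :
    soForm Y u v = ∑ i, ∑ j, (u i * v j) • Y i j := rfl

theorem soForm_single_left (Y : ι → ι → 𝔤) (i : ι) (v : ι → ℂ) :
    soForm Y (Pi.single i 1) v = ∑ j, v j • Y i j := by
  rw [soForm_apply, Finset.sum_eq_single i] <;> simp +contextual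

theorem soForm_single (Y : ι → ι → 𝔤) (i j : ι) :
    soForm Y (Pi.single i 1) (Pi.single j 1) = Y i j := by
  rw [soForm_single_left, Finset.sum_eq_single j] <;> simp +contextual

theorem soForm_eq_sum (Y : ι → ι → 𝔤) (u v : ι → ℂ) :
    soForm Y u v = ∑ i, u i • soForm Y (Pi.single i 1) v := by
  rw [soForm_apply]
  simp only [soForm_single_left, Finset.smul_sum, smul_smul]

omit [DecidableEq ι] in
theorem soForm_mem (Y : ι → ι → 𝔤) (K : LieSubalgebra ℂ 𝔤) (hK : ∀ i j, Y i j ∈ K) (u v : ι → ℂ) :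
    soForm Y u v ∈ K := by
  rw [soForm_apply]
  exact sum_mem fun i _ ↦ sum_mem fun j _ ↦ K.smul_mem _ (hK i j)

namespace SoFamily

variable {Y : ι → ι → 𝔤} (hY : SoFamily Y)
include hY

theorem soForm_skew (u v : ι → ℂ) : soForm Y u v = -soForm Y v u := by
  rw [soForm_apply, soForm_apply, Finset.sum_comm, ← Finset.sum_neg_distrib]
  refine Finset.sum_congr rfl fun i _ ↦ ?_
  rw [← Finset.sum_neg_distrib]
  refine Finset.sum_congr rfl fun j _ ↦ ?_
  rw [hY.skew j i, mul_comm, smul_neg]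

theorem soForm_self (u : ι → ℂ) : soForm Y u u = 0 := by
  have h : (2 : ℂ) • soForm Y u u = 0 := by
    rw [two_smul]
    nth_rw 2 [hY.soForm_skew u u]
    exact add_neg_cancel _
  exact (smul_eq_zero.mp h).resolve_left two_ne_zero

theorem lie_soForm_right (i j : ι) (w z : ι → ℂ) : ⁅Y i j, soForm Y w z⁆ =
    w j • soForm Y (Pi.single i 1) z - w i • soForm Y (Pi.single j 1) z -
      z j • soForm Y (Pi.single i 1) w + z i • soForm Y (Pi.single j 1) w := by
  have h1 : ∀ k, ⁅Y i j, soForm Y (Pi.single k 1) z⁆ =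
      kron j k • soForm Y (Pi.single i 1) z - kron i k • soForm Y (Pi.single j 1) z -
        z j • Y i k + z i • Y j k := by
    intro k
    simp only [soForm_single_left, lie_sum, lie_smul, hY.lie, smul_add, smul_sub,
      Finset.sum_add_distrib, Finset.sum_sub_distrib, Finset.smul_sum]
    congr 1
    · congr 1
      · simp only [smul_comm (z _)]
      · simp [kron, ite_smul]
    · simp [kron, ite_smul]
  rw [soForm_eq_sum Y w, lie_sum]
  simp only [lie_smul, h1, smul_add, smul_sub, Finset.sum_add_distrib, Finset.sum_sub_distrib]
  congr 1
  · congr 1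
    · congr 1 <;> simp [kron, ite_smul]
    · rw [soForm_single_left, Finset.smul_sum]
      exact Finset.sum_congr rfl fun k _ ↦ smul_comm _ _ _
  · rw [soForm_single_left, Finset.smul_sum]
    exact Finset.sum_congr rfl fun k _ ↦ smul_comm _ _ _

/-- The defining relations extended bilinearly, with the dot product in place of the Kronecker
symbol. Chevalley generators can therefore be taken in an isotropic basis instead of the standard
one. -/
theorem lie_soForm (u v w z : ι → ℂ) : ⁅soForm Y u v, soForm Y w z⁆ =
    (v ⬝ᵥ w) • soForm Y u z - (u ⬝ᵥ w) • soForm Y v z - (v ⬝ᵥ z) • soForm Y u w +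
      (u ⬝ᵥ z) • soForm Y v w := by
  have h1 : ∀ i, ⁅soForm Y (Pi.single i 1) v, soForm Y w z⁆ =
      (v ⬝ᵥ w) • soForm Y (Pi.single i 1) z - w i • soForm Y v z -
        (v ⬝ᵥ z) • soForm Y (Pi.single i 1) w + z i • soForm Y v w := by
    intro i
    rw [soForm_single_left Y i v, sum_lie]
    simp only [smul_lie, hY.lie_soForm_right, smul_add, smul_sub, Finset.sum_add_distrib,
      Finset.sum_sub_distrib, dotProduct, Finset.sum_smul, smul_smul]
    rw [soForm_eq_sum Y v z, soForm_eq_sum Y v w]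
    simp only [Finset.smul_sum, smul_smul, mul_comm]
  rw [soForm_eq_sum Y u v, sum_lie]
  simp only [smul_lie, h1, smul_add, smul_sub, Finset.sum_add_distrib, Finset.sum_sub_distrib]
  rw [soForm_eq_sum Y u z, soForm_eq_sum Y u w]
  simp only [dotProduct, Finset.smul_sum, Finset.sum_smul, Finset.mul_sum, smul_smul,
    mul_comm]

end SoFamily

/-- Two systems of vectors that are dual to each other and span isotropic subspaces. -/
structure IsotropicPair (m : ℕ) (p q : ℕ → ι → ℂ) : Prop where
  pp : ∀ i j, i < m → j < m → p i ⬝ᵥ p j = 0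
  qq : ∀ i j, i < m → j < m → q i ⬝ᵥ q j = 0
  pq : ∀ i j, i < m → j < m → p i ⬝ᵥ q j = kron i j

namespace IsotropicPair

variable {m : ℕ} {p q : ℕ → ι → ℂ} (S : IsotropicPair m p q) {Y : ι → ι → 𝔤} (hY : SoFamily Y)
include S

omit [DecidableEq ι] in
theorem qp (i j : ℕ) (hi : i < m) (hj : j < m) : q i ⬝ᵥ p j = kron i j := by
  rw [dotProduct_comm, S.pq j i hj hi, kron_comm]

include hY

theorem lie_diag_diag {a b : ℕ} (ha : a < m) (hb : b < m) :
    ⁅soForm Y (p a) (q a), soForm Y (p b) (q b)⁆ = 0 := by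
  rw [hY.lie_soForm, S.pp _ _ ha hb, S.qq _ _ ha hb, S.pq _ _ ha hb, S.qp _ _ ha hb]
  by_cases h : a = b
  · subst h
    rw [hY.soForm_skew (q a) (p a)]; module
  · rw [kron_of_ne h]; module

theorem lie_diag_pq {a b c : ℕ} (ha : a < m) (hb : b < m) (hc : c < m) :
    ⁅soForm Y (p a) (q a), soForm Y (p b) (q c)⁆ =
      (kron a b - kron a c) • soForm Y (p b) (q c) := by
  rw [hY.lie_soForm, S.pp _ _ ha hb, S.qq _ _ ha hc, S.pq _ _ ha hc, S.qp _ _ ha hb]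
  by_cases h : a = b <;> by_cases h' : a = c
  · subst h; subst h'; rw [hY.soForm_skew (q a) (p a)]; module
  · subst h; rw [kron_of_ne h']; module
  · subst h'; rw [kron_of_ne h, hY.soForm_skew (q a) (p b), kron_self]; module
  · rw [kron_of_ne h, kron_of_ne h']; module

theorem lie_diag_pp {a b c : ℕ} (ha : a < m) (hb : b < m) (hc : c < m) :
    ⁅soForm Y (p a) (q a), soForm Y (p b) (p c)⁆ =
      (kron a b + kron a c) • soForm Y (p b) (p c) := by
  rw [hY.lie_soForm, S.pp _ _ ha hb, S.pp _ _ ha hc, S.qp _ _ ha hc, S.qp _ _ ha hb]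
  by_cases h : a = b <;> by_cases h' : a = c
  · subst h; subst h'; rw [hY.soForm_self]; module
  · subst h; rw [kron_of_ne h']; module
  · subst h'; rw [kron_of_ne h, hY.soForm_skew (p a) (p b), kron_self]; module
  · rw [kron_of_ne h, kron_of_ne h']; module

theorem lie_diag_qq {a b c : ℕ} (ha : a < m) (hb : b < m) (hc : c < m) :
    ⁅soForm Y (p a) (q a), soForm Y (q b) (q c)⁆ =
      (-(kron a b + kron a c)) • soForm Y (q b) (q c) := by
  rw [hY.lie_soForm, S.qq _ _ ha hb, S.qq _ _ ha hc, S.pq _ _ ha hc, S.pq _ _ ha hb]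
  by_cases h : a = b <;> by_cases h' : a = c
  · subst h; subst h'; rw [hY.soForm_self]; module
  · subst h; rw [kron_of_ne h']; module
  · subst h'; rw [kron_of_ne h, hY.soForm_skew (q a) (q b), kron_self]; module
  · rw [kron_of_ne h, kron_of_ne h']; module

end IsotropicPair

end SoForm

/-! ### Vinberg vectors for the Cartan matrices of types `B` and `D` -/

section FiniteType

theorem sum_fin_ite (n c : ℕ) (P : Prop) [Decidable P] (u : ℕ → ℤ) :
    ∑ i : Fin n, (if (i : ℕ) = c ∧ P then u i else 0) = if c < n ∧ P then u c else 0 := by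
  by_cases hP : P
  · simp only [hP, and_true]
    by_cases hc : c < n
    · rw [if_pos hc, Finset.sum_eq_single ⟨c, hc⟩]
      · simp
      · intro b _ hb
        exact if_neg fun h ↦ hb (Fin.ext h)
      · simp
    · rw [if_neg hc]
      refine Finset.sum_eq_zero fun i _ ↦ if_neg ?_
      omega
  · simp [hP]

theorem isFiniteTypeMatrix_B (m : ℕ) : IsFiniteTypeMatrix (CartanMatrix.B m) := by
  -- These are the coefficients of `4ρ^∨` in the simple coroots, so every entry of `A u` is 4; the
  -- last entry is half of what the quadratic formula gives.
  let u : ℕ → ℤ := fun k ↦ if k + 1 < m then 2 * (k + 1) * (2 * m - k) else m * (m + 1)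
  refine ⟨CartanMatrix.B_diag m, CartanMatrix.B_off_diag_nonpos m, fun i ↦ u i, fun i ↦ ?_,
    fun j ↦ ?_⟩
  · have := i.2
    simp only [u]
    split_ifs
    · have : (0 : ℤ) < 2 * m - (i : ℕ) := by omega
      positivity
    · have : 0 < m := by omega
      positivity
  · have h : ∀ i : Fin m, CartanMatrix.B m j i * u i =
        2 * (if (i : ℕ) = j ∧ True then u i else 0) -
        (if (i : ℕ) = j + 1 ∧ True then u i else 0) -
        (if (i : ℕ) = j + 1 ∧ (j : ℕ) + 2 = m then u i else 0) -
        (if (i : ℕ) = j - 1 ∧ 0 < (j : ℕ) then u i else 0) := by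
      intro i
      have := i.2
      have := j.2
      simp only [CartanMatrix.B, Matrix.of_apply, Fin.ext_iff, and_true]
      split_ifs <;> omega
    rw [Finset.sum_congr rfl fun i _ ↦ h i]
    simp only [Finset.sum_sub_distrib, ← Finset.mul_sum, sum_fin_ite]
    obtain ⟨j, hj⟩ := j
    simp only [u]
    rcases j with _ | j
    · rcases m with _ | _ | _ | m
      · omega
      · simp
      · simp
      · simp
        linarith
    · obtain h | ⟨k, rfl⟩ : m = j + 2 ∨ ∃ k, m = j + 3 + k := by
        by_cases h : m = j + 2
        · exact .inl h
        · exact .inr ⟨m - (j + 3), by omega⟩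
      · subst h
        simp
        ring_nf; norm_num
      · rcases k with _ | k
        · simp; ring_nf; norm_num
        · simp only [and_true]
          split_ifs <;> first | omega | (push_cast; nlinarith)

theorem isFiniteTypeMatrix_D (m : ℕ) (hm : 3 ≤ m) : IsFiniteTypeMatrix (CartanMatrix.D m) := by
  -- Again the coefficients of `4ρ^∨`; the two end nodes of the fork share the value that a single
  -- further node would have.
  let u : ℕ → ℤ := fun k ↦ if k + 2 < m then 2 * (k + 1) * (2 * m - 2 - k) else m * (m - 1)
  refine ⟨CartanMatrix.D_diag m, CartanMatrix.D_off_diag_nonpos m, fun i ↦ u i, fun i ↦ ?_,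
    fun j ↦ ?_⟩
  · have := i.2
    simp only [u]
    split_ifs
    · have : (0 : ℤ) < 2 * m - 2 - (i : ℕ) := by omega
      positivity
    · have : (0 : ℤ) < m - 1 := by omega
      positivity
  · have h : ∀ i : Fin m, CartanMatrix.D m j i * u i =
        2 * (if (i : ℕ) = j ∧ True then u i else 0) -
        (if (i : ℕ) = j + 1 ∧ (j : ℕ) + 2 < m then u i else 0) -
        (if (i : ℕ) = j + 2 ∧ (j : ℕ) + 3 = m then u i else 0) -
        (if (i : ℕ) = j - 2 ∧ (j : ℕ) + 1 = m then u i else 0) -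
        (if (i : ℕ) = j - 1 ∧ (0 < (j : ℕ) ∧ (j : ℕ) + 1 < m) then u i else 0) := by
      intro i
      have := i.2
      have := j.2
      simp only [CartanMatrix.D, Matrix.of_apply, Fin.ext_iff, and_true]
      split_ifs <;> omega
    rw [Finset.sum_congr rfl fun i _ ↦ h i]
    simp only [Finset.sum_sub_distrib, ← Finset.mul_sum, sum_fin_ite]
    obtain ⟨j, hj⟩ := j
    simp only [u]
    obtain ⟨n, rfl⟩ : ∃ n, m = n + 3 := ⟨m - 3, by omega⟩
    obtain h | h | h | ⟨k, rfl⟩ : j = n + 2 ∨ j = n + 1 ∨ j = n ∨ ∃ k, n = j + 1 + k := by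
      by_cases h : n ≤ j
      · omega
      · exact .inr (.inr (.inr ⟨n - (j + 1), by omega⟩))
    · subst h
      simp
      ring_nf; norm_num
    · subst h
      simp
      ring_nf; norm_num
    · subst h
      rcases j with _ | j
      · simp
      · simp; ring_nf; norm_num
    · simp only [and_true]
      rcases j with _ | j
      · split_ifs <;> omega
      · split_ifs <;> first | omega | (push_cast; nlinarith)

end FiniteType

/-! ### Chevalley generators of orthogonal Lie algebras in isotropic bases -/

section ClassicalSystems

variable {𝔤 : Type*} [LieRing 𝔤] [LieAlgebra ℂ 𝔤] {ι : Type*} [DecidableEq ι] [Fintype ι]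

namespace IsotropicPair

variable {m : ℕ} {p q : ℕ → ι → ℂ} (S : IsotropicPair m p q) {Y : ι → ι → 𝔤} (hY : SoFamily Y)

/-- The coroots of the even orthogonal Lie algebra. -/
def hD (m : ℕ) (p q : ℕ → ι → ℂ) (Y : ι → ι → 𝔤) (k : Fin m) : 𝔤 :=
  if (k : ℕ) + 1 < m then soForm Y (p k) (q k) - soForm Y (p (k + 1)) (q (k + 1))
  else soForm Y (p (m - 2)) (q (m - 2)) + soForm Y (p (m - 1)) (q (m - 1))

/-- The simple root vectors of the even orthogonal Lie algebra. -/
def eD (m : ℕ) (p q : ℕ → ι → ℂ) (Y : ι → ι → 𝔤) (k : Fin m) : 𝔤 :=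
  if (k : ℕ) + 1 < m then soForm Y (p k) (q (k + 1)) else soForm Y (p (m - 2)) (p (m - 1))

/-- The negative simple root vectors of the even orthogonal Lie algebra. -/
def fD (m : ℕ) (p q : ℕ → ι → ℂ) (Y : ι → ι → 𝔤) (k : Fin m) : 𝔤 :=
  if (k : ℕ) + 1 < m then soForm Y (p (k + 1)) (q k) else soForm Y (q (m - 1)) (q (m - 2))

include S hY

theorem lie_eD_fD (hm : 2 ≤ m) (i : Fin m) :
    ⁅eD m p q Y i, fD m p q Y i⁆ = hD m p q Y i := by
  have hi := i.2
  unfold eD fD hD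
  split_ifs with h
  · rw [hY.lie_soForm, S.pp _ _ (by omega) (by omega), S.qq _ _ (by omega) (by omega),
      S.pq _ _ (by omega) (by omega), S.qp _ _ (by omega) (by omega), kron_self, kron_self,
      hY.soForm_skew (q _) (p _)]
    module
  · rw [hY.lie_soForm, S.pq _ _ (by omega) (by omega), S.pq _ _ (by omega) (by omega),
      S.pq _ _ (by omega) (by omega), S.pq _ _ (by omega) (by omega), kron_self, kron_self,
      kron_of_ne (by omega), kron_of_ne (by omega)]
    module

theorem lie_eD_fD_of_ne (i j : Fin m) (hij : i ≠ j) :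
    ⁅eD m p q Y i, fD m p q Y j⁆ = 0 := by
  have hi := i.2
  have hj := j.2
  have hij' : (i : ℕ) ≠ j := fun h ↦ hij (Fin.ext h)
  unfold eD fD
  split_ifs with h h' h'
  · rw [hY.lie_soForm, S.pp _ _ (by omega) (by omega), S.qq _ _ (by omega) (by omega),
      S.pq _ _ (by omega) (by omega), S.qp _ _ (by omega) (by omega), kron_of_ne hij',
      kron_of_ne (by omega)]
    module
  · rw [hY.lie_soForm, S.qq _ _ (by omega) (by omega), S.qq _ _ (by omega) (by omega),
      S.pq _ _ (by omega) (by omega), S.pq _ _ (by omega) (by omega),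
      kron_of_ne (j := m - 1) (by omega)]
    by_cases hi' : (i : ℕ) = m - 2
    · rw [show (i : ℕ) + 1 = m - 1 by omega, hY.soForm_self]; module
    · rw [kron_of_ne hi']; module
  · rw [hY.lie_soForm, S.pp _ _ (by omega) (by omega), S.pp _ _ (by omega) (by omega),
      S.pq _ _ (by omega) (by omega), S.pq _ _ (by omega) (by omega),
      kron_of_ne (i := m - 1) (by omega)]
    by_cases hi' : m - 2 = (j : ℕ)
    · rw [show (j : ℕ) + 1 = m - 1 by omega, hY.soForm_self]; module
    · rw [kron_of_ne hi']; module
  · omega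

theorem lie_hD_hD (hm : 2 ≤ m) (i j : Fin m) : ⁅hD m p q Y i, hD m p q Y j⁆ = 0 := by
  have hi := i.2
  have hj := j.2
  unfold hD
  split_ifs <;> simp (disch := omega) only [add_lie, sub_lie, lie_add, lie_sub,
    S.lie_diag_diag hY] <;> simp

theorem lie_hD_eD (hm : 2 ≤ m) (i j : Fin m) :
    ⁅hD m p q Y j, eD m p q Y i⁆ = CartanMatrix.D m i j • eD m p q Y i := by
  have hi := i.2
  have hj := j.2
  unfold hD eD
  have e : ∀ a b : ℕ, kron a b = ((if a = b then 1 else 0 : ℤ) : ℂ) := fun a b ↦ by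
    simp [kron]
  split_ifs with h1 h2 h2 <;> simp (disch := omega) only [add_lie, sub_lie,
    S.lie_diag_pq hY, S.lie_diag_pp hY, ← sub_smul, ← add_smul, ← Int.cast_smul_eq_zsmul ℂ, e]
  all_goals
    congr 1
    norm_cast
    simp only [CartanMatrix.D, Matrix.of_apply, Fin.ext_iff]
    grind

theorem lie_hD_fD (hm : 2 ≤ m) (i j : Fin m) :
    ⁅hD m p q Y j, fD m p q Y i⁆ = -CartanMatrix.D m i j • fD m p q Y i := by
  have hi := i.2
  have hj := j.2
  unfold hD fD
  have e : ∀ a b : ℕ, kron a b = ((if a = b then 1 else 0 : ℤ) : ℂ) := fun a b ↦ by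
    simp [kron]
  split_ifs with h1 h2 h2 <;> simp (disch := omega) only [add_lie, sub_lie,
    S.lie_diag_pq hY, S.lie_diag_qq hY, ← sub_smul, ← add_smul, ← Int.cast_smul_eq_zsmul ℂ, e]
  all_goals
    congr 1
    norm_cast
    simp only [CartanMatrix.D, Matrix.of_apply, Fin.ext_iff]
    grind

theorem chevalleySystem_D (hm : 2 ≤ m) (h0 : ∀ k, hD m p q Y k ≠ 0) :
    ChevalleySystem (CartanMatrix.D m) (hD m p q Y) (eD m p q Y) (fD m p q Y) where
  h_ne_zero := h0
  lie_e_f := S.lie_eD_fD hY hm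
  lie_e_f_ne := S.lie_eD_fD_of_ne hY
  lie_h_h := S.lie_hD_hD hY hm
  lie_h_e := S.lie_hD_eD hY hm
  lie_h_f := S.lie_hD_fD hY hm

end IsotropicPair

namespace IsotropicPair

variable {m : ℕ} {p q : ℕ → ι → ℂ} (S : IsotropicPair m p q) {Y : ι → ι → 𝔤} (hY : SoFamily Y)

/-- The coroots of the odd orthogonal Lie algebra. -/
def hB (m : ℕ) (p q : ℕ → ι → ℂ) (Y : ι → ι → 𝔤) (k : Fin m) : 𝔤 :=
  if (k : ℕ) + 1 < m then soForm Y (p k) (q k) - soForm Y (p (k + 1)) (q (k + 1))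
  else (2 : ℂ) • soForm Y (p (m - 1)) (q (m - 1))

/-- The simple root vectors of the odd orthogonal Lie algebra. -/
def eB (m : ℕ) (p q : ℕ → ι → ℂ) (w : ι → ℂ) (Y : ι → ι → 𝔤) (k : Fin m) : 𝔤 :=
  if (k : ℕ) + 1 < m then soForm Y (p k) (q (k + 1)) else soForm Y (p (m - 1)) w

/-- The negative simple root vectors of the odd orthogonal Lie algebra. -/
def fB (m : ℕ) (p q : ℕ → ι → ℂ) (w : ι → ℂ) (Y : ι → ι → 𝔤) (k : Fin m) : 𝔤 :=
  if (k : ℕ) + 1 < m then soForm Y (p (k + 1)) (q k) else (2 : ℂ) • soForm Y w (q (m - 1))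

section Odd

variable {w : ι → ℂ} (hww : w ⬝ᵥ w = 1) (hpw : ∀ i < m, p i ⬝ᵥ w = 0) (hqw : ∀ i < m, q i ⬝ᵥ w = 0)
include S hY hpw hqw

theorem lie_diag_pw {a b : ℕ} (ha : a < m) (hb : b < m) :
    ⁅soForm Y (p a) (q a), soForm Y (p b) w⁆ = kron a b • soForm Y (p b) w := by
  rw [hY.lie_soForm, S.pp _ _ ha hb, S.qp _ _ ha hb, hpw a ha, hqw a ha]
  by_cases h : a = b
  · subst h; module
  · rw [kron_of_ne h]; module

theorem lie_diag_wq {a b : ℕ} (ha : a < m) (hb : b < m) :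
    ⁅soForm Y (p a) (q a), soForm Y w (q b)⁆ = (-kron a b) • soForm Y w (q b) := by
  rw [hY.lie_soForm, S.qq _ _ ha hb, S.pq _ _ ha hb, hpw a ha, hqw a ha]
  by_cases h : a = b
  · subst h; rw [hY.soForm_skew w]; module
  · rw [kron_of_ne h]; module

include hww in
theorem lie_eB_fB (i : Fin m) : ⁅eB m p q w Y i, fB m p q w Y i⁆ = hB m p q Y i := by
  have hi := i.2
  unfold eB fB hB
  split_ifs with h
  · rw [hY.lie_soForm, S.pp _ _ (by omega) (by omega), S.qq _ _ (by omega) (by omega),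
      S.pq _ _ (by omega) (by omega), S.qp _ _ (by omega) (by omega), kron_self, kron_self,
      hY.soForm_skew (q _) (p _)]
    module
  · rw [lie_smul, hY.lie_soForm, S.pq _ _ (by omega) (by omega), hww, hpw _ (by omega),
      dotProduct_comm, hqw _ (by omega), hY.soForm_self]
    module

theorem lie_eB_fB_of_ne (i j : Fin m) (hij : i ≠ j) : ⁅eB m p q w Y i, fB m p q w Y j⁆ = 0 := by
  have hi := i.2
  have hj := j.2
  have hij' : (i : ℕ) ≠ j := fun h ↦ hij (Fin.ext h)
  unfold eB fB
  split_ifs with h h' h'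
  · rw [hY.lie_soForm, S.pp _ _ (by omega) (by omega), S.qq _ _ (by omega) (by omega),
      S.pq _ _ (by omega) (by omega), S.qp _ _ (by omega) (by omega), kron_of_ne hij',
      kron_of_ne (by omega)]
    module
  · rw [lie_smul, hY.lie_soForm, S.qq _ _ (by omega) (by omega), S.pq _ _ (by omega) (by omega),
      hqw _ (by omega), hpw _ (by omega), kron_of_ne (by omega)]
    module
  · rw [hY.lie_soForm, S.pp _ _ (by omega) (by omega), S.pq _ _ (by omega) (by omega),
      dotProduct_comm, dotProduct_comm w, hqw _ (by omega), hpw _ (by omega),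
      kron_of_ne (by omega)]
    module
  · omega

omit hpw hqw in
theorem lie_hB_hB (i j : Fin m) : ⁅hB m p q Y i, hB m p q Y j⁆ = 0 := by
  have hi := i.2
  have hj := j.2
  unfold hB
  split_ifs <;> simp (disch := omega) only [smul_lie, lie_smul, sub_lie, lie_sub,
    S.lie_diag_diag hY] <;> simp

theorem lie_hB_eB (i j : Fin m) :
    ⁅hB m p q Y j, eB m p q w Y i⁆ = CartanMatrix.B m i j • eB m p q w Y i := by
  have hi := i.2
  have hj := j.2
  unfold hB eB
  have e : ∀ a b : ℕ, kron a b = ((if a = b then 1 else 0 : ℤ) : ℂ) := fun a b ↦ by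
    simp [kron]
  split_ifs with h1 h2 h2 <;> simp (disch := omega) only [smul_lie, sub_lie, smul_smul,
    S.lie_diag_pq hY, S.lie_diag_pw hY hpw hqw, ← sub_smul, ← Int.cast_smul_eq_zsmul ℂ, e]
  all_goals
    congr 1
    norm_cast
    simp only [CartanMatrix.B, Matrix.of_apply, Fin.ext_iff]
    grind

theorem lie_hB_fB (i j : Fin m) :
    ⁅hB m p q Y j, fB m p q w Y i⁆ = -CartanMatrix.B m i j • fB m p q w Y i := by
  have hi := i.2
  have hj := j.2
  unfold hB fB
  have e : ∀ a b : ℕ, kron a b = ((if a = b then 1 else 0 : ℤ) : ℂ) := fun a b ↦ by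
    simp [kron]
  split_ifs with h1 h2 h2 <;> simp (disch := omega) only [smul_lie, lie_smul, sub_lie, smul_smul,
    S.lie_diag_pq hY, S.lie_diag_wq hY hpw hqw, ← sub_smul, ← Int.cast_smul_eq_zsmul ℂ, e]
  all_goals
    congr 1
    norm_cast
    simp only [CartanMatrix.B, Matrix.of_apply, Fin.ext_iff]
    grind

include hww in
theorem chevalleySystem_B (h0 : ∀ k, hB m p q Y k ≠ 0) :
    ChevalleySystem (CartanMatrix.B m) (hB m p q Y) (eB m p q w Y) (fB m p q w Y) where
  h_ne_zero := h0
  lie_e_f := S.lie_eB_fB hY hww hpw hqw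
  lie_e_f_ne := S.lie_eB_fB_of_ne hY hpw hqw
  lie_h_h := S.lie_hB_hB hY
  lie_h_e := S.lie_hB_eB hY hpw hqw
  lie_h_f := S.lie_hB_fB hY hpw hqw

end Odd

section Generation

include S hY

variable (K : LieSubalgebra ℂ 𝔤)
  (hpq : ∀ k, k + 1 < m → soForm Y (p k) (q (k + 1)) ∈ K)
  (hqp : ∀ k, k + 1 < m → soForm Y (p (k + 1)) (q k) ∈ K)

include hpq hqp in
theorem diag_mem (hlast : soForm Y (p (m - 1)) (q (m - 1)) ∈ K) (k : ℕ) (hk : k < m) :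
    soForm Y (p k) (q k) ∈ K := by
  obtain ⟨d, hd⟩ : ∃ d, k + d + 1 = m := ⟨m - 1 - k, by omega⟩
  induction d generalizing k with
  | zero => rwa [show k = m - 1 by omega]
  | succ d ih =>
    have h1 := K.lie_mem (hpq k (by omega)) (hqp k (by omega))
    rw [hY.lie_soForm, S.pp _ _ (by omega) (by omega), S.qq _ _ (by omega) (by omega),
      S.pq _ _ (by omega) (by omega), S.qp _ _ (by omega) (by omega), kron_self, kron_self,
      hY.soForm_skew (q _) (p _)] at h1
    have h2 := K.add_mem h1 (ih (k + 1) (by omega) (by omega))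
    convert h2 using 1
    module

include hpq in
theorem pp_mem (hlast : soForm Y (p (m - 2)) (p (m - 1)) ∈ K) (k : ℕ) (hk : k + 1 < m) :
    soForm Y (p k) (p (k + 1)) ∈ K := by
  obtain ⟨d, hd⟩ : ∃ d, k + d + 2 = m := ⟨m - 2 - k, by omega⟩
  induction d generalizing k with
  | zero => rwa [show k = m - 2 by omega, show m - 2 + 1 = m - 1 by omega]
  | succ d ih =>
    -- From `p_{k+1} ∧ p_{k+2}`, the first bracket gives `p_k ∧ p_{k+2}`, and the second one gives
    -- `p_k ∧ p_{k+1}` up to sign.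
    have h1 := K.lie_mem (K.lie_mem (hpq k hk) (ih (k + 1) (by omega) (by omega)))
      (hpq (k + 1) (by omega))
    simp (disch := omega) only [hY.lie_soForm, S.pp, S.qp, kron_self, kron_of_ne, zero_smul,
      one_smul, sub_zero, add_zero, zero_sub, neg_mem_iff, S.pq] at h1
    simpa using h1

include hqp in
theorem qq_mem (hlast : soForm Y (q (m - 1)) (q (m - 2)) ∈ K) (k : ℕ) (hk : k + 1 < m) :
    soForm Y (q k) (q (k + 1)) ∈ K := by
  obtain ⟨d, hd⟩ : ∃ d, k + d + 2 = m := ⟨m - 2 - k, by omega⟩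
  induction d generalizing k with
  | zero =>
    rw [show k = m - 2 by omega, show m - 2 + 1 = m - 1 by omega, hY.soForm_skew]
    exact neg_mem hlast
  | succ d ih =>
    have h1 := K.lie_mem (K.lie_mem (hqp k hk) (ih (k + 1) (by omega) (by omega)))
      (hqp (k + 1) (by omega))
    simp (disch := omega) only [hY.lie_soForm, kron_self, kron_of_ne, zero_smul,
      one_smul, sub_zero, add_zero, zero_sub, neg_lie, neg_mem_iff, S.pq,
      S.qp, S.qq] at h1
    simpa using h1

end Generation

end IsotropicPair

end ClassicalSystems

/-! ### The standard hyperbolic basis over the complex numbers -/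

section Standard

/-- The standard basis vectors, numbered by natural numbers. -/
def stdVec (n k : ℕ) : Fin n → ℂ := fun i ↦ if (i : ℕ) = k then 1 else 0

theorem stdVec_eq_single {n : ℕ} (i : Fin n) : stdVec n i = Pi.single i 1 := by
  ext j
  simp [stdVec, Pi.single_apply, Fin.ext_iff]

theorem stdVec_dotProduct (n : ℕ) {i j : ℕ} (hi : i < n) :
    stdVec n i ⬝ᵥ stdVec n j = kron i j := by
  have h := stdVec_eq_single (⟨i, hi⟩ : Fin n)
  simp only at h
  rw [h, single_one_dotProduct]
  simp [stdVec, kron]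

/-- A basis of a maximal isotropic subspace. -/
def isoP (n k : ℕ) : Fin n → ℂ := stdVec n (2 * k) + Complex.I • stdVec n (2 * k + 1)

/-- The dual basis of a complementary maximal isotropic subspace. -/
def isoQ (n k : ℕ) : Fin n → ℂ :=
  (1 / 2 : ℂ) • stdVec n (2 * k) - (Complex.I / 2) • stdVec n (2 * k + 1)

theorem isotropicPair_std {n m : ℕ} (hn : 2 * m ≤ n) :
    IsotropicPair m (isoP n) (isoQ n) where
  pp i j hi hj := by
    have h1 : 2 * i < n := by omega
    have h2 : 2 * i + 1 < n := by omega
    simp only [isoP, add_dotProduct, dotProduct_add, smul_dotProduct, dotProduct_smul,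
      stdVec_dotProduct n h1, stdVec_dotProduct n h2, smul_eq_mul]
    by_cases h : i = j
    · subst h
      rw [kron_self, kron_self, kron_of_ne (by omega), kron_of_ne (by omega)]
      linear_combination Complex.I_mul_I
    · rw [kron_of_ne (by omega), kron_of_ne (by omega), kron_of_ne (by omega),
        kron_of_ne (by omega)]
      ring
  qq i j hi hj := by
    have h1 : 2 * i < n := by omega
    have h2 : 2 * i + 1 < n := by omega
    simp only [isoQ, sub_dotProduct, dotProduct_sub, smul_dotProduct, dotProduct_smul,
      stdVec_dotProduct n h1, stdVec_dotProduct n h2, smul_eq_mul]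
    by_cases h : i = j
    · subst h
      rw [kron_self, kron_self, kron_of_ne (by omega), kron_of_ne (by omega)]
      linear_combination (1 / 4) * Complex.I_mul_I
    · rw [kron_of_ne (by omega), kron_of_ne (by omega), kron_of_ne (by omega),
        kron_of_ne (by omega)]
      ring
  pq i j hi hj := by
    have h1 : 2 * i < n := by omega
    have h2 : 2 * i + 1 < n := by omega
    simp only [isoP, isoQ, add_dotProduct, dotProduct_sub, smul_dotProduct, dotProduct_smul,
      stdVec_dotProduct n h1, stdVec_dotProduct n h2, smul_eq_mul]
    by_cases h : i = j
    · subst h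
      rw [kron_self, kron_self, kron_self, kron_of_ne (by omega), kron_of_ne (by omega)]
      linear_combination (-1 / 2) * Complex.I_mul_I
    · rw [kron_of_ne (by omega), kron_of_ne (by omega), kron_of_ne (by omega),
        kron_of_ne (by omega), kron_of_ne h]
      ring

theorem isoP_dotProduct_last {n m k : ℕ} (hn : n = 2 * m + 1) (hk : k < m) :
    isoP n k ⬝ᵥ stdVec n (2 * m) = 0 := by
  simp only [isoP, add_dotProduct, smul_dotProduct]
  rw [stdVec_dotProduct n (by omega), stdVec_dotProduct n (by omega), kron_of_ne (by omega),
    kron_of_ne (by omega)]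
  simp

theorem isoQ_dotProduct_last {n m k : ℕ} (hn : n = 2 * m + 1) (hk : k < m) :
    isoQ n k ⬝ᵥ stdVec n (2 * m) = 0 := by
  simp only [isoQ, sub_dotProduct, smul_dotProduct]
  rw [stdVec_dotProduct n (by omega), stdVec_dotProduct n (by omega), kron_of_ne (by omega),
    kron_of_ne (by omega)]
  simp

theorem stdVec_even (n k : ℕ) : stdVec n (2 * k) = (1 / 2 : ℂ) • isoP n k + isoQ n k := by
  unfold isoP isoQ
  module

theorem stdVec_odd (n k : ℕ) :
    stdVec n (2 * k + 1) = (-Complex.I / 2) • isoP n k + Complex.I • isoQ n k := by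
  unfold isoP isoQ
  linear_combination (norm := module) Complex.I_mul_I • stdVec n (2 * k + 1)

end Standard

/-! ### Generation by consecutive entries -/

section Consecutive

variable {𝔤 : Type*} [LieRing 𝔤] [LieAlgebra ℂ 𝔤]

/-- The relation `[Y i k, Y k j] = Y i j` builds an entry from consecutive ones between `i` and `j`.
Confining them to that interval lets the result apply to a part of the chain. -/
theorem SoFamily.mem_of_consecutive {n : ℕ} {Y : Fin n → Fin n → 𝔤} (hY : SoFamily Y)
    (K : LieSubalgebra ℂ 𝔤) (i j : Fin n) (hij : i < j)
    (h : ∀ s t : Fin n, i ≤ s → t ≤ j → (s : ℕ) + 1 = t → Y s t ∈ K) : Y i j ∈ K := by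
  obtain ⟨d, hd⟩ : ∃ d, (i : ℕ) + d + 1 = j := ⟨j - i - 1, by omega⟩
  induction d generalizing j with
  | zero => exact h i j le_rfl le_rfl (by omega)
  | succ d ih =>
    have hj := j.2
    let k : Fin n := ⟨i + d + 1, by omega⟩
    have hk : (k : ℕ) = i + d + 1 := rfl
    have h1 := ih k (by omega) (fun s t hs ht hst ↦ h s t hs (by omega) hst) (by omega)
    have h2 := h k j (by omega) le_rfl (by omega)
    have h3 := K.lie_mem h1 h2
    rw [hY.lie, kron_self, kron_of_ne (by omega), kron_of_ne (by omega),
      kron_of_ne (by omega)] at h3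
    simpa using h3

theorem SoFamily.mem {n : ℕ} {Y : Fin n → Fin n → 𝔤} (hY : SoFamily Y)
    (K : LieSubalgebra ℂ 𝔤) (h : ∀ s t : Fin n, (s : ℕ) + 1 = t → Y s t ∈ K) (i j : Fin n) :
    Y i j ∈ K := by
  rcases lt_trichotomy i j with hij | hij | hij
  · exact hY.mem_of_consecutive K i j hij fun s t _ _ ↦ h s t
  · rw [hij, hY.apply_self]; exact K.zero_mem
  · rw [hY.skew]
    exact neg_mem (hY.mem_of_consecutive K j i hij fun s t _ _ ↦ h s t)

end Consecutive

/-! ### Values of an invariant form on an orthogonal family -/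

section FormValues

variable {𝔤 : Type*} [LieRing 𝔤] [LieAlgebra ℂ 𝔤] {B : LinearMap.BilinForm ℂ 𝔤}
  (hinv : ∀ x y z : 𝔤, B ⁅x, y⁆ z = B x ⁅y, z⁆) {ι : Type*} [DecidableEq ι] {Y : ι → ι → 𝔤}
  (hY : SoFamily Y)
include hinv hY

/-- Writing `Y i j = [Y i k, Y k j]` and moving one factor across by invariance exchanges `j` for
`k`. Hence one value of the norm determines all of them. -/
theorem SoFamily.form_right {i j k : ι} (hij : i ≠ j) (hjk : j ≠ k) (hik : i ≠ k) :
    B (Y i j) (Y i j) = B (Y i k) (Y i k) := by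
  have h1 : Y i j = ⁅Y i k, Y k j⁆ := by
    rw [hY.lie, kron_self, kron_of_ne hik, kron_of_ne hij, kron_of_ne hjk.symm]; module
  have h2 : ⁅Y k j, Y i j⁆ = Y i k := by
    rw [hY.lie, kron_self, kron_of_ne hij.symm, kron_of_ne hik.symm, kron_of_ne hjk.symm,
      hY.skew k i]
    module
  nth_rw 1 [h1]
  rw [hinv, h2]

theorem SoFamily.form_self {l : ℂ} (i₀ j₀ : ι) (h₀ : i₀ ≠ j₀)
    (h : B (Y i₀ j₀) (Y i₀ j₀) = -l) (i j : ι) (hij : i ≠ j) : B (Y i j) (Y i j) = -l := by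
  have hsw : ∀ i j, B (Y i j) (Y i j) = B (Y j i) (Y j i) := by
    intro i j; rw [hY.skew i j]; simp
  have h1 : ∀ j, i₀ ≠ j → B (Y i₀ j) (Y i₀ j) = -l := by
    intro j hj
    by_cases hjj : j = j₀
    · rw [hjj, h]
    · rw [hY.form_right hinv hj hjj h₀, h]
  by_cases hi : i₀ = j
  · subst hi; rw [hsw, h1 i (Ne.symm hij)]
  · by_cases hi' : i = i₀
    · subst hi'; exact h1 j hij
    · rw [hsw, hY.form_right hinv (Ne.symm hij) hi' (Ne.symm hi), hsw, h1 j hi]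

/-- A fifth index `t` is indispensable: in `so(4)`, a sum of two ideals, an invariant form may take
any value here. -/
theorem SoFamily.form_disjoint {i j k l t : ι} (hij : i ≠ j)
    (hjk : j ≠ k) (hjl : j ≠ l) (hti : t ≠ i) (htj : t ≠ j) (htk : t ≠ k) (htl : t ≠ l) :
    B (Y i j) (Y k l) = 0 := by
  have h1 : Y i j = ⁅Y i t, Y t j⁆ := by
    rw [hY.lie, kron_self, kron_of_ne hti.symm, kron_of_ne hij, kron_of_ne htj]; module
  rw [h1, hinv, hY.lie, kron_of_ne htk, kron_of_ne htl, kron_of_ne hjk, kron_of_ne hjl]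
  simp

end FormValues

/-! ### Types and levels of orthogonal families: odd size -/

section SoDecomposition

variable {𝔤 : Type*} [LieRing 𝔤] [LieAlgebra ℂ 𝔤]

/-- The subalgebra spanned by an orthogonal family. -/
def soSubalgebra {ι : Type*} (Y : ι → ι → 𝔤) : LieSubalgebra ℂ 𝔤 :=
  LieSubalgebra.lieSpan ℂ 𝔤 (Set.range fun i : ι × ι ↦ Y i.1 i.2)

theorem mem_soSubalgebra {ι : Type*} (Y : ι → ι → 𝔤) (i j : ι) : Y i j ∈ soSubalgebra Y :=
  LieSubalgebra.subset_lieSpan ⟨(i, j), rfl⟩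

variable {n : ℕ} {Y : Fin n → Fin n → 𝔤} (hY : SoFamily Y)

theorem soForm_stdVec (Y : Fin n → Fin n → 𝔤) (i j : Fin n) :
    soForm Y (stdVec n i) (stdVec n j) = Y i j := by
  rw [stdVec_eq_single, stdVec_eq_single, soForm_single]

include hY

theorem SoFamily.soForm_isoP_isoQ (a : ℕ) (i j : Fin n) (hi : (i : ℕ) = 2 * a)
    (hj : (j : ℕ) = 2 * a + 1) : soForm Y (isoP n a) (isoQ n a) = (-Complex.I) • Y i j := by
  unfold isoP isoQ
  rw [← hj, ← hi]
  simp only [map_add, map_sub, LinearMap.map_smul, LinearMap.add_apply, LinearMap.smul_apply,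
    soForm_stdVec, hY.apply_self, hY.skew j i]
  module

/-- By `SoFamily.mem`, consecutive entries suffice. Those within a pair `(2k, 2k+1)` are multiples
of `p_k ∧ q_k`; those between two pairs expand into four products of isotropic vectors, or involve
the extra vector at the end in odd size. -/
theorem SoFamily.soSubalgebra_le {m : ℕ} (hn : n = 2 * m ∨ n = 2 * m + 1) (K : LieSubalgebra ℂ 𝔤)
    (hd : ∀ k < m, soForm Y (isoP n k) (isoQ n k) ∈ K)
    (hpq : ∀ k, k + 1 < m → soForm Y (isoP n k) (isoQ n (k + 1)) ∈ K)
    (hqp : ∀ k, k + 1 < m → soForm Y (isoP n (k + 1)) (isoQ n k) ∈ K)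
    (hpp : ∀ k, k + 1 < m → soForm Y (isoP n k) (isoP n (k + 1)) ∈ K)
    (hqq : ∀ k, k + 1 < m → soForm Y (isoQ n k) (isoQ n (k + 1)) ∈ K)
    (hpw : n = 2 * m + 1 → soForm Y (isoP n (m - 1)) (stdVec n (2 * m)) ∈ K)
    (hwq : n = 2 * m + 1 → soForm Y (stdVec n (2 * m)) (isoQ n (m - 1)) ∈ K) :
    soSubalgebra Y ≤ K := by
  refine LieSubalgebra.lieSpan_le.mpr ?_
  rintro _ ⟨⟨i, j⟩, rfl⟩
  refine hY.mem K (fun s t hst ↦ ?_) i j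
  have hs := s.2
  have ht := t.2
  obtain ⟨k, hk⟩ := Nat.even_or_odd' (s : ℕ)
  rcases hk with hk | hk
  · have h1 := K.smul_mem Complex.I (hd k (by omega))
    rw [hY.soForm_isoP_isoQ k s t hk (by omega), smul_smul, mul_neg, Complex.I_mul_I, neg_neg,
      one_smul] at h1
    exact h1
  · rw [← soForm_stdVec Y s t, hk, stdVec_odd]
    by_cases hkm : k + 1 < m
    · rw [show (t : ℕ) = 2 * (k + 1) by omega, stdVec_even]
      simp only [map_add, LinearMap.map_smul, LinearMap.add_apply, LinearMap.smul_apply]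
      refine K.add_mem (K.add_mem ?_ ?_) (K.add_mem ?_ ?_)
      · exact K.smul_mem _ (K.smul_mem _ (hpp k hkm))
      · refine K.smul_mem _ (K.smul_mem _ ?_)
        rw [hY.soForm_skew]
        exact neg_mem (hqp k hkm)
      · exact K.smul_mem _ (hpq k hkm)
      · exact K.smul_mem _ (hqq k hkm)
    · have hk' : k = m - 1 := by omega
      rw [show (t : ℕ) = 2 * m by omega, hk']
      simp only [map_add, LinearMap.map_smul, LinearMap.add_apply, LinearMap.smul_apply]
      refine K.add_mem (K.smul_mem _ (hpw (by omega))) (K.smul_mem _ ?_)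
      rw [hY.soForm_skew]
      exact neg_mem (hwq (by omega))

omit hY in
theorem soForm_mem_soSubalgebra (Y : Fin n → Fin n → 𝔤) (u v : Fin n → ℂ) :
    soForm Y u v ∈ soSubalgebra Y :=
  soForm_mem Y _ (mem_soSubalgebra Y) u v

variable {B : LinearMap.BilinForm ℂ 𝔤} (hinv : ∀ x y z : 𝔤, B ⁅x, y⁆ z = B x ⁅y, z⁆)
  (hs : B.IsSymm) {l : ℕ}
  (hl : ∀ i j : Fin n, (i : ℕ) = 0 → (j : ℕ) = 1 → B (Y i j) (Y i j) = -l)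
  (hdisj : n = 4 → ∀ i j k l : Fin n, (i : ℕ) = 0 → (j : ℕ) = 1 → (k : ℕ) = 2 → (l : ℕ) = 3 →
    B (Y i j) (Y k l) = 0)
include hinv hs hl hdisj

/-- The factor `-i` in `p_a ∧ q_a = -i Y_{2a,2a+1}` turns the norm `-l` into `l`. The elements `p_a
∧ q_a` are thus orthogonal of norm `l`, and the norms of the coroots follow. -/
theorem SoFamily.form_diag {m : ℕ} (hn : 2 * m ≤ n) (a b : ℕ) (ha : a < m) (hb : b < m) :
    B (soForm Y (isoP n a) (isoQ n a)) (soForm Y (isoP n b) (isoQ n b)) = l * kron a b := by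
  rw [hY.soForm_isoP_isoQ a ⟨2 * a, by omega⟩ ⟨2 * a + 1, by omega⟩ rfl rfl,
    hY.soForm_isoP_isoQ b ⟨2 * b, by omega⟩ ⟨2 * b + 1, by omega⟩ rfl rfl]
  simp only [map_smul, LinearMap.smul_apply, smul_eq_mul]
  by_cases hab : a = b
  · subst hab
    rw [hY.form_self hinv ⟨0, by omega⟩ ⟨1, by omega⟩ (by simp) (hl _ _ rfl rfl) _ _ (by simp),
      kron_self]
    linear_combination (-l : ℂ) * Complex.I_mul_I
  · rw [kron_of_ne hab]
    by_cases hn4 : n = 4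
    · obtain ⟨rfl, rfl⟩ | ⟨rfl, rfl⟩ : a = 0 ∧ b = 1 ∨ a = 1 ∧ b = 0 := by omega
      · rw [hdisj hn4 _ _ _ _ rfl rfl rfl rfl]; ring
      · rw [hs.eq, hdisj hn4 _ _ _ _ rfl rfl rfl rfl]; ring
    · obtain ⟨t, ht⟩ : ∃ t < n, t ≠ 2 * a ∧ t ≠ 2 * a + 1 ∧ t ≠ 2 * b ∧ t ≠ 2 * b + 1 := by
        by_contra! hcon
        have h0 := hcon 0
        have h1 := hcon 2
        have h2 := hcon 4
        omega
      rw [hY.form_disjoint hinv (t := ⟨t, ht.1⟩)]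
      · ring
      all_goals simp only [ne_eq, Fin.mk.injEq]; omega

theorem SoFamily.form_hD {m : ℕ} (hm : 2 ≤ m) (hn : n = 2 * m) (k : Fin m) :
    B (IsotropicPair.hD m (isoP n) (isoQ n) Y k) (IsotropicPair.hD m (isoP n) (isoQ n) Y k) =
      2 * l := by
  have hk := k.2
  unfold IsotropicPair.hD
  split_ifs <;> simp only [map_add, map_sub, LinearMap.add_apply, LinearMap.sub_apply] <;>
  · rw [hY.form_diag hinv hs hl hdisj hn.ge _ _ (by omega) (by omega),
      hY.form_diag hinv hs hl hdisj hn.ge _ _ (by omega) (by omega),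
      hY.form_diag hinv hs hl hdisj hn.ge _ _ (by omega) (by omega),
      hY.form_diag hinv hs hl hdisj hn.ge _ _ (by omega) (by omega), kron_self, kron_self,
      kron_of_ne (by omega), kron_of_ne (by omega)]
    ring

theorem SoFamily.form_hB {m : ℕ} (hn : n = 2 * m + 1) (k : Fin m) :
    B (IsotropicPair.hB m (isoP n) (isoQ n) Y k) (IsotropicPair.hB m (isoP n) (isoQ n) Y k) =
      if (k : ℕ) + 1 < m then 2 * (l : ℂ) else 4 * (l : ℂ) := by
  have hk := k.2
  have hn' : 2 * m ≤ n := by omega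
  unfold IsotropicPair.hB
  split_ifs
  · simp only [map_sub, LinearMap.sub_apply]
    rw [hY.form_diag hinv hs hl hdisj hn' _ _ (by omega) (by omega),
      hY.form_diag hinv hs hl hdisj hn' _ _ (by omega) (by omega),
      hY.form_diag hinv hs hl hdisj hn' _ _ (by omega) (by omega),
      hY.form_diag hinv hs hl hdisj hn' _ _ (by omega) (by omega), kron_self, kron_self,
      kron_of_ne (by omega), kron_of_ne (by omega)]
    ring
  · simp only [map_smul, LinearMap.smul_apply, smul_eq_mul]
    rw [hY.form_diag hinv hs hl hdisj hn' _ _ (by omega) (by omega), kron_self]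
    ring

variable (hl0 : l ≠ 0)
include hl0

theorem SoFamily.chevalleySystem_even {m : ℕ} (hm : 2 ≤ m) (hn : n = 2 * m) :
    ChevalleySystem (CartanMatrix.D m) (IsotropicPair.hD m (isoP n) (isoQ n) Y)
      (IsotropicPair.eD m (isoP n) (isoQ n) Y) (IsotropicPair.fD m (isoP n) (isoQ n) Y) := by
  refine (isotropicPair_std hn.ge).chevalleySystem_D hY hm fun k h0 ↦ ?_
  have := hY.form_hD hinv hs hl hdisj hm hn k
  rw [h0] at this
  simp [hl0] at this

theorem SoFamily.chevalleySystem_odd {m : ℕ} (hn : n = 2 * m + 1) :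
    ChevalleySystem (CartanMatrix.B m) (IsotropicPair.hB m (isoP n) (isoQ n) Y)
      (IsotropicPair.eB m (isoP n) (isoQ n) (stdVec n (2 * m)) Y)
      (IsotropicPair.fB m (isoP n) (isoQ n) (stdVec n (2 * m)) Y) := by
  refine (isotropicPair_std (by omega)).chevalleySystem_B hY ?_
    (fun i hi ↦ isoP_dotProduct_last hn hi) (fun i hi ↦ isoQ_dotProduct_last hn hi) fun k h0 ↦ ?_
  · rw [stdVec_dotProduct n (by omega), kron_self]
  · have := hY.form_hB hinv hs hl hdisj hn k
    rw [h0] at this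
    split_ifs at this <;> simp [hl0] at this

omit hs hl hdisj hl0 hinv in
theorem SoFamily.soSubalgebra_le_even {m : ℕ} (hm : 2 ≤ m) (hn : n = 2 * m)
    (K : LieSubalgebra ℂ 𝔤) (he : ∀ k, IsotropicPair.eD m (isoP n) (isoQ n) Y k ∈ K)
    (hf : ∀ k, IsotropicPair.fD m (isoP n) (isoQ n) Y k ∈ K) : soSubalgebra Y ≤ K := by
  have S := isotropicPair_std hn.ge
  have hpq : ∀ k, k + 1 < m → soForm Y (isoP n k) (isoQ n (k + 1)) ∈ K := fun k hk ↦ by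
    simpa [IsotropicPair.eD, hk] using he ⟨k, by omega⟩
  have hqp : ∀ k, k + 1 < m → soForm Y (isoP n (k + 1)) (isoQ n k) ∈ K := fun k hk ↦ by
    simpa [IsotropicPair.fD, hk] using hf ⟨k, by omega⟩
  have hpl : soForm Y (isoP n (m - 2)) (isoP n (m - 1)) ∈ K := by
    simpa [IsotropicPair.eD, show ¬m - 1 + 1 < m by omega] using he ⟨m - 1, by omega⟩
  have hql : soForm Y (isoQ n (m - 1)) (isoQ n (m - 2)) ∈ K := by
    simpa [IsotropicPair.fD, show ¬m - 1 + 1 < m by omega] using hf ⟨m - 1, by omega⟩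
  have hdl : soForm Y (isoP n (m - 1)) (isoQ n (m - 1)) ∈ K := by
    have h1 := K.lie_mem (hpq (m - 2) (by omega)) (hqp (m - 2) (by omega))
    have h2 := K.lie_mem hpl hql
    rw [show m - 2 + 1 = m - 1 by omega, hY.lie_soForm, S.pp _ _ (by omega) (by omega),
      S.qq _ _ (by omega) (by omega), S.pq _ _ (by omega) (by omega),
      S.qp _ _ (by omega) (by omega), kron_self, kron_self, hY.soForm_skew (isoQ _ _) (isoP _ _)]
      at h1
    rw [hY.lie_soForm, S.pq _ _ (by omega) (by omega), S.pq _ _ (by omega) (by omega),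
      S.pq _ _ (by omega) (by omega), S.pq _ _ (by omega) (by omega), kron_self, kron_self,
      kron_of_ne (by omega), kron_of_ne (by omega)] at h2
    -- The two brackets are the sum and the difference of the last two diagonal elements.
    have h3 := K.smul_mem (1 / 2 : ℂ) (sub_mem h2 h1)
    convert h3 using 1
    module
  exact hY.soSubalgebra_le (.inl hn) K (S.diag_mem hY K hpq hqp hdl) hpq hqp
    (S.pp_mem hY K hpq hpl) (S.qq_mem hY K hqp hql) (by omega) (by omega)

omit hs hl hdisj hl0 hinv in
theorem SoFamily.soSubalgebra_le_odd {m : ℕ} (hm : 1 ≤ m) (hn : n = 2 * m + 1)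
    (K : LieSubalgebra ℂ 𝔤)
    (he : ∀ k, IsotropicPair.eB m (isoP n) (isoQ n) (stdVec n (2 * m)) Y k ∈ K)
    (hf : ∀ k, IsotropicPair.fB m (isoP n) (isoQ n) (stdVec n (2 * m)) Y k ∈ K) :
    soSubalgebra Y ≤ K := by
  have S := isotropicPair_std (n := n) (m := m) (by omega)
  have hww : stdVec n (2 * m) ⬝ᵥ stdVec n (2 * m) = 1 := by
    rw [stdVec_dotProduct n (by omega), kron_self]
  have hpq : ∀ k, k + 1 < m → soForm Y (isoP n k) (isoQ n (k + 1)) ∈ K := fun k hk ↦ by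
    simpa [IsotropicPair.eB, hk] using he ⟨k, by omega⟩
  have hqp : ∀ k, k + 1 < m → soForm Y (isoP n (k + 1)) (isoQ n k) ∈ K := fun k hk ↦ by
    simpa [IsotropicPair.fB, hk] using hf ⟨k, by omega⟩
  have hpw : soForm Y (isoP n (m - 1)) (stdVec n (2 * m)) ∈ K := by
    simpa [IsotropicPair.eB, show ¬m - 1 + 1 < m by omega] using he ⟨m - 1, by omega⟩
  have hwq : soForm Y (stdVec n (2 * m)) (isoQ n (m - 1)) ∈ K := by
    have := hf ⟨m - 1, by omega⟩
    rw [IsotropicPair.fB, if_neg (by simp; omega)] at this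
    have := K.smul_mem (1 / 2 : ℂ) this
    rw [smul_smul] at this
    norm_num at this
    exact this
  have hp : ∀ i < m, isoP n i ⬝ᵥ stdVec n (2 * m) = 0 := fun i hi ↦ isoP_dotProduct_last hn hi
  have hq : ∀ i < m, isoQ n i ⬝ᵥ stdVec n (2 * m) = 0 := fun i hi ↦ isoQ_dotProduct_last hn hi
  have hp' : ∀ i < m, stdVec n (2 * m) ⬝ᵥ isoP n i = 0 := fun i hi ↦ by
    rw [dotProduct_comm, hp i hi]
  have hq' : ∀ i < m, stdVec n (2 * m) ⬝ᵥ isoQ n i = 0 := fun i hi ↦ by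
    rw [dotProduct_comm, hq i hi]
  have hdl : soForm Y (isoP n (m - 1)) (isoQ n (m - 1)) ∈ K := by
    have h1 := K.lie_mem hpw hwq
    rw [hY.lie_soForm, S.pq _ _ (by omega) (by omega), hww, hp _ (by omega), hq' _ (by omega),
      hY.soForm_self] at h1
    simpa using h1
  have hpp : ∀ k, k + 1 < m → soForm Y (isoP n k) (isoP n (k + 1)) ∈ K := by
    intro k hk
    refine S.pp_mem hY K hpq ?_ k hk
    have h1 := hpq (m - 2) (by omega)
    rw [show m - 2 + 1 = m - 1 by omega] at h1
    -- Bracketing twice with `p_{m-1} ∧ w` carries `q_{m-1}` to `w` and then `w` to `p_{m-1}`, up to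
    -- sign.
    have h2 := K.lie_mem (K.lie_mem h1 hpw) hpw
    simp (disch := omega) only [hY.lie_soForm, S.pp, S.qp, hww, hp, hq, hp', kron_self, zero_smul,
      one_smul, sub_zero, add_zero, zero_sub, neg_mem_iff] at h2
    exact h2
  have hqq : ∀ k, k + 1 < m → soForm Y (isoQ n k) (isoQ n (k + 1)) ∈ K := by
    intro k hk
    refine S.qq_mem hY K hqp ?_ k hk
    have h1 := hqp (m - 2) (by omega)
    rw [show m - 2 + 1 = m - 1 by omega] at h1
    have h2 := K.lie_mem (K.lie_mem h1 hwq) hwq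
    simp (disch := omega) only [hY.lie_soForm, S.pq, S.qq, hww, hp, hq, hq', kron_self, zero_smul,
      one_smul, sub_zero, add_zero, zero_add] at h2
    rw [hY.soForm_skew]
    exact neg_mem h2
  exact hY.soSubalgebra_le (.inr hn) K (S.diag_mem hY K hpq hqp hdl) hpq hqp hpp hqq
    (fun _ ↦ hpw) (fun _ ↦ hwq)

variable [FiniteDimensional ℂ 𝔤] {V : Type*} [AddCommGroup V] [Module ℂ V]
  (R : AffineAlgebra 𝔤 B 1 V)

theorem SoFamily.isComponent_B {m : ℕ} (hm : 2 ≤ m) (hn : n = 2 * m + 1) :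
    R.IsComponent (soSubalgebra Y) (.B m) l := by
  have S := hY.chevalleySystem_odd hinv hs hl hdisj hl0 hn
  have hK : soSubalgebra Y = S.subalgebra := by
    apply le_antisymm
    · exact hY.soSubalgebra_le_odd (by omega) hn _ S.e_mem S.f_mem
    · refine LieSubalgebra.lieSpan_le.mpr ?_
      rintro _ (⟨k, rfl⟩ | ⟨k, rfl⟩)
      · unfold IsotropicPair.eB; split_ifs <;> exact soForm_mem_soSubalgebra Y _ _
      · unfold IsotropicPair.fB
        split_ifs
        · exact soForm_mem_soSubalgebra Y _ _
        · exact (soSubalgebra Y).smul_mem _ (soForm_mem_soSubalgebra Y _ _)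
  rw [hK]
  refine S.isComponent R (isFiniteTypeMatrix_B m) hinv hs (.B m) (Equiv.refl _)
    (fun i j ↦ rfl) l hl0 fun i hi ↦ ?_
  rw [hY.form_hB hinv hs hl hdisj hn, if_pos]
  -- Only the last simple root is short, and the comparison with its neighbour at `m - 2` shows
  -- this.
  by_contra hcon
  have h1 := i.2
  have h2 := hi ⟨m - 2, by omega⟩
  simp only [CartanMatrix.B, Matrix.of_apply, Fin.ext_iff] at h2
  rw [if_neg (by omega), if_pos (by omega), if_pos (by omega), if_neg (by omega), if_neg (by omega),
    if_pos (by omega)] at h2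
  simp at h2

/-- For `so(3)` the only simple coroot is the doubled element `2 p ∧ q` of norm `4 l`. It counts as
long in type `A₁`, which doubles the level. -/
theorem SoFamily.isComponent_three (hn : n = 3) :
    R.IsComponent (soSubalgebra Y) (.A 1) (2 * l) := by
  have S := hY.chevalleySystem_odd (m := 1) hinv hs hl hdisj hl0 hn
  have hK : soSubalgebra Y = S.subalgebra := by
    apply le_antisymm
    · exact hY.soSubalgebra_le_odd le_rfl hn _ S.e_mem S.f_mem
    · refine LieSubalgebra.lieSpan_le.mpr ?_
      rintro _ (⟨k, rfl⟩ | ⟨k, rfl⟩)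
      · unfold IsotropicPair.eB; split_ifs <;> exact soForm_mem_soSubalgebra Y _ _
      · unfold IsotropicPair.fB
        split_ifs
        · exact soForm_mem_soSubalgebra Y _ _
        · exact (soSubalgebra Y).smul_mem _ (soForm_mem_soSubalgebra Y _ _)
  rw [hK]
  refine S.isComponent R (isFiniteTypeMatrix_B 1) hinv hs (.A 1) (Equiv.refl _) (fun i j ↦ ?_)
    (2 * l) (by omega) fun i hi ↦ ?_
  · rw [CartanMatrix.B_one]; rfl
  · have := i.2
    rw [hY.form_hB hinv hs hl hdisj hn, if_neg (by omega)]
    push_cast; ring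

end SoDecomposition

theorem ChevalleySystem.single {𝔤 : Type*} [LieRing 𝔤] [LieAlgebra ℂ 𝔤] {ι : Type*}
    {A : Matrix ι ι ℤ} {h e f : ι → 𝔤} (S : ChevalleySystem A h e f) (i : ι) (hi : A i i = 2) :
    ChevalleySystem (CartanMatrix.A 1) (fun _ ↦ h i) (fun _ ↦ e i) (fun _ ↦ f i) where
  h_ne_zero _ := S.h_ne_zero i
  lie_e_f _ := S.lie_e_f i
  lie_e_f_ne j k hjk := absurd (Subsingleton.elim j k) hjk
  lie_h_h _ _ := S.lie_h_h i i
  lie_h_e j k := by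
    rw [S.lie_h_e, hi, Subsingleton.elim j k]; simp [CartanMatrix.A]
  lie_h_f j k := by
    rw [S.lie_h_f, hi, Subsingleton.elim j k]; simp [CartanMatrix.A]

theorem isFiniteTypeMatrix_A_one : IsFiniteTypeMatrix (CartanMatrix.A 1) :=
  CartanMatrix.B_one ▸ isFiniteTypeMatrix_B 1

/-! ### Types and levels of orthogonal families: even size -/

section SoDecompositionEven

variable {𝔤 : Type*} [LieRing 𝔤] [LieAlgebra ℂ 𝔤] {n : ℕ} {Y : Fin n → Fin n → 𝔤}
  (hY : SoFamily Y) {B : LinearMap.BilinForm ℂ 𝔤} (hinv : ∀ x y z : 𝔤, B ⁅x, y⁆ z = B x ⁅y, z⁆)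
  (hs : B.IsSymm) {l : ℕ}
  (hl : ∀ i j : Fin n, (i : ℕ) = 0 → (j : ℕ) = 1 → B (Y i j) (Y i j) = -l)
  (hdisj : n = 4 → ∀ i j k l : Fin n, (i : ℕ) = 0 → (j : ℕ) = 1 → (k : ℕ) = 2 → (l : ℕ) = 3 →
    B (Y i j) (Y k l) = 0)
  [FiniteDimensional ℂ 𝔤] {V : Type*} [AddCommGroup V] [Module ℂ V]
  (R : AffineAlgebra 𝔤 B 1 V) (hl0 : l ≠ 0)
include hY hinv hs hl hdisj hl0

/-- The type and the numbering of its nodes are left free so that `so(6)` can be recorded as `A₃`.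
-/
theorem SoFamily.isComponent_D {m : ℕ} (hm : 3 ≤ m) (hn : n = 2 * m) (T : DynkinType)
    (ε : Fin m ≃ Fin T.rank) (hT : ∀ i j, CartanMatrix.D m i j = T.cartanMatrix (ε i) (ε j)) :
    R.IsComponent (soSubalgebra Y) T l := by
  have S := hY.chevalleySystem_even hinv hs hl hdisj hl0 (by omega) hn
  have hK : soSubalgebra Y = S.subalgebra := by
    apply le_antisymm
    · exact hY.soSubalgebra_le_even (by omega) hn _ S.e_mem S.f_mem
    · refine LieSubalgebra.lieSpan_le.mpr ?_
      rintro _ (⟨k, rfl⟩ | ⟨k, rfl⟩)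
      · unfold IsotropicPair.eD; split_ifs <;> exact soForm_mem_soSubalgebra Y _ _
      · unfold IsotropicPair.fD; split_ifs <;> exact soForm_mem_soSubalgebra Y _ _
  rw [hK]
  exact S.isComponent R (isFiniteTypeMatrix_D m hm) hinv hs T ε hT l hl0
    fun i _ ↦ hY.form_hD hinv hs hl hdisj (by omega) hn i

/-- The Cartan matrix of `D₂` is diagonal, so its two triples generate commuting copies of `sl₂`. -/
theorem SoFamily.hasDecomposition_four (hn : n = 4) :
    HasDecomposition R (soSubalgebra Y) [(.A 1, l), (.A 1, l)] := by
  have S := hY.chevalleySystem_even (m := 2) hinv hs hl hdisj hl0 le_rfl hn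
  have hI := isotropicPair_std (n := n) (m := 2) hn.ge
  have S₀ := S.single 0 (by simp)
  have S₁ := S.single 1 (by simp)
  have hK : soSubalgebra Y = S₀.subalgebra ⊔ S₁.subalgebra := by
    apply le_antisymm
    · refine hY.soSubalgebra_le_even (m := 2) le_rfl hn _ ?_ ?_ <;> intro k <;> fin_cases k
      · exact (le_sup_left : S₀.subalgebra ≤ _) (S₀.e_mem 0)
      · exact (le_sup_right : S₁.subalgebra ≤ _) (S₁.e_mem 0)
      · exact (le_sup_left : S₀.subalgebra ≤ _) (S₀.f_mem 0)
      · exact (le_sup_right : S₁.subalgebra ≤ _) (S₁.f_mem 0)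
    · refine sup_le (LieSubalgebra.lieSpan_le.mpr ?_) (LieSubalgebra.lieSpan_le.mpr ?_) <;>
      rintro _ (⟨k, rfl⟩ | ⟨k, rfl⟩) <;>
      first
        | (unfold IsotropicPair.eD; split_ifs <;> exact soForm_mem_soSubalgebra Y _ _)
        | (unfold IsotropicPair.fD; split_ifs <;> exact soForm_mem_soSubalgebra Y _ _)
  have hcomp : ∀ i : Fin 2, R.IsComponent (S.single i (by simp)).subalgebra (.A 1) l := fun i ↦
    (S.single i (by simp)).isComponent R isFiniteTypeMatrix_A_one hinv hs (.A 1) (Equiv.refl _)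
      (fun _ _ ↦ rfl) l hl0 fun _ _ ↦ hY.form_hD hinv hs hl hdisj le_rfl hn i
  rw [hK]
  refine (HasDecomposition.of_isComponent (hcomp 0)).sup
    (HasDecomposition.of_isComponent (hcomp 1)) (lieCommute_lieSpan ?_)
  have h1 : ⁅IsotropicPair.eD 2 (isoP n) (isoQ n) Y 0, IsotropicPair.eD 2 (isoP n) (isoQ n) Y 1⁆ =
      0 := by
    simp [IsotropicPair.eD, hY.lie_soForm, hI.pp, hI.qp, hY.soForm_self, kron]
  have h2 : ⁅IsotropicPair.fD 2 (isoP n) (isoQ n) Y 0, IsotropicPair.fD 2 (isoP n) (isoQ n) Y 1⁆ =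
      0 := by
    simp [IsotropicPair.fD, hY.lie_soForm, hI.pq, hI.qq, hY.soForm_self, kron]
  rintro _ (⟨_, rfl⟩ | ⟨_, rfl⟩) _ (⟨_, rfl⟩ | ⟨_, rfl⟩)
  · exact h1
  · exact S.lie_e_f_ne 0 1 (by decide)
  · rw [← lie_skew, S.lie_e_f_ne 1 0 (by decide), neg_zero]
  · exact h2

theorem SoFamily.hasDecomposition_even {m : ℕ} (hm : 2 ≤ m) (hn : n = 2 * m) :
    HasDecomposition R (soSubalgebra Y) (typeD m l) := by
  unfold typeD
  split_ifs with h2 h3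
  · exact hY.hasDecomposition_four hinv hs hl hdisj R hl0 (by omega)
  · subst h3
    -- In this numbering of `D₃` the node 0 is the middle one, and the transposition puts it in the
    -- middle of the chain.
    refine .of_isComponent (hY.isComponent_D hinv hs hl hdisj R hl0 le_rfl hn (.A 3)
      (Equiv.swap (0 : Fin 3) 1) ?_)
    change ∀ i j : Fin 3, CartanMatrix.D 3 i j =
      CartanMatrix.A 3 (Equiv.swap (0 : Fin 3) 1 i) (Equiv.swap (0 : Fin 3) 1 j)
    intro i j
    fin_cases i <;> fin_cases j <;> decide
  · exact .of_isComponent (hY.isComponent_D hinv hs hl hdisj R hl0 (by omega) hn (.D m)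
      (Equiv.refl _) fun i j ↦ rfl)

end SoDecompositionEven

/-! ### Chains of Berman generators -/

section Chain

variable {𝔤 : Type*} [LieRing 𝔤] [LieAlgebra ℂ 𝔤]

theorem exists_soVector_last {n : ℕ} {Y : Fin (n + 1) → Fin (n + 1) → 𝔤} (hY : SoFamily Y) (y : 𝔤)
    (hcomm : ∀ i : Fin n, (i : ℕ) + 1 ≠ n → ⁅Y i.castSucc i.succ, y⁆ = 0)
    (hadj : ∀ i : Fin n, (i : ℕ) + 1 = n →
      ⁅Y i.castSucc i.succ, ⁅Y i.castSucc i.succ, y⁆⁆ = -y ∧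
      ⁅y, ⁅y, Y i.castSucc i.succ⁆⁆ = -Y i.castSucc i.succ) :
    ∃ v, SoVector Y v ∧ v (Fin.last n) = y := by
  rcases n with _ | n
  -- With one index the family is zero, and any element is a vector.
  · refine ⟨fun _ ↦ y, ⟨fun i j k ↦ ?_, fun i j ↦ ?_⟩, rfl⟩
    · rw [show j = i from (Fin.subsingleton_one.elim j i :), hY.apply_self]; simp
    · rw [show j = i from (Fin.subsingleton_one.elim j i :), hY.apply_self]; simp
  · have hm : (Fin.last n).castSucc ≠ Fin.last (n + 1) := (Fin.castSucc_lt_last _).ne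
    have hd := hadj (Fin.last n) rfl
    rw [Fin.succ_last] at hd
    -- The centralizer of `y` is a subalgebra, so commuting with consecutive entries is enough.
    let K : LieSubalgebra ℂ 𝔤 :=
      { __ := LinearMap.ker (LieAlgebra.ad ℂ 𝔤 y : 𝔤 →ₗ[ℂ] 𝔤)
        lie_mem' := by
          intro a b ha hb
          have ha' : ⁅y, a⁆ = 0 := ha
          have hb' : ⁅y, b⁆ = 0 := hb
          change ⁅y, ⁅a, b⁆⁆ = 0
          rw [leibniz_lie, ha', hb', zero_lie, lie_zero, add_zero] }
    have hlt : ∀ i j : Fin (n + 2), j ≠ Fin.last (n + 1) → i < j → ⁅Y i j, y⁆ = 0 := by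
      intro i j hj hij
      have hj' : (j : ℕ) ≠ n + 1 := fun h ↦ hj (Fin.ext h)
      have : Y i j ∈ K := by
        refine hY.mem_of_consecutive K i j hij fun s t _ ht hst ↦ ?_
        have h1 := hcomm ⟨s, by omega⟩ (by simp only; omega)
        change ⁅y, Y s t⁆ = 0
        rw [← lie_skew, neg_eq_zero]
        rwa [show (⟨s, by omega⟩ : Fin (n + 1)).castSucc = s from rfl,
          show (⟨s, by omega⟩ : Fin (n + 1)).succ = t from Fin.ext hst] at h1
      have h2 : ⁅y, Y i j⁆ = 0 := this
      rw [← lie_skew, h2, neg_zero]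
    have hall : ∀ i j, i ≠ Fin.last (n + 1) → j ≠ Fin.last (n + 1) → ⁅Y i j, y⁆ = 0 := by
      intro i j hi hj
      rcases lt_trichotomy i j with hij | hij | hij
      · exact hlt i j hj hij
      · rw [hij, hY.apply_self, zero_lie]
      · rw [hY.skew, neg_lie, hlt j i hi hij, neg_zero]
    obtain ⟨v, hv, hvl, -⟩ := exists_soVector hY hm hall hd.1 hd.2
    exact ⟨v, hv, hvl⟩

/-- The family with one more index, numbered by an initial segment. -/
def snocFamily {n : ℕ} (Y : Fin n → Fin n → 𝔤) (v : Fin n → 𝔤) (i j : Fin (n + 1)) : 𝔤 :=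
  extendFamily Y v (finSuccEquivLast i) (finSuccEquivLast j)

theorem SoFamily.snoc {n : ℕ} {Y : Fin n → Fin n → 𝔤} (hY : SoFamily Y) {v : Fin n → 𝔤}
    (hv : SoVector Y v) : SoFamily (snocFamily Y v) :=
  (hY.extend hv).comp finSuccEquivLast

omit [LieAlgebra ℂ 𝔤] in
theorem snocFamily_castSucc {n : ℕ} (Y : Fin n → Fin n → 𝔤) (v : Fin n → 𝔤) (i j : Fin n) :
    snocFamily Y v i.castSucc j.castSucc = Y i j := by
  simp [snocFamily, extendFamily]

omit [LieAlgebra ℂ 𝔤] in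
theorem snocFamily_last {n : ℕ} (Y : Fin n → Fin n → 𝔤) (v : Fin n → 𝔤) (i : Fin n) :
    snocFamily Y v i.castSucc (Fin.last n) = v i := by
  simp [snocFamily, extendFamily]

/-- By induction on the length: the new generator commutes with all earlier ones but the last, so it
is the entry at the last index of a vector over the family built so far. -/
theorem exists_soFamily_of_chain {n : ℕ} (x : Fin n → 𝔤)
    (hcomm : ∀ i j : Fin n, (i : ℕ) + 1 < j → ⁅x i, x j⁆ = 0)
    (hadj : ∀ i j : Fin n, (i : ℕ) + 1 = j →
      ⁅x i, ⁅x i, x j⁆⁆ = -x j ∧ ⁅x j, ⁅x j, x i⁆⁆ = -x i) :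
    ∃ Y : Fin (n + 1) → Fin (n + 1) → 𝔤, SoFamily Y ∧
      ∀ i : Fin n, Y i.castSucc i.succ = x i := by
  induction n with
  | zero => exact ⟨fun _ _ ↦ 0, ⟨by simp, by simp⟩, fun i ↦ i.elim0⟩
  | succ n ih =>
    obtain ⟨Y, hY, hx⟩ := ih (fun i ↦ x i.castSucc) (fun i j ↦ hcomm i.castSucc j.castSucc)
      (fun i j ↦ hadj i.castSucc j.castSucc)
    obtain ⟨v, hv, hvl⟩ := exists_soVector_last hY (x (Fin.last n))
      (fun i hi ↦ by
        have := i.2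
        rw [hx]
        exact hcomm _ _ (by simp; omega))
      (fun i hi ↦ by
        rw [hx]
        exact hadj _ _ (by simpa using hi))
    refine ⟨snocFamily Y v, hY.snoc hv, fun i ↦ ?_⟩
    induction i using Fin.lastCases with
    | last => rw [Fin.succ_last, snocFamily_last, hvl]
    | cast i => rw [Fin.succ_castSucc, snocFamily_castSucc, hx]

theorem soSubalgebra_eq_of_chain {n : ℕ} (x : Fin n → 𝔤) {Y : Fin (n + 1) → Fin (n + 1) → 𝔤}
    (hY : SoFamily Y) (hx : ∀ i : Fin n, Y i.castSucc i.succ = x i) :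
    soSubalgebra Y = LieSubalgebra.lieSpan ℂ 𝔤 (Set.range x) := by
  apply le_antisymm
  · refine LieSubalgebra.lieSpan_le.mpr ?_
    rintro _ ⟨⟨i, j⟩, rfl⟩
    refine hY.mem _ (fun s t hst ↦ ?_) i j
    have ht := t.2
    have h := hx ⟨s, by omega⟩
    have hs : (⟨s, by omega⟩ : Fin n).castSucc = s := rfl
    have ht : (⟨s, by omega⟩ : Fin n).succ = t := Fin.ext hst
    rw [hs, ht] at h
    rw [h]
    exact LieSubalgebra.subset_lieSpan ⟨_, rfl⟩
  · refine LieSubalgebra.lieSpan_le.mpr ?_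
    rintro _ ⟨i, rfl⟩
    rw [← hx]
    exact mem_soSubalgebra _ _ _

variable [FiniteDimensional ℂ 𝔤] {V : Type*} [AddCommGroup V] [Module ℂ V]
  {B : LinearMap.BilinForm ℂ 𝔤} (hinv : ∀ x y z : 𝔤, B ⁅x, y⁆ z = B x ⁅y, z⁆)
  (hs : B.IsSymm) (R : AffineAlgebra 𝔤 B 1 V)
include hinv hs

/-- The norm `-2` of the generators means `l = 2`. The vanishing of `B` on distinct generators
supplies the extra datum that `so(4)` requires. -/
theorem hasDecomposition_of_chain {n : ℕ} (x : Fin n → 𝔤)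
    (hcomm : ∀ i j : Fin n, (i : ℕ) + 1 < j → ⁅x i, x j⁆ = 0)
    (hadj : ∀ i j : Fin n, (i : ℕ) + 1 = j →
      ⁅x i, ⁅x i, x j⁆⁆ = -x j ∧ ⁅x j, ⁅x j, x i⁆⁆ = -x i)
    (hB : ∀ i j, B (x i) (x j) = if i = j then -2 else 0) :
    (n = 2 → HasDecomposition R (LieSubalgebra.lieSpan ℂ 𝔤 (Set.range x)) [(.A 1, 4)]) ∧
    (∀ m, 2 ≤ m → n = 2 * m →
      HasDecomposition R (LieSubalgebra.lieSpan ℂ 𝔤 (Set.range x)) [(.B m, 2)]) ∧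
    (∀ m, 2 ≤ m → n = 2 * m - 1 →
      HasDecomposition R (LieSubalgebra.lieSpan ℂ 𝔤 (Set.range x)) (typeD m 2)) := by
  obtain ⟨Y, hY, hx⟩ := exists_soFamily_of_chain x hcomm hadj
  rw [← soSubalgebra_eq_of_chain x hY hx]
  have hcons : ∀ (s t : Fin (n + 1)) (hst : (s : ℕ) + 1 = t),
      Y s t = x ⟨s, by have := t.2; omega⟩ := by
    intro s t hst
    rw [← hx]
    congr 1
    exact Fin.ext hst.symm
  have hl : ∀ i j : Fin (n + 1), (i : ℕ) = 0 → (j : ℕ) = 1 → B (Y i j) (Y i j) = -(2 : ℕ) := by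
    intro i j hi hj
    rw [hcons i j (by omega), hB, if_pos rfl]
    norm_num
  have hdisj : n + 1 = 4 → ∀ i j k l : Fin (n + 1), (i : ℕ) = 0 → (j : ℕ) = 1 → (k : ℕ) = 2 →
      (l : ℕ) = 3 → B (Y i j) (Y k l) = 0 := by
    intro _ i j k l hi hj hk hl
    rw [hcons i j (by omega), hcons k l (by omega), hB, if_neg]
    simp only [Fin.mk.injEq]; omega
  refine ⟨fun hn ↦ ?_, fun m hm hn ↦ ?_, fun m hm hn ↦ ?_⟩
  · exact .of_isComponent (hY.isComponent_three hinv hs hl hdisj two_ne_zero R (by omega))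
  · exact .of_isComponent (hY.isComponent_B hinv hs hl hdisj two_ne_zero R hm (by omega))
  · exact hY.hasDecomposition_even hinv hs hl hdisj R two_ne_zero hm (by omega)

end Chain

/-! ### Forked diagrams of Berman generators -/

section Fork

variable {𝔤 : Type*} [LieRing 𝔤] [LieAlgebra ℂ 𝔤] {B : LinearMap.BilinForm ℂ 𝔤}

/-- For `D₄` each half is a copy of `so(4)`, where the value of `B` on disjoint entries does not
follow from the norms and is computed from the generators. -/
theorem form_half_disjoint (hinv : ∀ x y z : 𝔤, B ⁅x, y⁆ z = B x ⁅y, z⁆) (hs : B.IsSymm)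
    {ι : Type*} [DecidableEq ι] {Y : ι → ι → 𝔤} (hY : SoFamily Y) {a b : ι → 𝔤} (ha : SoVector Y a)
    (hb : SoVector Y b) (hc : ∀ i j, ⁅a i, b j⁆ = -⁅a j, b i⁆) {i j k : ι} (hij : i ≠ j)
    (hik : i ≠ k) (hjk : j ≠ k) (h₁ : B (Y i j) (a k) = 0) (h₂ : B (Y i j) (b k) = 0) (s : ℂ) :
    B ((1 / 2 : ℂ) • (Y i j - s • ⁅a i, b j⁆)) ((1 / 2 : ℂ) • (a k + s • b k)) = 0 := by
  have e1 : B ⁅a i, b j⁆ (a k) = 0 := by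
    rw [hinv, ← lie_skew, hc k j, neg_neg, ← hinv, ha.lie_self]
    simp [h₂]
  have e2 : B ⁅a i, b j⁆ (b k) = 0 := by
    have h3 : a i = ⁅Y i k, a k⁆ := by
      rw [ha.lie, kron_self, kron_of_ne hik]; module
    have h4 : ⁅Y i k, Y j k⁆ = -Y i j := by
      rw [hY.lie, kron_self, kron_of_ne hij, kron_of_ne hjk.symm, kron_of_ne hik]; module
    rw [hinv, hb.lie_self, h3, ← lie_skew]
    simp only [map_neg, LinearMap.neg_apply, neg_neg]
    rw [hinv, h4, map_neg, hs.eq, h₁, neg_zero]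
  simp [h₁, h₂, e1, e2]

theorem hasDecomposition_of_fork [FiniteDimensional ℂ 𝔤] {V : Type*} [AddCommGroup V] [Module ℂ V]
    (hinv : ∀ x y z : 𝔤, B ⁅x, y⁆ z = B x ⁅y, z⁆) (hs : B.IsSymm) (R : AffineAlgebra 𝔤 B 1 V)
    {n : ℕ} (hn : 2 ≤ n) (x : ℕ → 𝔤)
    (hcomm : ∀ i j, i < j → j < n + 2 → ¬(i + 1 = j ∧ j ≤ n) → ¬(i + 1 = n ∧ j = n + 1) →
      ⁅x i, x j⁆ = 0)
    (hadj : ∀ i j, i < j → j < n + 2 → i + 1 = j ∧ j ≤ n ∨ i + 1 = n ∧ j = n + 1 →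
      ⁅x i, ⁅x i, x j⁆⁆ = -x j ∧ ⁅x j, ⁅x j, x i⁆⁆ = -x i)
    (hB : ∀ i j, i < n + 2 → j < n + 2 → B (x i) (x j) = if i = j then -2 else 0) :
    (∀ m, 2 ≤ m → n + 2 = 2 * m →
      HasDecomposition R (LieSubalgebra.lieSpan ℂ 𝔤 (x '' Set.Iio (n + 2)))
        (typeD m 1 ++ typeD m 1)) ∧
    (∀ m, 2 ≤ m → n + 2 = 2 * m + 1 →
      HasDecomposition R (LieSubalgebra.lieSpan ℂ 𝔤 (x '' Set.Iio (n + 2)))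
        [(.B m, 1), (.B m, 1)]) := by
  obtain ⟨Y, hY, hx⟩ := exists_soFamily_of_chain (fun i : Fin n ↦ x i)
    (fun i j hij ↦ hcomm i j (by omega) (by omega) (by omega) (by omega))
    (fun i j hij ↦ hadj i j (by omega) (by omega) (by omega))
  obtain ⟨a, ha, hal⟩ := exists_soVector_last hY (x n)
    (fun i hi ↦ by rw [hx]; exact hcomm _ _ i.2 (by omega) (by omega) (by omega))
    (fun i hi ↦ by rw [hx]; exact hadj _ _ i.2 (by omega) (by omega))
  obtain ⟨b, hb, hbl⟩ := exists_soVector_last hY (x (n + 1))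
    (fun i hi ↦ by rw [hx]; exact hcomm _ _ (by omega) (by omega) (by omega) (by omega))
    (fun i hi ↦ by rw [hx]; exact hadj _ _ (by omega) (by omega) (by omega))
  have hc := lie_vectors_skew ha hb (l := Fin.last n) (by
    rw [hal, hbl]; exact hcomm _ _ (by omega) (by omega) (by omega) (by omega))
  -- The chain occupies `n + 1` indices; the half sum or half difference of the two vectors supplies
  -- the last one.
  let Z : ℂ → Fin (n + 2) → Fin (n + 2) → 𝔤 := fun s ↦
    snocFamily (fun i j ↦ (1 / 2 : ℂ) • (Y i j - s • ⁅a i, b j⁆))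
      (fun i ↦ (1 / 2 : ℂ) • (a i + s • b i))
  have hZ : ∀ s : ℂ, s * s = 1 → SoFamily (Z s) := fun s hs ↦
    (soFamily_half hY ha hb hc s hs).snoc (soVector_half ha hb hc s hs)
  have hZc : LieCommute (soSubalgebra (Z 1)) (soSubalgebra (Z (-1))) := by
    refine lieCommute_lieSpan ?_
    rintro _ ⟨⟨i, j⟩, rfl⟩ _ ⟨⟨k, l⟩, rfl⟩
    exact extendFamily_half_commute hY ha hb hc _ _ _ _
  have hmemY : ∀ i j, Y i j ∈ LieSubalgebra.lieSpan ℂ 𝔤 (x '' Set.Iio (n + 2)) := by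
    intro i j
    have h1 := mem_soSubalgebra Y i j
    rw [soSubalgebra_eq_of_chain _ hY hx] at h1
    refine LieSubalgebra.lieSpan_mono ?_ h1
    rintro _ ⟨i, rfl⟩
    exact ⟨i, by simp only [Set.mem_Iio]; omega, rfl⟩
  have hvec : ∀ (v : Fin (n + 1) → 𝔤), SoVector Y v →
      v (Fin.last n) ∈ LieSubalgebra.lieSpan ℂ 𝔤 (x '' Set.Iio (n + 2)) →
      ∀ i, v i ∈ LieSubalgebra.lieSpan ℂ 𝔤 (x '' Set.Iio (n + 2)) := by
    intro v hv hvl i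
    by_cases hi : i = Fin.last n
    · rwa [hi]
    · have h1 := LieSubalgebra.lie_mem _ (hmemY i (Fin.last n)) hvl
      rw [hv.lie, kron_self, kron_of_ne hi] at h1
      simpa using h1
  have hmema := hvec a ha (hal ▸ LieSubalgebra.subset_lieSpan ⟨n, by simp, rfl⟩)
  have hmemb := hvec b hb (hbl ▸ LieSubalgebra.subset_lieSpan ⟨n + 1, by simp, rfl⟩)
  have hle : ∀ s, soSubalgebra (Z s) ≤ LieSubalgebra.lieSpan ℂ 𝔤 (x '' Set.Iio (n + 2)) := by
    intro s
    have h1 : ∀ i : Fin (n + 1), (1 / 2 : ℂ) • (a i + s • b i) ∈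
        LieSubalgebra.lieSpan ℂ 𝔤 (x '' Set.Iio (n + 2)) := fun i ↦
      LieSubalgebra.smul_mem _ _ (add_mem (hmema i) (LieSubalgebra.smul_mem _ _ (hmemb i)))
    refine LieSubalgebra.lieSpan_le.mpr ?_
    rintro _ ⟨⟨i, j⟩, rfl⟩
    simp only [Z, snocFamily]
    rcases finSuccEquivLast i with _ | i <;> rcases finSuccEquivLast j with _ | j
    · exact zero_mem _
    · exact neg_mem (h1 j)
    · exact h1 i
    · exact LieSubalgebra.smul_mem _ _ (sub_mem (hmemY i j)
        (LieSubalgebra.smul_mem _ _ (LieSubalgebra.lie_mem _ (hmema i) (hmemb j))))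
  have hsup : LieSubalgebra.lieSpan ℂ 𝔤 (x '' Set.Iio (n + 2)) =
      soSubalgebra (Z 1) ⊔ soSubalgebra (Z (-1)) := by
    apply le_antisymm
    · have hp : ∀ i j, Z 1 i j ∈ soSubalgebra (Z 1) ⊔ soSubalgebra (Z (-1)) := fun i j ↦
        (le_sup_left : soSubalgebra (Z 1) ≤ _) (mem_soSubalgebra _ i j)
      have hq : ∀ i j, Z (-1) i j ∈ soSubalgebra (Z 1) ⊔ soSubalgebra (Z (-1)) := fun i j ↦
        (le_sup_right : soSubalgebra (Z (-1)) ≤ _) (mem_soSubalgebra _ i j)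
      refine LieSubalgebra.lieSpan_le.mpr ?_
      rintro _ ⟨k, hk, rfl⟩
      have hk' : k < n + 2 := hk
      obtain hk | rfl | rfl : k < n ∨ k = n ∨ k = n + 1 := by omega
      · have h1 : x k = Z 1 (Fin.castSucc (⟨k, hk⟩ : Fin n).castSucc)
            (Fin.castSucc (⟨k, hk⟩ : Fin n).succ) + Z (-1) (Fin.castSucc (⟨k, hk⟩ : Fin n).castSucc)
            (Fin.castSucc (⟨k, hk⟩ : Fin n).succ) := by
          simp only [Z, snocFamily_castSucc]
          rw [show Y (⟨k, hk⟩ : Fin n).castSucc (⟨k, hk⟩ : Fin n).succ = x k from hx ⟨k, hk⟩]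
          module
        rw [h1]
        exact add_mem (hp _ _) (hq _ _)
      · have h1 : x k = Z 1 (Fin.last k).castSucc (Fin.last _) +
            Z (-1) (Fin.last k).castSucc (Fin.last _) := by
          simp only [Z, snocFamily_last]
          rw [hal]
          module
        rw [h1]
        exact add_mem (hp _ _) (hq _ _)
      · have h1 : x (n + 1) = Z 1 (Fin.last n).castSucc (Fin.last _) -
            Z (-1) (Fin.last n).castSucc (Fin.last _) := by
          simp only [Z, snocFamily_last]
          rw [hbl]
          module
        rw [h1]
        exact sub_mem (hp _ _) (hq _ _)
    · exact sup_le (hle 1) (hle (-1))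
  -- The generators at the two ends are orthogonal of norm `-2`, so the norm here is `(-2 - 2 s²) /
  -- 4 = -1`.
  have hlast : ∀ s : ℂ, s * s = 1 → B (Z s (Fin.last n).castSucc (Fin.last _))
      (Z s (Fin.last n).castSucc (Fin.last _)) = -(1 : ℕ) := by
    intro s hs'
    simp only [Z, snocFamily_last, hal, hbl, map_smul, map_add, LinearMap.smul_apply,
      LinearMap.add_apply, smul_eq_mul]
    rw [hB _ _ (by omega) (by omega), hB _ _ (by omega) (by omega), hB _ _ (by omega) (by omega),
      hB _ _ (by omega) (by omega), if_pos rfl, if_pos rfl, if_neg (by omega), if_neg (by omega)]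
    push_cast
    linear_combination (-1 / 2) * hs'
  have hl : ∀ s : ℂ, s * s = 1 → ∀ i j : Fin (n + 2), (i : ℕ) = 0 → (j : ℕ) = 1 →
      B (Z s i j) (Z s i j) = -(1 : ℕ) := by
    intro s hs' i j hi hj
    exact (hZ s hs').form_self hinv _ _ (Fin.castSucc_lt_last _).ne (hlast s hs') i j (by omega)
  have hdisj : ∀ s : ℂ, n + 2 = 4 → ∀ i j k l : Fin (n + 2), (i : ℕ) = 0 → (j : ℕ) = 1 →
      (k : ℕ) = 2 → (l : ℕ) = 3 → B (Z s i j) (Z s k l) = 0 := by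
    intro s hn4 i j k l hi hj hk hl
    obtain rfl : n = 2 := by omega
    obtain rfl : i = (0 : Fin 3).castSucc := Fin.ext hi
    obtain rfl : j = (1 : Fin 3).castSucc := Fin.ext hj
    obtain rfl : k = (2 : Fin 3).castSucc := Fin.ext hk
    obtain rfl : l = Fin.last 3 := Fin.ext hl
    simp only [Z, snocFamily_castSucc, snocFamily_last]
    have h0 : Y 0 1 = x 0 := hx 0
    refine form_half_disjoint hinv hs hY ha hb hc (by decide) (by decide) (by decide) ?_ ?_ s
    · rw [h0, show a 2 = x 2 from hal, hB _ _ (by omega) (by omega), if_neg (by omega)]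
    · rw [h0, show b 2 = x 3 from hbl, hB _ _ (by omega) (by omega), if_neg (by omega)]
  have h1 : (1 : ℂ) * 1 = 1 := by norm_num
  have h2 : (-1 : ℂ) * -1 = 1 := by norm_num
  rw [hsup]
  refine ⟨fun m hm hn ↦ ?_, fun m hm hn ↦ ?_⟩
  · exact ((hZ 1 h1).hasDecomposition_even hinv hs (hl 1 h1) (hdisj 1) R one_ne_zero hm hn).sup
      ((hZ (-1) h2).hasDecomposition_even hinv hs (hl (-1) h2) (hdisj (-1)) R one_ne_zero hm hn) hZc
  · exact (HasDecomposition.of_isComponent ((hZ 1 h1).isComponent_B hinv hs (hl 1 h1) (hdisj 1)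
      one_ne_zero R hm hn)).sup (HasDecomposition.of_isComponent ((hZ (-1) h2).isComponent_B hinv hs
      (hl (-1) h2) (hdisj (-1)) one_ne_zero R hm hn)) hZc

end Fork

/-! ### Simply laced root systems in coordinates -/

section Frame

variable {ι : Type*} [Fintype ι] [DecidableEq ι]

/-- The bilinear form on the lattice `ℤ^ι` with Gram matrix `A`. -/
def latticeForm (A : Matrix ι ι ℤ) : (ι → ℤ) →ₗ[ℤ] (ι → ℤ) →ₗ[ℤ] ℤ := Matrix.toLinearMap₂' ℤ A

theorem latticeForm_apply (A : Matrix ι ι ℤ) (u v : ι → ℤ) :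
    latticeForm A u v = u ⬝ᵥ A.mulVec v := Matrix.toLinearMap₂'_apply' _ _ _

theorem latticeForm_single (A : Matrix ι ι ℤ) (i j : ι) :
    latticeForm A (Pi.single i 1) (Pi.single j 1) = A i j := by
  rw [latticeForm_apply]; simp

theorem latticeForm_comm {A : Matrix ι ι ℤ} (hA : A.IsSymm) (u v : ι → ℤ) :
    latticeForm A u v = latticeForm A v u := by
  rw [latticeForm_apply, latticeForm_apply, Matrix.dotProduct_mulVec, dotProduct_comm,
    ← Matrix.mulVec_transpose, hA]

variable {𝔤 : Type*} [LieRing 𝔤] [LieAlgebra ℂ 𝔤]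

/-- The vectors of weight `v` with respect to the family `h` of commuting elements. -/
def weightVectors (A : Matrix ι ι ℤ) (h : (ι → ℤ) →ₗ[ℤ] 𝔤) (v : ι → ℤ) : Submodule ℂ 𝔤 where
  carrier := {x | ∀ w, ⁅h w, x⁆ = (latticeForm A v w : ℂ) • x}
  add_mem' hx hy w := by rw [lie_add, hx w, hy w, smul_add]
  zero_mem' w := by simp
  smul_mem' c x hx w := by rw [lie_smul, hx w, smul_comm]

theorem lie_mem_weightVectors {A : Matrix ι ι ℤ} {h : (ι → ℤ) →ₗ[ℤ] 𝔤} {u v : ι → ℤ} {x y : 𝔤}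
    (hx : x ∈ weightVectors A h u) (hy : y ∈ weightVectors A h v) :
    ⁅x, y⁆ ∈ weightVectors A h (u + v) := by
  intro w
  rw [leibniz_lie, hx w, hy w, map_add, LinearMap.add_apply]
  push_cast
  rw [smul_lie, lie_smul, add_smul]

/-- A Lie algebra with a Cartan subalgebra and a simply laced root system, in coordinates: the root
lattice is `ℤ^ι` with the form given by `A`, the set of roots is `Φ`, and the coroots are the
values of `h` on `Φ`. -/
structure SimplyLacedFrame (A : Matrix ι ι ℤ) (B : LinearMap.BilinForm ℂ 𝔤) (Φ : Set (ι → ℤ))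
    (h : (ι → ℤ) →ₗ[ℤ] 𝔤) : Prop where
  symm : A.IsSymm
  lie_h_h : ∀ u v, ⁅h u, h v⁆ = 0
  form_h : ∀ u v, B (h u) (h v) = latticeForm A u v
  norm_root : ∀ v ∈ Φ, latticeForm A v v = 2
  reflect : ∀ u ∈ Φ, ∀ v ∈ Φ, v - latticeForm A v u • u ∈ Φ
  sub_mem : ∀ u ∈ Φ, ∀ v ∈ Φ, 0 < latticeForm A u v → u ≠ v → u - v ∈ Φ
  single_mem : ∀ i, Pi.single i 1 ∈ Φ
  exists_sl2 : ∀ v ∈ Φ, ∃ e ∈ weightVectors A h v, ∃ f ∈ weightVectors A h (-v), ⁅e, f⁆ = h v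
  exists_smul : ∀ v ∈ Φ, ∀ x ∈ weightVectors A h v, ∀ y ∈ weightVectors A h v, y ≠ 0 →
    ∃ c : ℂ, x = c • y
  eq_zero : ∀ v ∉ Φ, v ≠ 0 → ∀ x ∈ weightVectors A h v, x = 0
  span : ∀ K : Submodule ℂ 𝔤, (∀ v, h v ∈ K) → (∀ v ∈ Φ, weightVectors A h v ≤ K) → K = ⊤

end Frame

/-! ### Coordinates from a base with symmetric Cartan matrix -/

section FrameOfIsOfType

variable {𝔤 : Type*} [LieRing 𝔤] [LieAlgebra ℂ 𝔤] [FiniteDimensional ℂ 𝔤] [IsKilling ℂ 𝔤]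
  (H : LieSubalgebra ℂ 𝔤) [H.IsCartanSubalgebra] {r : ℕ} {A : Matrix (Fin r) (Fin r) ℤ}
  (hA : A.IsSymm) (b : (rootSystem H).Base) (ε : b.support ≃ Fin r)
  (hb : ∀ i j : b.support, b.cartanMatrix i j = A (ε i) (ε j))

/-- The elements of the root lattice with given coordinates. -/
def latticeWeight (b : (rootSystem H).Base) (ε : b.support ≃ Fin r) :
    (Fin r → ℤ) →ₗ[ℤ] Module.Dual ℂ H :=
  Fintype.linearCombination ℤ fun i ↦ (rootSystem H).root (ε.symm i)

/-- The elements of the coroot lattice with given coordinates. -/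
def latticeCoweight (b : (rootSystem H).Base) (ε : b.support ≃ Fin r) :
    (Fin r → ℤ) →ₗ[ℤ] H :=
  Fintype.linearCombination ℤ fun i ↦ (rootSystem H).coroot (ε.symm i)

theorem latticeWeight_single (i : Fin r) :
    latticeWeight H b ε (Pi.single i 1) = (rootSystem H).root (ε.symm i) := by
  simp [latticeWeight, Fintype.linearCombination_apply_single]

theorem latticeCoweight_single (i : Fin r) :
    latticeCoweight H b ε (Pi.single i 1) = (rootSystem H).coroot (ε.symm i) := by
  simp [latticeCoweight, Fintype.linearCombination_apply_single]

include hb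

theorem latticeWeight_latticeCoweight (u v : Fin r → ℤ) :
    latticeWeight H b ε u (latticeCoweight H b ε v) = latticeForm A u v := by
  have h1 : ∀ i j : Fin r, (rootSystem H).root (ε.symm i) ((rootSystem H).coroot (ε.symm j)) =
      (A i j : ℂ) := by
    intro i j
    have h2 := hb (ε.symm i) (ε.symm j)
    rw [ε.apply_symm_apply, ε.apply_symm_apply] at h2
    have h3 : (rootSystem H).pairingIn ℤ (ε.symm i) (ε.symm j) = A i j := h2
    rw [← h3]
    exact ((rootSystem H).algebraMap_pairingIn ℤ (ε.symm i : H.root) (ε.symm j)).symm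
  rw [latticeForm_apply]
  simp only [latticeWeight, latticeCoweight, Fintype.linearCombination_apply, map_sum,
    LinearMap.sum_apply, map_zsmul, LinearMap.smul_apply, h1, dotProduct, Matrix.mulVec]
  push_cast
  simp only [Finset.mul_sum, zsmul_eq_mul]
  rw [Finset.sum_comm]
  exact Finset.sum_congr rfl fun i _ ↦ Finset.sum_congr rfl fun j _ ↦ by ring

include hA

/-- Simple reflections act on the coordinates of roots and of coroots by transposed matrices, which
coincide for symmetric `A`. Hence a root and its coroot have the same coordinates. -/
theorem exists_latticeWeight_eq (α : H.root) : ∃ v, latticeWeight H b ε v = (rootSystem H).root α ∧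
    latticeCoweight H b ε v = (rootSystem H).coroot α := by
  induction α using b.induction_reflect with
  | h₀ α ih =>
    obtain ⟨v, h1, h2⟩ := ih
    refine ⟨-v, ?_, ?_⟩
    · rw [map_neg, h1, RootPairing.root_reflectionPerm, RootPairing.reflection_apply_self]
    · rw [map_neg, h2, RootPairing.coroot_reflectionPerm, RootPairing.coreflection_apply_self]
  | h₁ α hα =>
    refine ⟨Pi.single (ε ⟨α, hα⟩) 1, ?_, ?_⟩
    · rw [latticeWeight_single, ε.symm_apply_apply]
    · rw [latticeCoweight_single, ε.symm_apply_apply]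
  | h₂ α j ih hj =>
    obtain ⟨v, h1, h2⟩ := ih
    have e1 := latticeWeight_single H b ε (ε ⟨j, hj⟩)
    have e2 := latticeCoweight_single H b ε (ε ⟨j, hj⟩)
    rw [ε.symm_apply_apply] at e1 e2
    refine ⟨v - latticeForm A v (Pi.single (ε ⟨j, hj⟩) 1) • Pi.single (ε ⟨j, hj⟩) 1, ?_, ?_⟩
    · rw [map_sub, map_zsmul, RootPairing.root_reflectionPerm, RootPairing.reflection_apply, e1,
        ← h1, ← Int.cast_smul_eq_zsmul ℂ, ← latticeWeight_latticeCoweight H b ε hb, e2]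
      rfl
    · rw [map_sub, map_zsmul, RootPairing.coroot_reflectionPerm, RootPairing.coreflection_apply, e2,
        ← h2, ← Int.cast_smul_eq_zsmul ℂ, latticeForm_comm hA,
        ← latticeWeight_latticeCoweight H b ε hb, e1]
      rfl

omit hA hb in
theorem latticeWeight_injective : Function.Injective (latticeWeight H b ε) := by
  have h1 := b.linearIndepOn_root
  have h2 : LinearIndependent ℤ fun i : Fin r ↦ (rootSystem H).root (ε.symm i) := by
    have h3 : LinearIndependent ℂ fun i : Fin r ↦ (rootSystem H).root (ε.symm i) :=
      h1.comp _ ε.symm.injective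
    exact h3.restrict_scalars' ℤ
  exact h2.fintypeLinearCombination_injective

/-- The coroots in coordinates, as elements of the Lie algebra. -/
def frameMap (b : (rootSystem H).Base) (ε : b.support ≃ Fin r) : (Fin r → ℤ) →ₗ[ℤ] 𝔤 :=
  (H.toSubmodule.subtype.restrictScalars ℤ) ∘ₗ latticeCoweight H b ε

omit hA hb in
theorem frameMap_apply (v : Fin r → ℤ) : frameMap H b ε v = (latticeCoweight H b ε v : 𝔤) := rfl

/-- The roots in coordinates. -/
def frameRoots (b : (rootSystem H).Base) (ε : b.support ≃ Fin r) : Set (Fin r → ℤ) :=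
  {v | ∃ α, (rootSystem H).root α = latticeWeight H b ε v}

omit hA hb in
theorem span_latticeCoweight : Submodule.span ℂ (Set.range (latticeCoweight H b ε)) = ⊤ := by
  rw [eq_top_iff, ← RootPairing.IsRootSystem.span_coroot_eq_top (P := rootSystem H),
    show Submodule.span ℂ (Set.range (rootSystem H).coroot) = _ from b.span_coroot_support.symm,
    Submodule.span_le]
  rintro _ ⟨i, hi, rfl⟩
  refine Submodule.subset_span ⟨Pi.single (ε ⟨i, hi⟩) 1, ?_⟩
  rw [latticeCoweight_single, ε.symm_apply_apply]

omit hA in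
theorem mem_weightVectors_iff (v : Fin r → ℤ) (x : 𝔤) :
    x ∈ weightVectors A (frameMap H b ε) v ↔
      ∀ t : H, ⁅(t : 𝔤), x⁆ = latticeWeight H b ε v t • x := by
  constructor
  · intro hx t
    have ht : t ∈ Submodule.span ℂ (Set.range (latticeCoweight H b ε)) := by
      rw [span_latticeCoweight]; trivial
    induction ht using Submodule.span_induction with
    | mem u hu =>
      obtain ⟨w, rfl⟩ := hu
      rw [latticeWeight_latticeCoweight H b ε hb]
      exact hx w
    | zero => simp
    | add u w _ _ hu hw => simp [hu, hw, add_smul]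
    | smul c u _ hu => simp [hu, mul_smul]
  · intro hx w
    rw [frameMap_apply, hx, latticeWeight_latticeCoweight H b ε hb]

omit hA in
theorem mem_weightVectors_iff_mem_rootSpace (v : Fin r → ℤ) (x : 𝔤) :
    x ∈ weightVectors A (frameMap H b ε) v ↔ x ∈ rootSpace H (latticeWeight H b ε v : H → ℂ) := by
  rw [mem_weightVectors_iff H b ε hb]
  refine ⟨fun hx ↦ ?_, fun hx t ↦ lie_eq_smul_of_mem_rootSpace hx t⟩
  rw [LieModule.mem_genWeightSpace]
  intro t
  refine ⟨1, ?_⟩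
  have := hx t
  simp [this]

theorem coroot_eq_frameMap {α : H.root} {v : Fin r → ℤ}
    (h : (rootSystem H).root α = latticeWeight H b ε v) :
    (rootSystem H).coroot α = latticeCoweight H b ε v := by
  obtain ⟨w, h1, h2⟩ := exists_latticeWeight_eq H hA b ε hb α
  rw [← h2, latticeWeight_injective H b ε (h1.trans h)]

theorem latticeForm_eq_pairingIn {α β : H.root} {u v : Fin r → ℤ}
    (hu : (rootSystem H).root α = latticeWeight H b ε u)
    (hv : (rootSystem H).root β = latticeWeight H b ε v) :
    (rootSystem H).pairingIn ℤ α β = latticeForm A u v := by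
  have h1 := (rootSystem H).algebraMap_pairingIn ℤ α β
  rw [← RootPairing.root_coroot_eq_pairing, hu, coroot_eq_frameMap H hA b ε hb hv] at h1
  have h2 := latticeWeight_latticeCoweight H b ε hb u v
  have h3 : (((rootSystem H).pairingIn ℤ α β : ℤ) : ℂ) = (latticeForm A u v : ℤ) := h1.trans h2
  exact_mod_cast h3

theorem isLongRoot (α : H.root) : IsLongRoot H α := by
  intro β
  obtain ⟨u, hu, -⟩ := exists_latticeWeight_eq H hA b ε hb α
  obtain ⟨v, hv, -⟩ := exists_latticeWeight_eq H hA b ε hb β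
  rw [latticeForm_eq_pairingIn H hA b ε hb hu.symm hv.symm,
    latticeForm_eq_pairingIn H hA b ε hb hv.symm hu.symm, latticeForm_comm hA]

omit hA hb in
theorem exists_sl2_root (α : H.root) : ∃ e ∈ rootSpace H (α.1 : H → ℂ),
    ∃ f ∈ rootSpace H (-α.1 : H → ℂ), IsSl2Triple ((rootSystem H).coroot α : 𝔤) e f := by
  have hα := H.isNonZero_coe_root α
  obtain ⟨h, e, f, ht, he, hf⟩ := exists_isSl2Triple_of_weight_isNonZero hα
  have := ht.h_eq_coroot hα he hf
  subst this
  exact ⟨e, he, f, hf, ht⟩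

variable {B : LinearMap.BilinForm ℂ 𝔤} (hB : IsNormalizedForm H B)
include hB

/-- All roots are long here, so every coroot has norm 2, and `B` identifies each coroot with its
root. -/
theorem form_coroot (α : H.root) (t : H) :
    B ((rootSystem H).coroot α : 𝔤) (t : 𝔤) = (rootSystem H).root α t := by
  obtain ⟨e, he, f, hf, ht⟩ := exists_sl2_root H α
  have h1 : ∀ t : H, B ((rootSystem H).coroot α : 𝔤) (t : 𝔤) = (rootSystem H).root α t * B e f := by
    intro t
    have h2 : ⁅f, (t : 𝔤)⁆ = (rootSystem H).root α t • f := by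
      rw [← lie_skew]
      have h3 : ⁅(t : 𝔤), f⁆ = _ := lie_eq_smul_of_mem_rootSpace hf t
      rw [h3]
      simp
    rw [← ht.lie_e_f, hB.invariant, h2, map_smul, smul_eq_mul]
  have h4 := h1 ((rootSystem H).coroot α)
  rw [hB.long α (isLongRoot H hA b ε hb α), show (rootSystem H).root α ((rootSystem H).coroot α) = 2
    from (rootSystem H).root_coroot_two α] at h4
  rw [h1 t]
  linear_combination (-1 / 2 : ℂ) * (rootSystem H).root α t * h4

theorem simplyLacedFrame :
    SimplyLacedFrame A B (frameRoots H b ε) (frameMap H b ε) where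
  symm := hA
  lie_h_h u v := by
    have := trivial_lie_zero H H (latticeCoweight H b ε u) (latticeCoweight H b ε v)
    exact congrArg Subtype.val this
  form_h u v := by
    rw [← latticeWeight_latticeCoweight H b ε hb]
    have hu : latticeCoweight H b ε u = ∑ i, u i • (rootSystem H).coroot (ε.symm i) := rfl
    have hu' : latticeWeight H b ε u = ∑ i, u i • (rootSystem H).root (ε.symm i) := rfl
    have h1 : frameMap H b ε u = ∑ i, (u i : ℂ) • ((rootSystem H).coroot (ε.symm i) : 𝔤) := by
      rw [frameMap_apply, hu]
      push_cast
      simp [Int.cast_smul_eq_zsmul]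
    rw [h1, hu', map_sum, LinearMap.sum_apply, LinearMap.sum_apply]
    refine Finset.sum_congr rfl fun i _ ↦ ?_
    rw [map_smul, LinearMap.smul_apply, frameMap_apply, form_coroot H hA b ε hb hB,
      LinearMap.smul_apply, Int.cast_smul_eq_zsmul]
  norm_root v := by
    rintro ⟨α, hα⟩
    rw [← latticeForm_eq_pairingIn H hA b ε hb hα hα, RootPairing.pairingIn_same]
  reflect u := by
    rintro ⟨α, hα⟩ v ⟨β, hβ⟩
    refine ⟨(rootSystem H).reflectionPerm α β, ?_⟩
    rw [RootPairing.root_reflectionPerm, RootPairing.reflection_apply, map_sub, map_zsmul, ← hα,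
      ← hβ, ← latticeForm_eq_pairingIn H hA b ε hb hβ hα, ← Int.cast_smul_eq_zsmul ℂ]
    have h1 := (rootSystem H).algebraMap_pairingIn ℤ β α
    rw [← RootPairing.root_coroot_eq_pairing] at h1
    exact congrArg (fun c : ℂ ↦ (rootSystem H).root β - c • (rootSystem H).root α) h1.symm
  sub_mem u := by
    rintro ⟨α, hα⟩ v ⟨β, hβ⟩ huv hne
    rw [← latticeForm_eq_pairingIn H hA b ε hb hα hβ] at huv
    have h1 : α ≠ β := by
      rintro rfl
      exact hne (latticeWeight_injective H b ε (hα.symm.trans hβ))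
    obtain ⟨γ, hγ⟩ := (rootSystem H).root_sub_root_mem_of_pairingIn_pos huv h1
    exact ⟨γ, by rw [hγ, map_sub, hα, hβ]⟩
  single_mem i := ⟨ε.symm i, (latticeWeight_single H b ε i).symm⟩
  exists_sl2 v := by
    rintro ⟨α, hα⟩
    obtain ⟨e, he, f, hf, ht⟩ := exists_sl2_root H α
    have hα' : (latticeWeight H b ε v : H → ℂ) = α.1 := by rw [← hα]; rfl
    refine ⟨e, ?_, f, ?_, ?_⟩
    · rw [mem_weightVectors_iff_mem_rootSpace H b ε hb, hα']
      exact he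
    · rw [mem_weightVectors_iff_mem_rootSpace H b ε hb, map_neg, LinearMap.coe_neg, hα']
      exact hf
    · rw [ht.lie_e_f, coroot_eq_frameMap H hA b ε hb hα]
      rfl
  exists_smul v := by
    rintro ⟨α, hα⟩ x hx y hy hy0
    have hα' : (latticeWeight H b ε v : H → ℂ) = α.1 := by rw [← hα]; rfl
    rw [mem_weightVectors_iff_mem_rootSpace H b ε hb, hα'] at hx hy
    have h1 := finrank_rootSpace_eq_one α.1 (H.isNonZero_coe_root α)
    obtain ⟨c, hc⟩ := exists_smul_eq_of_finrank_eq_one h1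
      (x := (⟨y, hy⟩ : rootSpace H (α.1 : H → ℂ))) (fun h ↦ hy0 (congrArg Subtype.val h)) ⟨x, hx⟩
    exact ⟨c, (congrArg Subtype.val hc).symm⟩
  eq_zero v hv hv0 x hx := by
    by_contra hx0
    rw [mem_weightVectors_iff_mem_rootSpace H b ε hb] at hx
    let χ : LieModule.Weight ℂ H 𝔤 := ⟨latticeWeight H b ε v, fun h ↦ hx0 (by
      have h' : rootSpace H (latticeWeight H b ε v : H → ℂ) = ⊥ := h
      rw [h'] at hx; simpa using hx)⟩
    have hχ : χ.IsNonZero := by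
      intro h
      apply hv0
      apply latticeWeight_injective H b ε
      ext t
      have h2 : (χ : H → ℂ) t = 0 := by rw [h]; rfl
      rw [map_zero]
      exact h2
    refine hv ⟨⟨χ, by simpa using hχ⟩, ?_⟩
    ext t
    rfl
  span K h0 h1 := by
    have h2 := LieModule.iSup_genWeightSpace_eq_top' ℂ H 𝔤
    rw [eq_top_iff, ← LieSubmodule.top_toSubmodule (R := ℂ) (L := H) (M := 𝔤), ← h2,
      LieSubmodule.iSup_toSubmodule]
    refine iSup_le fun χ ↦ ?_
    by_cases hχ : χ.IsZero
    · intro x hx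
      have hx' : x ∈ rootSpace H (0 : H → ℂ) := by
        rw [← hχ]; exact hx
      rw [LieAlgebra.rootSpace_zero_eq] at hx'
      have h3 : H.toSubmodule ≤ K := by
        have h4 := congrArg (Submodule.map H.toSubmodule.subtype) (span_latticeCoweight H b ε)
        rw [Submodule.map_span, Submodule.map_top, Submodule.range_subtype] at h4
        rw [← h4, Submodule.span_le]
        rintro _ ⟨_, ⟨v, rfl⟩, rfl⟩
        exact h0 v
      exact h3 hx'
    · obtain ⟨v, hv, -⟩ := exists_latticeWeight_eq H hA b ε hb ⟨χ, by simpa using hχ⟩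
      refine le_trans ?_ (h1 v ⟨_, hv.symm⟩)
      intro x hx
      rw [mem_weightVectors_iff_mem_rootSpace H b ε hb, hv]
      exact hx

/-- The radical of `B` is an ideal. It contains no root space, since it would then contain a coroot
of norm 2; so it lies in `H`, where `B` against coroots recovers all roots. -/
theorem eq_zero_of_forall_form_eq_zero (x : 𝔤) (hx : ∀ y, B x y = 0) : x = 0 := by
  let I : LieIdeal ℂ 𝔤 :=
    { __ := LinearMap.ker B
      lie_mem := by
        intro y z hz
        have hz' : B z = 0 := hz
        change B ⁅y, z⁆ = 0
        ext w
        rw [← lie_skew, map_neg, LinearMap.neg_apply, hB.invariant, hz']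
        simp }
  have hI : ∀ {z}, z ∈ I → B z = 0 := fun h ↦ h
  have hroot : ∀ α : H.root, ¬ rootSpace H α.val ≤ I.restr H := by
    intro α hα
    obtain ⟨e, he, f, hf, ht⟩ := exists_sl2_root H α
    have h1 : e ∈ I := hα he
    have h2 : ((rootSystem H).coroot α : 𝔤) ∈ I := by
      rw [← ht.lie_e_f]
      exact lie_mem_left ℂ 𝔤 I _ _ h1
    have h3 := hB.long α (isLongRoot H hA b ε hb α)
    rw [hI h2] at h3
    simp at h3
  have h1 := lieIdeal_eq_inf_cartan_sup_biSup_rootSpace (H := H) I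
  have h2 : (⨆ (α : H.root) (_ : rootSpace H α.val ≤ I.restr H), rootSpace H α.val) = ⊥ :=
    iSup₂_eq_bot.mpr fun α hα ↦ absurd hα (hroot α)
  rw [h2, sup_bot_eq] at h1
  have hxI : x ∈ I.restr H := by
    change B x = 0
    ext y
    exact hx y
  rw [h1] at hxI
  have hxH : x ∈ H := hxI.2
  have h3 : ∀ φ : Module.Dual ℂ H, φ ⟨x, hxH⟩ = 0 := by
    intro φ
    have hφ : φ ∈ Submodule.span ℂ (Set.range (rootSystem H).root) := by
      rw [RootPairing.IsRootSystem.span_root_eq_top]; trivial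
    induction hφ using Submodule.span_induction with
    | mem u hu =>
      obtain ⟨α, rfl⟩ := hu
      rw [← form_coroot H hA b ε hb hB, hB.symm.eq]
      exact hx _
    | zero => rfl
    | add u v _ _ hu hv => simp [hu, hv]
    | smul c u _ hu => simp [hu]
  exact congrArg Subtype.val ((Module.forall_dual_apply_eq_zero_iff ℂ _).mp h3)

end FrameOfIsOfType

/-! ### Root vectors, strings and induction over roots -/

section FrameTheory

variable {ι : Type*} [Fintype ι] [DecidableEq ι] {𝔤 : Type*} [LieRing 𝔤] [LieAlgebra ℂ 𝔤]
  {A : Matrix ι ι ℤ} {B : LinearMap.BilinForm ℂ 𝔤} {Φ : Set (ι → ℤ)} {h : (ι → ℤ) →ₗ[ℤ] 𝔤}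

namespace SimplyLacedFrame

variable (F : SimplyLacedFrame A B Φ h)
include F

theorem neg_mem {v : ι → ℤ} (hv : v ∈ Φ) : -v ∈ Φ := by
  have := F.reflect v hv v hv
  rw [F.norm_root v hv] at this
  convert this using 1
  module

theorem norm_add (u v : ι → ℤ) : latticeForm A (u + v) (u + v) =
    latticeForm A u u + 2 * latticeForm A u v + latticeForm A v v := by
  simp only [map_add, LinearMap.add_apply]
  rw [latticeForm_comm F.symm v u]; ring

theorem norm_sub (u v : ι → ℤ) : latticeForm A (u - v) (u - v) =
    latticeForm A u u - 2 * latticeForm A u v + latticeForm A v v := by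
  simp only [map_sub, LinearMap.sub_apply]
  rw [latticeForm_comm F.symm v u]; ring

theorem h_ne_zero {v : ι → ℤ} (hv : v ∈ Φ) : h v ≠ 0 := by
  intro h0
  have := F.form_h v v
  rw [h0, F.norm_root v hv] at this
  simp at this

/-- All vanishing of brackets is reduced to this test: a nonzero weight must be a root and so have
norm 2. -/
theorem eq_zero_of_norm {v : ι → ℤ} (hv : 2 < latticeForm A v v) {x : 𝔤}
    (hx : x ∈ weightVectors A h v) : x = 0 := by
  refine F.eq_zero v (fun hv' ↦ ?_) ?_ x hx
  · rw [F.norm_root v hv'] at hv; omega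
  · rintro rfl; simp at hv

theorem eq_one_of_pos {u v : ι → ℤ} (hu : u ∈ Φ) (hv : v ∈ Φ) (h0 : 0 < latticeForm A u v)
    (hne : u ≠ v) : latticeForm A u v = 1 := by
  have h1 := F.norm_root _ (F.sub_mem u hu v hv h0 hne)
  rw [F.norm_sub, F.norm_root u hu, F.norm_root v hv] at h1
  omega

/-- If `u` and `v` are roots whose sum is a root, then the brackets of the root vectors of `u` and
`v` make up the root vectors of the sum. -/
theorem exists_lie_eq {u v : ι → ℤ} (hu : u ∈ Φ) (hv : v ∈ Φ) (huv : latticeForm A u v = -1) {x : 𝔤}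
    (hx : x ∈ weightVectors A h (u + v)) {y : 𝔤} (hy : y ∈ weightVectors A h v) (hy0 : y ≠ 0) :
    ∃ z ∈ weightVectors A h u, ⁅z, y⁆ = x := by
  obtain ⟨e, he, f, hf, hef⟩ := F.exists_sl2 u hu
  have h1 : ⁅f, y⁆ = 0 := by
    refine F.eq_zero_of_norm ?_ (lie_mem_weightVectors hf hy)
    rw [F.norm_add, map_neg, map_neg, LinearMap.neg_apply, LinearMap.neg_apply, huv,
      F.norm_root u hu, F.norm_root v hv]
    norm_num
  have h2 : ⁅f, ⁅e, y⁆⁆ = y := by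
    have h5 : ⁅f, e⁆ = -h u := by rw [← lie_skew, hef]
    rw [leibniz_lie, h1, lie_zero, add_zero, h5, neg_lie, hy u, latticeForm_comm F.symm, huv]
    simp
  have h3 : ⁅e, y⁆ ≠ 0 := by
    intro h0
    rw [h0, lie_zero] at h2
    exact hy0 h2.symm
  have h4 : u + v ∈ Φ := by
    have := F.reflect u hu v hv
    rw [latticeForm_comm F.symm, huv] at this
    convert this using 1
    module
  obtain ⟨c, hc⟩ := F.exists_smul _ h4 x hx _ (lie_mem_weightVectors he hy) h3
  exact ⟨c • e, Submodule.smul_mem _ _ he, by rw [smul_lie, hc]⟩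

-- Testing with `h (u + v)` multiplies `B x y` by the norm of `u + v`; this is why the norm, rather
-- than the vector, is required to be nonzero.
omit F in
theorem form_eq_zero (hinv : ∀ x y z : 𝔤, B ⁅x, y⁆ z = B x ⁅y, z⁆) {u v : ι → ℤ}
    (huv : latticeForm A (u + v) (u + v) ≠ 0) {x y : 𝔤} (hx : x ∈ weightVectors A h u)
    (hy : y ∈ weightVectors A h v) : B x y = 0 := by
  have h1 := hinv x (h (u + v)) y
  rw [← lie_skew, hx, hy, map_neg, LinearMap.neg_apply, map_smul, map_smul, LinearMap.smul_apply,
    smul_eq_mul, smul_eq_mul] at h1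
  have h2 : ((latticeForm A (u + v) (u + v) : ℤ) : ℂ) * B x y = 0 := by
    have h3 : latticeForm A (u + v) (u + v) =
        latticeForm A u (u + v) + latticeForm A v (u + v) := by
      rw [← LinearMap.add_apply, ← map_add]
    rw [h3, Int.cast_add]
    linear_combination -h1
  exact (mul_eq_zero.mp h2).resolve_left (by exact_mod_cast huv)

theorem form_e_f (hinv : ∀ x y z : 𝔤, B ⁅x, y⁆ z = B x ⁅y, z⁆) {v : ι → ℤ} (hv : v ∈ Φ) {e f : 𝔤}
    (hf : f ∈ weightVectors A h (-v)) (hef : ⁅e, f⁆ = h v) : B e f = 1 := by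
  have h1 := hinv e f (h v)
  have h2 : latticeForm A (-v) v = -2 := by rw [map_neg, LinearMap.neg_apply, F.norm_root v hv]
  rw [hef, F.form_h, F.norm_root v hv, ← lie_skew, hf v, h2] at h1
  simp only [map_neg, map_smul, smul_eq_mul] at h1
  push_cast at h1
  linear_combination (-1 / 2 : ℂ) * h1

/-- An induction principle for the roots in the lattice spanned by some roots. -/
theorem induction_of_eq_sum {κ : Type*} [Fintype κ] (γ : κ → ι → ℤ) (hγ : ∀ j, γ j ∈ Φ)
    (P : (ι → ℤ) → Prop) (hpos : ∀ j, P (γ j)) (hneg : ∀ j, P (-γ j))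
    (hstep : ∀ u v, u ∈ Φ → v ∈ Φ → latticeForm A u v = -1 → u + v ∈ Φ →
      ((∃ j, v = γ j) ∨ ∃ j, v = -γ j) → P u → P v → P (u + v))
    (n : κ → ℤ) (hv : ∑ j, n j • γ j ∈ Φ) : P (∑ j, n j • γ j) := by
  classical
  induction hN : ∑ j, (n j).natAbs using Nat.strong_induction_on generalizing n with
  | _ N ih =>
  subst hN
  set v := ∑ j, n j • γ j with hvdef
  -- Expanding `(v, v) = 2` shows that some `n j` and `(v, γ j)` have the same sign. Subtracting `γ
  -- j` with that sign leaves a root with a smaller coefficient sum.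
  have h1 : 0 < ∑ j, n j * latticeForm A v (γ j) := by
    have h2 := F.norm_root v hv
    nth_rw 2 [hvdef] at h2
    simp only [map_sum, map_smul, smul_eq_mul] at h2
    omega
  obtain ⟨j, -, hj⟩ := Finset.exists_lt_of_sum_lt (s := Finset.univ) (f := fun _ ↦ (0 : ℤ))
    (by simpa using h1)
  obtain ⟨s, hs, hsv, hsn⟩ : ∃ s : ℤ, (s = 1 ∨ s = -1) ∧ 0 < latticeForm A v (s • γ j) ∧
      0 < s * n j := by
    rcases pos_and_pos_or_neg_and_neg_of_mul_pos hj with ⟨h3, h4⟩ | ⟨h3, h4⟩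
    · exact ⟨1, .inl rfl, by simpa using h4, by simpa using h3⟩
    · exact ⟨-1, .inr rfl, by simpa using h4, by simpa using h3⟩
  have hsΦ : s • γ j ∈ Φ := by
    rcases hs with rfl | rfl
    · simpa using hγ j
    · simpa using F.neg_mem (hγ j)
  have hPs : P (s • γ j) := by
    rcases hs with rfl | rfl
    · simpa using hpos j
    · simpa using hneg j
  by_cases hne : v = s • γ j
  · rw [hne]; exact hPs
  have h5 := F.sub_mem v hv _ hsΦ hsv hne
  have h6 := F.eq_one_of_pos hv hsΦ hsv hne
  have h7 : v - s • γ j = ∑ k, (n k - if k = j then s else 0) • γ k := by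
    simp only [sub_smul, Finset.sum_sub_distrib, ite_smul, zero_smul, Finset.sum_ite_eq',
      Finset.mem_univ, if_true]
    rfl
  have h8 : P (v - s • γ j) := by
    rw [h7]
    refine ih _ ?_ _ (h7 ▸ h5) rfl
    refine Finset.sum_lt_sum (fun k _ ↦ ?_) ⟨j, Finset.mem_univ j, ?_⟩
    · split_ifs with hk
      · subst hk
        rcases hs with rfl | rfl <;> omega
      · simp
    · rw [if_pos rfl]
      rcases hs with rfl | rfl <;> omega
  have h9 := hstep (v - s • γ j) (s • γ j) h5 hsΦ (by
    rw [map_sub, LinearMap.sub_apply, h6, F.norm_root _ hsΦ]; norm_num) (by simpa using hv) (by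
    rcases hs with rfl | rfl
    · exact .inl ⟨j, by simp⟩
    · exact .inr ⟨j, by simp⟩) h8 hPs
  simpa using h9

section Inverting

variable {θ : 𝔤 ≃ₗ⁅ℂ⁆ 𝔤}

omit F in
theorem map_mem_weightVectors (hθ : ∀ v, θ (h v) = -h v) {v : ι → ℤ} {x : 𝔤}
    (hx : x ∈ weightVectors A h v) :
    θ x ∈ weightVectors A h (-v) := by
  intro w
  have h1 : h w = θ (-h w) := by rw [map_neg, hθ, neg_neg]
  rw [h1, ← LieEquiv.map_lie, neg_lie, hx w, ← neg_smul, map_smul, map_neg, LinearMap.neg_apply]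
  push_cast
  rfl

/-- Root vectors that are adapted to an automorphism that maps the coroot to its negative. -/
theorem exists_adapted {v : ι → ℤ} (hv : v ∈ Φ) (hθ : θ (h v) = -h v)
    (hθv : ∀ x ∈ weightVectors A h v, θ x ∈ weightVectors A h (-v))
    (hθv' : ∀ x ∈ weightVectors A h (-v), θ x ∈ weightVectors A h v) :
    ∃ e ∈ weightVectors A h v, ⁅e, -θ e⁆ = h v ∧ θ (θ e) = e := by
  obtain ⟨e, he, f, hf, hef⟩ := F.exists_sl2 v hv
  have hf0 : f ≠ 0 := by
    rintro rfl
    rw [lie_zero] at hef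
    exact F.h_ne_zero hv hef.symm
  have he0 : e ≠ 0 := by
    rintro rfl
    rw [zero_lie] at hef
    exact F.h_ne_zero hv hef.symm
  obtain ⟨c, hc⟩ := F.exists_smul _ (F.neg_mem hv) _ (hθv _ he) f hf hf0
  have hc0 : c ≠ 0 := by
    rintro rfl
    have h0 : θ e = θ 0 := by rw [hc, map_zero, zero_smul]
    exact he0 (θ.injective h0)
  -- Scaling `e` by `t` scales `[e, θ e]` by `t²`, so a square root achieves the normalization.
  obtain ⟨t, ht⟩ := IsAlgClosed.exists_pow_nat_eq (-c⁻¹) (n := 2) two_pos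
  have h1 : ⁅t • e, -θ (t • e)⁆ = h v := by
    rw [map_smul, hc, smul_lie, lie_neg, lie_smul, lie_smul, hef]
    have h2 : t * t * c = -1 := by
      rw [← sq, ht]; field_simp
    linear_combination (norm := module) (-h2) • h v
  have he' : t • e ∈ weightVectors A h v := Submodule.smul_mem _ _ he
  refine ⟨t • e, he', h1, ?_⟩
  have he0' : t • e ≠ 0 := by
    intro h0
    rw [h0, zero_lie] at h1
    exact F.h_ne_zero hv h1.symm
  have h3 := hθv' _ (hθv _ he')
  obtain ⟨d, hd⟩ := F.exists_smul _ hv _ h3 _ he' he0'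
  -- Here `θ²` acts on the root vector by `d`, and applying `θ` to the normalized bracket forces `d
  -- = 1`.
  have h4 := congrArg θ h1
  rw [LieEquiv.map_lie, map_neg, hd, hθ, lie_neg, lie_smul, ← lie_skew, ← lie_neg, h1] at h4
  have h5 : (d - 1) • h v = 0 := by
    linear_combination (norm := module) -h4
  have h6 := (smul_eq_zero.mp h5).resolve_right (F.h_ne_zero hv)
  rw [hd, sub_eq_zero.mp h6, one_smul]

end Inverting

end SimplyLacedFrame

end FrameTheory

/-! ### Berman generators of the fixed subalgebra of an inverting involution -/

section Berman

variable {ι : Type*} [Fintype ι] [DecidableEq ι] {𝔤 : Type*} [LieRing 𝔤] [LieAlgebra ℂ 𝔤]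
  {A : Matrix ι ι ℤ} {B : LinearMap.BilinForm ℂ 𝔤} {Φ : Set (ι → ℤ)} {h : (ι → ℤ) →ₗ[ℤ] 𝔤}

/-- Root vectors that are adapted to an automorphism `θ` that maps the coroot to its negative. -/
structure IsAdapted (A : Matrix ι ι ℤ) (h : (ι → ℤ) →ₗ[ℤ] 𝔤) (θ : 𝔤 ≃ₗ⁅ℂ⁆ 𝔤) (v : ι → ℤ) (e : 𝔤) :
    Prop where
  mem : e ∈ weightVectors A h v
  map_mem : θ e ∈ weightVectors A h (-v)
  lie_eq : ⁅θ e, e⁆ = h v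
  map_map : θ (θ e) = e

theorem IsAdapted.map {θ : 𝔤 ≃ₗ⁅ℂ⁆ 𝔤} {v : ι → ℤ} {e : 𝔤} (he : IsAdapted A h θ v e) :
    IsAdapted A h θ (-v) (θ e) where
  mem := he.map_mem
  map_mem := by rw [he.map_map, neg_neg]; exact he.mem
  lie_eq := by rw [he.map_map, ← lie_skew, he.lie_eq, map_neg]
  map_map := by rw [he.map_map]

theorem neg_latticeForm_left (u v : ι → ℤ) : latticeForm A (-u) v = -latticeForm A u v := by
  rw [map_neg, LinearMap.neg_apply]

namespace SimplyLacedFrame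

variable (F : SimplyLacedFrame A B Φ h) {θ : 𝔤 ≃ₗ⁅ℂ⁆ 𝔤} {u v : ι → ℤ} {e e' : 𝔤}
include F

/-- The vectors `y` and `[e, y]` span the two-dimensional module of the `sl₂` of `u`, on which `e +
θ e` squares to `-1`. -/
theorem lie_lie_of_isAdapted (hu : u ∈ Φ) (hv : v ∈ Φ) (huv : latticeForm A u v = -1)
    (he : IsAdapted A h θ u e) {y : 𝔤} (hy : y ∈ weightVectors A h v) :
    ⁅e + θ e, ⁅e + θ e, y⁆⁆ = -y := by
  have h1 : ⁅θ e, y⁆ = 0 := by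
    refine F.eq_zero_of_norm ?_ (lie_mem_weightVectors he.map_mem hy)
    rw [F.norm_add, neg_latticeForm_left, neg_latticeForm_left, map_neg, huv, F.norm_root u hu,
      F.norm_root v hv]
    norm_num
  have h2 : ⁅e, ⁅e, y⁆⁆ = 0 := by
    refine F.eq_zero_of_norm ?_ (lie_mem_weightVectors he.mem (lie_mem_weightVectors he.mem hy))
    rw [F.norm_add, F.norm_add, map_add, huv, F.norm_root u hu, F.norm_root v hv]
    norm_num
  have h3 : ⁅θ e, ⁅e, y⁆⁆ = -y := by
    rw [leibniz_lie, h1, lie_zero, add_zero, he.lie_eq, hy u, latticeForm_comm F.symm, huv]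
    simp
  rw [add_lie _ _ y, h1, add_zero, add_lie, h2, h3, zero_add]

theorem lie_lie_adapted (hu : u ∈ Φ) (hv : v ∈ Φ) (huv : latticeForm A u v = -1)
    (he : IsAdapted A h θ u e) (he' : IsAdapted A h θ v e') :
    ⁅e + θ e, ⁅e + θ e, e' + θ e'⁆⁆ = -(e' + θ e') := by
  have h1 := F.lie_lie_of_isAdapted (F.neg_mem hu) (F.neg_mem hv)
    (by rw [neg_latticeForm_left, map_neg, huv]; rfl) he.map he'.map_mem
  rw [he.map_map, add_comm] at h1
  rw [lie_add, lie_add, F.lie_lie_of_isAdapted hu hv huv he he'.mem, h1]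
  abel

theorem lie_adapted_eq_zero (hu : u ∈ Φ) (hv : v ∈ Φ) (huv : latticeForm A u v = 0)
    (he : IsAdapted A h θ u e) (he' : IsAdapted A h θ v e') : ⁅e + θ e, e' + θ e'⁆ = 0 := by
  have key : ∀ {u v : ι → ℤ} {x y : 𝔤}, u ∈ Φ → v ∈ Φ → latticeForm A u v = 0 →
      x ∈ weightVectors A h u → y ∈ weightVectors A h v → ⁅x, y⁆ = 0 := by
    intro u v x y hu hv huv hx hy
    refine F.eq_zero_of_norm ?_ (lie_mem_weightVectors hx hy)
    rw [F.norm_add, huv, F.norm_root u hu, F.norm_root v hv]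
    norm_num
  have hn := neg_latticeForm_left (A := A)
  rw [add_lie, lie_add, lie_add, key hu hv huv he.mem he'.mem,
    key hu (F.neg_mem hv) (by rw [map_neg, huv, neg_zero]) he.mem he'.map_mem,
    key (F.neg_mem hu) hv (by rw [hn, huv, neg_zero]) he.map_mem he'.mem,
    key (F.neg_mem hu) (F.neg_mem hv) (by rw [hn, map_neg, huv, neg_zero, neg_zero])
      he.map_mem he'.map_mem]
  simp

theorem form_adapted_self (hinv : ∀ x y z : 𝔤, B ⁅x, y⁆ z = B x ⁅y, z⁆) (hs : B.IsSymm)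
    (hu : u ∈ Φ) (he : IsAdapted A h θ u e) : B (e + θ e) (e + θ e) = -2 := by
  have h1 : B e (-θ e) = 1 := F.form_e_f hinv hu (Submodule.neg_mem _ he.map_mem)
    (by rw [lie_neg, lie_skew, he.lie_eq])
  rw [map_neg] at h1
  have h2 : B e e = 0 := form_eq_zero hinv (by
    rw [F.norm_add, F.norm_root u hu]; norm_num) he.mem he.mem
  have h3 : B (θ e) (θ e) = 0 := form_eq_zero hinv (by
    rw [F.norm_add, neg_latticeForm_left, map_neg, F.norm_root u hu]; norm_num)
    he.map_mem he.map_mem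
  have h4 : B (θ e) e = B e (θ e) := hs.eq _ _
  rw [LinearMap.map_add₂, map_add, map_add, h2, h3, h4]
  linear_combination -2 * h1

theorem form_adapted_eq_zero (hinv : ∀ x y z : 𝔤, B ⁅x, y⁆ z = B x ⁅y, z⁆) (hu : u ∈ Φ)
    (hv : v ∈ Φ) (h1 : latticeForm A u v ≠ 2) (h2 : latticeForm A u v ≠ -2)
    (he : IsAdapted A h θ u e) (he' : IsAdapted A h θ v e') : B (e + θ e) (e' + θ e') = 0 := by
  have hn := neg_latticeForm_left (A := A)
  have hu' := F.norm_root u hu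
  have hv' := F.norm_root v hv
  rw [LinearMap.map_add₂, map_add, map_add,
    form_eq_zero hinv (by rw [F.norm_add, hu', hv']; omega) he.mem he'.mem,
    form_eq_zero hinv
      (by rw [F.norm_add]; simp only [map_neg, LinearMap.neg_apply, hu', hv']; omega)
      he.mem he'.map_mem,
    form_eq_zero hinv
      (by rw [F.norm_add]; simp only [map_neg, LinearMap.neg_apply, hu', hv']; omega)
      he.map_mem he'.mem,
    form_eq_zero hinv
      (by rw [F.norm_add]; simp only [map_neg, LinearMap.neg_apply, hu', hv']; omega)
      he.map_mem he'.map_mem]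
  simp

variable (hθ : ∀ v, θ (h v) = -h v)
include hθ

theorem exists_isAdapted (hv : v ∈ Φ) : ∃ e, IsAdapted A h θ v e := by
  obtain ⟨e, he, h1, h2⟩ := F.exists_adapted hv (hθ v) (fun _ ↦ map_mem_weightVectors hθ)
    fun x hx ↦ by simpa using map_mem_weightVectors hθ hx
  exact ⟨e, he, map_mem_weightVectors hθ he, by rw [← lie_skew, ← lie_neg, h1], h2⟩

/-- Being an involution need not be assumed: the normalization of adapted root vectors already makes
`θ²` trivial on every root space. -/
theorem involutive (x : 𝔤) : θ (θ x) = x := by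
  let K : Submodule ℂ 𝔤 := LinearMap.eqLocus ((θ : 𝔤 →ₗ[ℂ] 𝔤) ∘ₗ (θ : 𝔤 →ₗ[ℂ] 𝔤)) LinearMap.id
  have h1 : K = ⊤ := by
    refine F.span K (fun v ↦ ?_) fun v hv x hx ↦ ?_
    · change θ (θ (h v)) = h v
      rw [hθ, map_neg, hθ, neg_neg]
    · obtain ⟨e, he⟩ := F.exists_isAdapted hθ hv
      have he0 : e ≠ 0 := by
        rintro rfl
        apply F.h_ne_zero hv
        rw [← he.lie_eq, lie_zero]
      obtain ⟨c, rfl⟩ := F.exists_smul v hv x hx e he.mem he0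
      exact K.smul_mem c he.map_map
  have h2 : x ∈ K := by rw [h1]; trivial
  exact h2

/-- The fixed subalgebra of an inverting involution is generated by its Berman generators. -/
theorem fixedSubalgebra_eq_lieSpan (e : ι → 𝔤)
    (he : ∀ i, IsAdapted A h θ (Pi.single i 1) (e i)) :
    fixedSubalgebra θ = LieSubalgebra.lieSpan ℂ 𝔤 (Set.range fun i ↦ e i + θ (e i)) := by
  have hθθ := F.involutive hθ
  set L := LieSubalgebra.lieSpan ℂ 𝔤 (Set.range fun i ↦ e i + θ (e i)) with hL
  have he0 : ∀ i, e i ≠ 0 := by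
    intro i h0
    apply F.h_ne_zero (F.single_mem i)
    rw [← (he i).lie_eq, h0, lie_zero]
  have hθe0 : ∀ i, θ (e i) ≠ 0 := by
    intro i h0
    apply F.h_ne_zero (F.single_mem i)
    rw [← (he i).lie_eq, h0, zero_lie]
  have hmem : ∀ i, e i + θ (e i) ∈ L := fun i ↦ LieSubalgebra.subset_lieSpan ⟨i, rfl⟩
  have hsum : ∀ v : ι → ℤ, ∑ i, v i • (Pi.single i 1 : ι → ℤ) = v := by
    intro v
    ext j
    simp [Finset.sum_apply, Pi.single_apply]
  have key : ∀ v ∈ Φ, ∀ x ∈ weightVectors A h v, x + θ x ∈ L := by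
    intro v hv
    rw [← hsum v] at hv ⊢
    refine F.induction_of_eq_sum (fun i ↦ (Pi.single i 1 : ι → ℤ)) F.single_mem
      (fun v ↦ ∀ x ∈ weightVectors A h v, x + θ x ∈ L) ?_ ?_ ?_ v hv
    · intro i x hx
      obtain ⟨c, rfl⟩ := F.exists_smul _ (F.single_mem i) x hx _ (he i).mem (he0 i)
      rw [map_smul, ← smul_add]
      exact L.smul_mem c (hmem i)
    · intro i x hx
      obtain ⟨c, rfl⟩ := F.exists_smul _ (F.neg_mem (F.single_mem i)) x hx _ (he i).map_mem (hθe0 i)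
      rw [map_smul, ← smul_add, (he i).map_map, add_comm]
      exact L.smul_mem c (hmem i)
    · intro u v hu hv huv _ _ hPu hPv x hx
      obtain ⟨y, hy⟩ := F.exists_isAdapted hθ hv
      have hy0 : y ≠ 0 := by
        rintro rfl
        apply F.h_ne_zero hv
        rw [← hy.lie_eq, lie_zero]
      obtain ⟨z, hz, rfl⟩ := F.exists_lie_eq hu hv huv hx hy.mem hy0
      -- The weight `u - v` has norm 6, so the mixed brackets vanish and `x ↦ x + θ x` respects this
      -- bracket.
      have h1 : ⁅z, θ y⁆ = 0 := by
        refine F.eq_zero_of_norm ?_ (lie_mem_weightVectors hz hy.map_mem)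
        rw [← sub_eq_add_neg, F.norm_sub, huv, F.norm_root u hu, F.norm_root v hv]
        norm_num
      have h2 : ⁅θ z, y⁆ = 0 := by
        have := congrArg θ h1
        rw [LieEquiv.map_lie, hθθ] at this
        exact this.trans (map_zero θ)
      have h3 : ⁅z, y⁆ + θ ⁅z, y⁆ = ⁅z + θ z, y + θ y⁆ := by
        rw [LieEquiv.map_lie, lie_add, add_lie, add_lie, h1, h2, add_zero, zero_add]
      rw [h3]
      exact L.lie_mem (hPu z hz) (hPv y hy.mem)
  apply le_antisymm
  · intro x hx
    -- It suffices to place `x + θ x` in `L` for all `x`, because a fixed `x` is half of it.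
    let K : Submodule ℂ 𝔤 := L.toSubmodule.comap (LinearMap.id + (θ : 𝔤 →ₗ[ℂ] 𝔤))
    have h1 : K = ⊤ := by
      refine F.span K (fun v ↦ ?_) key
      change h v + θ (h v) ∈ L
      rw [hθ, add_neg_cancel]
      exact L.zero_mem
    have h2 : x ∈ K := by rw [h1]; trivial
    have h3 : x + θ x ∈ L := h2
    rw [mem_fixedSubalgebra.mp hx, ← two_smul ℂ] at h3
    have := L.smul_mem (2⁻¹ : ℂ) h3
    rwa [smul_smul, inv_mul_cancel₀ two_ne_zero, one_smul] at this
  · rw [hL, LieSubalgebra.lieSpan_le]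
    rintro _ ⟨i, rfl⟩
    rw [SetLike.mem_coe, mem_fixedSubalgebra, map_add, (he i).map_map, add_comm]

end SimplyLacedFrame

end Berman

/-! ### The types `A` and `D` -/

theorem isSymm_cartanMatrix_A (n : ℕ) : (CartanMatrix.A n).IsSymm := by
  ext i j
  simp only [CartanMatrix.A, Matrix.transpose_apply, Matrix.of_apply, eq_comm (a := j), or_comm]

theorem isSymm_cartanMatrix_D (n : ℕ) : (CartanMatrix.D n).IsSymm := by
  ext i j
  simp only [CartanMatrix.D, Matrix.transpose_apply, Matrix.of_apply, Fin.ext_iff]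
  split_ifs <;> omega

section Classical

variable {𝔤 : Type*} [LieRing 𝔤] [LieAlgebra ℂ 𝔤] {B : LinearMap.BilinForm ℂ 𝔤}

namespace SimplyLacedFrame

/-- This is all that types `A` and `D` need; the brackets depend only on the diagram, and the root
system is no longer used. -/
theorem exists_berman {ι : Type*} [Fintype ι] [DecidableEq ι] {A : Matrix ι ι ℤ}
    {Φ : Set (ι → ℤ)} {h : (ι → ℤ) →ₗ[ℤ] 𝔤} (F : SimplyLacedFrame A B Φ h)
    (hinv : ∀ x y z : 𝔤, B ⁅x, y⁆ z = B x ⁅y, z⁆) (hs : B.IsSymm) {θ : 𝔤 ≃ₗ⁅ℂ⁆ 𝔤}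
    (hθ : ∀ v, θ (h v) = -h v) (hA : ∀ i j, i ≠ j → A i j = 0 ∨ A i j = -1) :
    ∃ x : ι → 𝔤, (∀ i j, i ≠ j → A i j = 0 → ⁅x i, x j⁆ = 0) ∧
      (∀ i j, A i j = -1 → ⁅x i, ⁅x i, x j⁆⁆ = -x j ∧ ⁅x j, ⁅x j, x i⁆⁆ = -x i) ∧
      (∀ i j, B (x i) (x j) = if i = j then -2 else 0) ∧
      fixedSubalgebra θ = LieSubalgebra.lieSpan ℂ 𝔤 (Set.range x) := by
  choose e he using fun i ↦ F.exists_isAdapted hθ (F.single_mem i)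
  have hm := F.single_mem
  refine ⟨fun i ↦ e i + θ (e i), fun i j _ h0 ↦ ?_, fun i j h1 ↦ ⟨?_, ?_⟩, fun i j ↦ ?_,
    F.fixedSubalgebra_eq_lieSpan hθ e he⟩
  · exact F.lie_adapted_eq_zero (hm i) (hm j) (by rw [latticeForm_single, h0]) (he i) (he j)
  · exact F.lie_lie_adapted (hm i) (hm j) (by rw [latticeForm_single, h1]) (he i) (he j)
  · exact F.lie_lie_adapted (hm j) (hm i)
      (by rw [latticeForm_comm F.symm, latticeForm_single, h1]) (he j) (he i)
  · split_ifs with hij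
    · subst hij
      exact F.form_adapted_self hinv hs (hm i) (he i)
    · refine F.form_adapted_eq_zero hinv (hm i) (hm j) ?_ ?_ (he i) (he j) <;>
      rw [latticeForm_single] <;> rcases hA i j hij with h0 | h0 <;> rw [h0] <;> decide

end SimplyLacedFrame

variable [FiniteDimensional ℂ 𝔤] [IsKilling ℂ 𝔤] (H : LieSubalgebra ℂ 𝔤) [H.IsCartanSubalgebra]
  (hB : IsNormalizedForm H B) {θ : 𝔤 ≃ₗ⁅ℂ⁆ 𝔤} (hθ : ∀ h ∈ H, θ h = -h)
include hB hθ

omit hB in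
theorem map_frameMap {r : ℕ} (b : (rootSystem H).Base) (ε : b.support ≃ Fin r) (v : Fin r → ℤ) :
    θ (frameMap H b ε v) = -frameMap H b ε v :=
  hθ _ (latticeCoweight H b ε v).2

theorem fixedSubalgebra_eq_span_of_A_one (hT : IsOfType H (.A 1)) :
    ∃ x ≠ 0, (fixedSubalgebra θ).toSubmodule = Submodule.span ℂ {x} := by
  obtain ⟨b, ε, hb⟩ := hT
  obtain ⟨x, -, -, h3, h4⟩ := (simplyLacedFrame H (A := CartanMatrix.A 1) (by decide) b ε hb
    hB).exists_berman hB.invariant hB.symm (map_frameMap H hθ b ε)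
      fun i j hij ↦ absurd (Subsingleton.elim i j) hij
  refine ⟨x 0, fun h0 ↦ ?_, ?_⟩
  · have := h3 0 0
    rw [h0] at this
    simp at this
  · rw [h4]
    apply le_antisymm
    · intro y hy
      have hy' : y ∈ LieSubalgebra.lieSpan ℂ 𝔤 (Set.range x) := hy
      induction hy' using LieSubalgebra.lieSpan_induction with
      | mem u hu =>
        obtain ⟨i, rfl⟩ := hu
        rw [Subsingleton.elim i 0]
        exact Submodule.mem_span_singleton_self _
      | zero => exact zero_mem _
      | add u v hu' hv' hu hv => exact add_mem (hu hu') (hv hv')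
      | smul c u hu' hu => exact Submodule.smul_mem _ _ (hu hu')
      | lie u v hu' hv' hu hv =>
        obtain ⟨c, rfl⟩ := Submodule.mem_span_singleton.mp (hu hu')
        obtain ⟨d, rfl⟩ := Submodule.mem_span_singleton.mp (hv hv')
        rw [smul_lie, lie_smul, lie_self, smul_zero, smul_zero]
        exact zero_mem _
    · rw [Submodule.span_singleton_le_iff_mem]
      exact LieSubalgebra.subset_lieSpan ⟨0, rfl⟩

variable {V : Type*} [AddCommGroup V] [Module ℂ V] (R : AffineAlgebra 𝔤 B 1 V)

theorem hasDecomposition_of_A {n : ℕ} (hT : IsOfType H (.A n)) :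
    (n = 2 → HasDecomposition R (fixedSubalgebra θ) [(.A 1, 4)]) ∧
    (∀ m, 2 ≤ m → n = 2 * m → HasDecomposition R (fixedSubalgebra θ) [(.B m, 2)]) ∧
    (∀ m, 2 ≤ m → n = 2 * m - 1 → HasDecomposition R (fixedSubalgebra θ) (typeD m 2)) := by
  obtain ⟨b, ε, hb⟩ := hT
  obtain ⟨x, h1, h2, h3, h4⟩ := (simplyLacedFrame H (A := CartanMatrix.A n)
    (isSymm_cartanMatrix_A n) b ε hb
    hB).exists_berman hB.invariant hB.symm (map_frameMap H hθ b ε) (fun i j hij ↦ by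
      simp only [CartanMatrix.A, Matrix.of_apply, if_neg hij]
      split_ifs <;> simp)
  rw [h4]
  refine hasDecomposition_of_chain hB.invariant hB.symm R x (fun i j hij ↦ h1 i j ?_ ?_)
    (fun i j hij ↦ h2 i j ?_) h3
  · rintro rfl; omega
  · simp only [CartanMatrix.A, Matrix.of_apply]
    rw [if_neg (by rintro rfl; omega), if_neg (by omega)]
  · simp only [CartanMatrix.A, Matrix.of_apply]
    rw [if_neg (by rintro rfl; omega), if_pos (by omega)]

theorem hasDecomposition_of_D {N : ℕ} (hN : 4 ≤ N) (hT : IsOfType H (.D N)) :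
    (∀ m, 2 ≤ m → N = 2 * m →
      HasDecomposition R (fixedSubalgebra θ) (typeD m 1 ++ typeD m 1)) ∧
    (∀ m, 2 ≤ m → N = 2 * m + 1 →
      HasDecomposition R (fixedSubalgebra θ) [(.B m, 1), (.B m, 1)]) := by
  obtain ⟨n, rfl⟩ : ∃ n, N = n + 2 := ⟨N - 2, by omega⟩
  obtain ⟨b, ε, hb⟩ := hT
  obtain ⟨x, h1, h2, h3, h4⟩ := (simplyLacedFrame H (A := CartanMatrix.D (n + 2))
    (isSymm_cartanMatrix_D (n + 2)) b ε hb
    hB).exists_berman hB.invariant hB.symm (map_frameMap H hθ b ε) (fun i j hij ↦ by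
      simp only [CartanMatrix.D, Matrix.of_apply, if_neg hij]
      split_ifs <;> simp)
  let y : ℕ → 𝔤 := fun i ↦ if hi : i < n + 2 then x ⟨i, hi⟩ else 0
  have hy : ∀ (i : ℕ) (hi : i < n + 2), y i = x ⟨i, hi⟩ := fun i hi ↦ dif_pos hi
  have hrange : Set.range x = y '' Set.Iio (n + 2) := by
    ext z
    constructor
    · rintro ⟨i, rfl⟩
      exact ⟨i, i.2, hy i i.2⟩
    · rintro ⟨i, hi, rfl⟩
      exact ⟨⟨i, hi⟩, (hy i hi).symm⟩
  rw [h4, hrange]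
  refine hasDecomposition_of_fork hB.invariant hB.symm R (by omega) y (fun i j hij hj h5 h6 ↦ ?_)
    (fun i j hij hj h5 ↦ ?_) (fun i j hi hj ↦ ?_)
  · rw [hy i (hij.trans hj), hy j hj]
    refine h1 _ _ (by simp only [ne_eq, Fin.ext_iff]; omega) ?_
    simp only [CartanMatrix.D, Matrix.of_apply, Fin.ext_iff]
    split_ifs <;> omega
  · rw [hy i (hij.trans hj), hy j hj]
    refine h2 _ _ ?_
    simp only [CartanMatrix.D, Matrix.of_apply, Fin.ext_iff]
    split_ifs <;> omega
  · rw [hy i hi, hy j hj, h3]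
    simp only [Fin.ext_iff]

end Classical

/-! ### Cayley transforms -/

section Exponential

variable {𝔤 : Type*} [LieRing 𝔤] [LieAlgebra ℂ 𝔤]

/-- The exponential of a linear map of nilpotency class at most three. -/
def expLinear (D : 𝔤 →ₗ[ℂ] 𝔤) : 𝔤 →ₗ[ℂ] 𝔤 := LinearMap.id + D + (1 / 2 : ℂ) • (D ∘ₗ D)

theorem expLinear_apply (D : 𝔤 →ₗ[ℂ] 𝔤) (x : 𝔤) :
    expLinear D x = x + D x + (1 / 2 : ℂ) • D (D x) := rfl

theorem expLinear_neg_apply {D : 𝔤 →ₗ[ℂ] 𝔤} (hD : ∀ x, D (D (D x)) = 0) (x : 𝔤) :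
    expLinear (-D) (expLinear D x) = x := by
  simp only [expLinear_apply, LinearMap.neg_apply, map_add, map_smul, map_neg, hD, map_zero]
  module

theorem expLinear_lie {D : 𝔤 →ₗ[ℂ] 𝔤} (hL : ∀ x y, D ⁅x, y⁆ = ⁅D x, y⁆ + ⁅x, D y⁆)
    (hD : ∀ x, D (D (D x)) = 0) (x y : 𝔤) :
    expLinear D ⁅x, y⁆ = ⁅expLinear D x, expLinear D y⁆ := by
  -- The vanishing of `D³` on `[x, y]` and on `[D x, y]` removes the terms of order three and four
  -- in the product of the exponentials.
  have h1 := hD ⁅x, y⁆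
  have h2 := hD ⁅D x, y⁆
  simp only [hL, map_add, hD, zero_lie, lie_zero, map_zero] at h1 h2
  simp only [expLinear_apply, hL, map_add, lie_add, add_lie, lie_smul, smul_lie]
  linear_combination (norm := module) (-1 / 6 : ℂ) • h1 - (1 / 12 : ℂ) • h2

/-- The exponential of a derivation of nilpotency class at most three. -/
def expEquiv (D : 𝔤 →ₗ[ℂ] 𝔤) (hL : ∀ x y, D ⁅x, y⁆ = ⁅D x, y⁆ + ⁅x, D y⁆)
    (hD : ∀ x, D (D (D x)) = 0) : 𝔤 ≃ₗ⁅ℂ⁆ 𝔤 where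
  __ := expLinear D
  map_lie' := expLinear_lie hL hD _ _
  invFun := expLinear (-D)
  left_inv := expLinear_neg_apply hD
  right_inv x := by
    have := expLinear_neg_apply (D := -D) (fun x ↦ by simp [hD]) x
    rwa [neg_neg] at this

theorem expEquiv_apply (D : 𝔤 →ₗ[ℂ] 𝔤) (hL : ∀ x y, D ⁅x, y⁆ = ⁅D x, y⁆ + ⁅x, D y⁆)
    (hD : ∀ x, D (D (D x)) = 0) (x : 𝔤) :
    expEquiv D hL hD x = x + D x + (1 / 2 : ℂ) • D (D x) := rfl

theorem form_expEquiv {B : LinearMap.BilinForm ℂ 𝔤} (D : 𝔤 →ₗ[ℂ] 𝔤)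
    (hL : ∀ x y, D ⁅x, y⁆ = ⁅D x, y⁆ + ⁅x, D y⁆) (hD : ∀ x, D (D (D x)) = 0)
    (hB : ∀ x y, B (D x) y = -B x (D y)) (x y : 𝔤) :
    B (expEquiv D hL hD x) (expEquiv D hL hD y) = B x y := by
  simp only [expEquiv_apply, map_add, LinearMap.add_apply, map_smul, LinearMap.smul_apply, hB,
    smul_eq_mul, hD, map_zero]
  ring

theorem exists_expEquiv {B : LinearMap.BilinForm ℂ 𝔤}
    (hinv : ∀ x y z : 𝔤, B ⁅x, y⁆ z = B x ⁅y, z⁆) (e : 𝔤)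
    (he : ∀ x : 𝔤, ⁅e, ⁅e, ⁅e, x⁆⁆⁆ = 0) (s : ℂ) : ∃ φ : 𝔤 ≃ₗ⁅ℂ⁆ 𝔤,
      (∀ x, φ x = x + s • ⁅e, x⁆ + (s * s / 2) • ⁅e, ⁅e, x⁆⁆) ∧ ∀ x y, B (φ x) (φ y) = B x y := by
  let D : 𝔤 →ₗ[ℂ] 𝔤 := s • (LieAlgebra.ad ℂ 𝔤 e : 𝔤 →ₗ[ℂ] 𝔤)
  have hDx : ∀ x, D x = s • ⁅e, x⁆ := fun x ↦ rfl
  have hL : ∀ x y, D ⁅x, y⁆ = ⁅D x, y⁆ + ⁅x, D y⁆ := by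
    intro x y
    simp only [hDx]
    rw [leibniz_lie, smul_lie, lie_smul, smul_add]
  have hD : ∀ x, D (D (D x)) = 0 := by
    intro x
    simp only [hDx, lie_smul, he, smul_zero]
  refine ⟨expEquiv D hL hD, fun x ↦ ?_, form_expEquiv D hL hD fun x y ↦ ?_⟩
  · rw [expEquiv_apply, hDx, hDx, lie_smul]
    module
  · rw [hDx, hDx, map_smul, LinearMap.smul_apply, map_smul, ← lie_skew, map_neg,
      LinearMap.neg_apply, hinv]
    simp

end Exponential

/-! ### Transport of the Cartan subalgebra along automorphisms -/

section Cayley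

variable {ι : Type*} [Fintype ι] [DecidableEq ι] {𝔤 : Type*} [LieRing 𝔤] [LieAlgebra ℂ 𝔤]
  {A : Matrix ι ι ℤ} {B : LinearMap.BilinForm ℂ 𝔤} {Φ : Set (ι → ℤ)} {h : (ι → ℤ) →ₗ[ℤ] 𝔤}

/-- The transport of the coroot map along an automorphism. -/
def transport (φ : 𝔤 ≃ₗ⁅ℂ⁆ 𝔤) (h : (ι → ℤ) →ₗ[ℤ] 𝔤) : (ι → ℤ) →ₗ[ℤ] 𝔤 :=
  ((φ : 𝔤 →ₗ[ℂ] 𝔤).restrictScalars ℤ) ∘ₗ h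

omit [Fintype ι] [DecidableEq ι] in
theorem transport_apply (φ : 𝔤 ≃ₗ⁅ℂ⁆ 𝔤) (h : (ι → ℤ) →ₗ[ℤ] 𝔤) (v : ι → ℤ) :
    transport φ h v = φ (h v) := rfl

theorem mem_weightVectors_transport (φ : 𝔤 ≃ₗ⁅ℂ⁆ 𝔤) (v : ι → ℤ) (x : 𝔤) :
    φ x ∈ weightVectors A (transport φ h) v ↔ x ∈ weightVectors A h v := by
  refine forall_congr' fun w ↦ ?_
  rw [transport_apply, ← LieEquiv.map_lie, ← map_smul]
  exact φ.injective.eq_iff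

namespace SimplyLacedFrame

theorem transport (F : SimplyLacedFrame A B Φ h) (φ : 𝔤 ≃ₗ⁅ℂ⁆ 𝔤)
    (hφ : ∀ x y, B (φ x) (φ y) = B x y) :
    SimplyLacedFrame A B Φ (AffineFixedPoints.transport φ h) where
  symm := F.symm
  lie_h_h u v := by
    rw [transport_apply, transport_apply, ← LieEquiv.map_lie, F.lie_h_h]
    exact map_zero φ
  form_h u v := by rw [transport_apply, transport_apply, hφ, F.form_h]
  norm_root := F.norm_root
  reflect := F.reflect
  sub_mem := F.sub_mem
  single_mem := F.single_mem
  exists_sl2 v hv := by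
    obtain ⟨e, he, f, hf, hef⟩ := F.exists_sl2 v hv
    exact ⟨φ e, (mem_weightVectors_transport φ v e).mpr he, φ f,
      (mem_weightVectors_transport φ _ f).mpr hf, by rw [← LieEquiv.map_lie, hef, transport_apply]⟩
  exists_smul v hv x hx y hy hy0 := by
    obtain ⟨x, rfl⟩ : ∃ y, φ y = x := φ.surjective x
    obtain ⟨y, rfl⟩ : ∃ z, φ z = y := φ.surjective y
    rw [mem_weightVectors_transport] at hx hy
    have hy0' : y ≠ 0 := by
      rintro rfl
      exact hy0 (map_zero φ)
    obtain ⟨c, rfl⟩ := F.exists_smul v hv x hx y hy hy0'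
    exact ⟨c, map_smul φ c y⟩
  eq_zero v hv hv0 x hx := by
    obtain ⟨x, rfl⟩ : ∃ y, φ y = x := φ.surjective x
    rw [mem_weightVectors_transport] at hx
    rw [F.eq_zero v hv hv0 x hx]
    exact map_zero φ
  span K h0 h1 := by
    have h2 := F.span (K.comap (φ : 𝔤 →ₗ[ℂ] 𝔤)) h0
      fun v hv x hx ↦ h1 v hv ((mem_weightVectors_transport φ v x).mpr hx)
    rw [eq_top_iff]
    intro x _
    obtain ⟨x, rfl⟩ : ∃ y, φ y = x := φ.surjective x
    have h3 : x ∈ K.comap (φ : 𝔤 →ₗ[ℂ] 𝔤) := by rw [h2]; trivial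
    exact h3

/-- Since `(u, v) ≥ -2` for roots, `3u + v` has norm at least 8 and is not a weight. -/
theorem lie_lie_lie_eq_zero (F : SimplyLacedFrame A B Φ h) {u : ι → ℤ} (hu : u ∈ Φ) {e : 𝔤}
    (he : e ∈ weightVectors A h u) (x : 𝔤) : ⁅e, ⁅e, ⁅e, x⁆⁆⁆ = 0 := by
  let D : 𝔤 →ₗ[ℂ] 𝔤 := (LieAlgebra.ad ℂ 𝔤 e : 𝔤 →ₗ[ℂ] 𝔤)
  have h1 : LinearMap.ker (D ∘ₗ D ∘ₗ D) = ⊤ := by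
    refine F.span _ (fun v ↦ ?_) fun v hv y hy ↦ ?_
    · change ⁅e, ⁅e, ⁅e, h v⁆⁆⁆ = 0
      rw [← lie_skew e (h v), he v]
      simp
    · change ⁅e, ⁅e, ⁅e, y⁆⁆⁆ = 0
      refine F.eq_zero_of_norm ?_ (lie_mem_weightVectors he (lie_mem_weightVectors he
        (lie_mem_weightVectors he hy)))
      have h2 : -2 ≤ latticeForm A u v := by
        by_contra! hlt
        have h3 : u ≠ -v := by
          rintro rfl
          rw [neg_latticeForm_left, F.norm_root v hv] at hlt
          omega
        have := F.eq_one_of_pos hu (F.neg_mem hv) (by rw [map_neg]; omega) h3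
        rw [map_neg] at this
        omega
      rw [F.norm_add, F.norm_add, F.norm_add, map_add, map_add, F.norm_root u hu,
        F.norm_root v hv]
      omega
  have h2 : x ∈ LinearMap.ker (D ∘ₗ D ∘ₗ D) := by rw [h1]; trivial
  exact h2

end SimplyLacedFrame

end Cayley

/-! ### Cayley transforms in roots that are inverted -/

section CayleyTransform

variable {ι : Type*} [Fintype ι] [DecidableEq ι] {𝔤 : Type*} [LieRing 𝔤] [LieAlgebra ℂ 𝔤]
  {A : Matrix ι ι ℤ} {B : LinearMap.BilinForm ℂ 𝔤} {Φ : Set (ι → ℤ)} {h : (ι → ℤ) →ₗ[ℤ] 𝔤}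

/-- The involution `θ` preserves the Cartan subalgebra and acts on the coroot lattice by `σ`. -/
structure IsTwist (A : Matrix ι ι ℤ) (h : (ι → ℤ) →ₗ[ℤ] 𝔤) (θ : 𝔤 ≃ₗ⁅ℂ⁆ 𝔤)
    (σ : (ι → ℤ) →ₗ[ℤ] (ι → ℤ)) : Prop where
  map_h : ∀ v, θ (h v) = h (σ v)
  symm : ∀ u v, latticeForm A (σ u) v = latticeForm A u (σ v)
  map_map : ∀ x, θ (θ x) = x

theorem IsTwist.map_mem {θ : 𝔤 ≃ₗ⁅ℂ⁆ 𝔤} {σ : (ι → ℤ) →ₗ[ℤ] (ι → ℤ)} (T : IsTwist A h θ σ)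
    {v : ι → ℤ} {x : 𝔤} (hx : x ∈ weightVectors A h v) : θ x ∈ weightVectors A h (σ v) := by
  intro w
  rw [← T.map_map (h w), T.map_h, ← LieEquiv.map_lie, hx, T.symm]
  exact map_smul θ _ _

/-- The linear map `σ + ⟨β, ·⟩ β`. -/
def twistBy (A : Matrix ι ι ℤ) (σ : (ι → ℤ) →ₗ[ℤ] (ι → ℤ)) (β : ι → ℤ) :
    (ι → ℤ) →ₗ[ℤ] (ι → ℤ) :=
  σ + (latticeForm A β).smulRight β

theorem twistBy_apply (σ : (ι → ℤ) →ₗ[ℤ] (ι → ℤ)) (β v : ι → ℤ) :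
    twistBy A σ β v = σ v + latticeForm A β v • β := rfl

namespace SimplyLacedFrame

variable (F : SimplyLacedFrame A B Φ h)
include F

theorem lie_eq_zero_of_orthogonal {u v : ι → ℤ} (hu : u ∈ Φ) (hv : v ∈ Φ)
    (huv : latticeForm A u v = 0) {x y : 𝔤} (hx : x ∈ weightVectors A h u)
    (hy : y ∈ weightVectors A h v) : ⁅x, y⁆ = 0 := by
  refine F.eq_zero_of_norm ?_ (lie_mem_weightVectors hx hy)
  rw [F.norm_add, huv, F.norm_root u hu, F.norm_root v hv]
  norm_num

theorem isAdapted_ne_zero {θ : 𝔤 ≃ₗ⁅ℂ⁆ 𝔤} {v : ι → ℤ} (hv : v ∈ Φ) {e : 𝔤}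
    (he : IsAdapted A h θ v e) : e ≠ 0 := by
  rintro rfl
  apply F.h_ne_zero hv
  rw [← he.lie_eq, lie_zero]

/-- The Cayley transform that belongs to a root `β` with `θ h_β = -h_β`. -/
theorem exists_cayley (hinv : ∀ x y z : 𝔤, B ⁅x, y⁆ z = B x ⁅y, z⁆) {θ : 𝔤 ≃ₗ⁅ℂ⁆ 𝔤}
    {σ : (ι → ℤ) →ₗ[ℤ] (ι → ℤ)} (T : IsTwist A h θ σ) {β : ι → ℤ} (hβ : β ∈ Φ) (hσ : σ β = -β) :
    ∃ h' : (ι → ℤ) →ₗ[ℤ] 𝔤, SimplyLacedFrame A B Φ h' ∧ IsTwist A h' θ (twistBy A σ β) ∧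
      (∀ x ∈ weightVectors A h' β, θ x = -x) ∧
      ∀ γ ∈ Φ, latticeForm A β γ = 0 → ∀ x ∈ weightVectors A h' γ, x ∈ weightVectors A h γ := by
  obtain ⟨e, he⟩ : ∃ e, IsAdapted A h θ β e := by
    have h1 : ∀ x ∈ weightVectors A h β, θ x ∈ weightVectors A h (-β) :=
      fun x hx ↦ hσ ▸ T.map_mem hx
    obtain ⟨e, he, h2, h3⟩ := F.exists_adapted hβ (by rw [T.map_h, hσ, map_neg]) h1
      (fun x hx ↦ by simpa [hσ] using T.map_mem hx)
    exact ⟨e, he, h1 e he, by rw [← lie_skew, ← lie_neg, h2], h3⟩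
  set g := θ e with hg
  -- The parameters `i` and `-i/2` are chosen so that the composite sends `h β` to `-i (e + θ e)`,
  -- which `θ` fixes.
  obtain ⟨φ₁, hφ₁, hB₁⟩ := exists_expEquiv hinv e (F.lie_lie_lie_eq_zero hβ he.mem) Complex.I
  obtain ⟨φ₂, hφ₂, hB₂⟩ := exists_expEquiv hinv g
    (F.lie_lie_lie_eq_zero (F.neg_mem hβ) he.map_mem) (-Complex.I / 2)
  have hI : Complex.I * Complex.I = -1 := Complex.I_mul_I
  have hge : ⁅g, e⁆ = h β := he.lie_eq
  have heg : ⁅e, g⁆ = -h β := by rw [← lie_skew, hge]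
  have hev : ∀ v, ⁅e, h v⁆ = -((latticeForm A β v : ℤ) : ℂ) • e := by
    intro v
    rw [← lie_skew, he.mem v, neg_smul]
  have hgv : ∀ v, ⁅g, h v⁆ = ((latticeForm A β v : ℤ) : ℂ) • g := by
    intro v
    rw [← lie_skew, he.map_mem v, neg_latticeForm_left]
    push_cast
    module
  have hββ : ((latticeForm A β β : ℤ) : ℂ) = 2 := by rw [F.norm_root β hβ]; norm_num
  have hφ₁v : ∀ v, φ₁ (h v) = h v - (Complex.I * (latticeForm A β v : ℤ)) • e := by
    intro v
    rw [hφ₁, hev, lie_smul, lie_self]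
    module
  have hφ₁g : φ₁ g = g - Complex.I • h β - e := by
    rw [hφ₁, heg, lie_neg, hev, hββ]
    linear_combination (norm := module) hI • e
  have hφ₁e : φ₁ e = e := by
    rw [hφ₁, lie_self, lie_zero]
    module
  have hφ₂v : ∀ v, φ₂ (h v) = h v - (Complex.I / 2 * (latticeForm A β v : ℤ)) • g := by
    intro v
    rw [hφ₂, hgv, lie_smul, lie_self]
    module
  have hφ₂e : φ₂ e = e - (Complex.I / 2) • h β - (1 / 4 : ℂ) • g := by
    rw [hφ₂, hge, hgv, hββ]
    linear_combination (norm := module) (1 / 4 : ℂ) • hI • g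
  have hm1 : ∀ (c : ℂ) x, φ₁ (c • x) = c • φ₁ x := fun c x ↦ map_smul φ₁ c x
  have hs1 : ∀ x y, φ₁ (x - y) = φ₁ x - φ₁ y := fun x y ↦ map_sub φ₁ x y
  have hmθ : ∀ (c : ℂ) x, θ (c • x) = c • θ x := fun c x ↦ map_smul θ c x
  have hsθ : ∀ x y, θ (x - y) = θ x - θ y := fun x y ↦ map_sub θ x y
  have haθ : ∀ x y, θ (x + y) = θ x + θ y := fun x y ↦ map_add θ x y
  have hθg : θ g = e := T.map_map e
  have hθβ : θ (h β) = -h β := by rw [T.map_h, hσ, map_neg]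
  set φ : 𝔤 ≃ₗ⁅ℂ⁆ 𝔤 := φ₂.trans φ₁ with hφ
  have hφv : ∀ v, φ (h v) = h v - (((latticeForm A β v : ℤ) : ℂ) / 2) • h β -
      (Complex.I / 2 * (latticeForm A β v : ℤ)) • (e + g) := by
    intro v
    change φ₁ (φ₂ (h v)) = _
    rw [hφ₂v, hs1, hm1, hφ₁g, hφ₁v]
    linear_combination (norm := module) (((latticeForm A β v : ℤ) : ℂ) / 2) • hI • h β
  have hφe : φ e = (1 / 4 : ℂ) • (e - g - Complex.I • h β) := by
    change φ₁ (φ₂ e) = _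
    rw [hφ₂e, hs1, hs1, hm1, hm1, hφ₁g, hφ₁v, hφ₁e, hββ]
    linear_combination (norm := module) hI • e
  refine ⟨AffineFixedPoints.transport φ h, F.transport φ fun x y ↦ ?_, ⟨fun v ↦ ?_, fun u v ↦ ?_,
    T.map_map⟩, fun x hx ↦ ?_, fun γ hγ hβγ x hx ↦ ?_⟩
  · exact (hB₁ _ _).trans (hB₂ _ _)
  -- Adding `(β, ·) β` to `σ` turns the value `-β` at `β` into `β`, and preserves `(β, v)` because
  -- `σ` is symmetric with `σ β = -β`.
  · have h1 : latticeForm A β (σ v + latticeForm A β v • β) = latticeForm A β v := by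
      rw [map_add, map_smul, ← T.symm, hσ, neg_latticeForm_left, F.norm_root β hβ, smul_eq_mul]
      ring
    rw [transport_apply, transport_apply, twistBy_apply, hφv, hφv, h1, hsθ, hsθ, hmθ, hmθ, haθ,
      T.map_h, hθβ, hθg, map_add, map_smul, ← Int.cast_smul_eq_zsmul ℂ]
    module
  · rw [twistBy_apply, twistBy_apply, map_add, map_add, LinearMap.add_apply, T.symm, map_smul,
      map_smul, LinearMap.smul_apply, latticeForm_comm F.symm u β, smul_eq_mul, smul_eq_mul]
    ring
  · obtain ⟨x, rfl⟩ : ∃ y, φ y = x := φ.surjective x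
    rw [mem_weightVectors_transport] at hx
    obtain ⟨c, rfl⟩ := F.exists_smul β hβ x hx e he.mem (F.isAdapted_ne_zero hβ he)
    have h1 : φ (c • e) = c • φ e := map_smul φ c e
    -- The new root vector is a multiple of `e - θ e - i h β`, and `θ` negates it.
    rw [h1, hφe, hmθ, hmθ, hsθ, hsθ, hmθ, hθβ, hθg]
    module
  · obtain ⟨x, rfl⟩ : ∃ y, φ y = x := φ.surjective x
    rw [mem_weightVectors_transport] at hx
    -- Orthogonal roots are strongly orthogonal in the simply laced case, so both exponentials fix
    -- `x`. This preserves the signs already obtained when several transforms are composed.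
    have h1 : ⁅g, x⁆ = 0 := F.lie_eq_zero_of_orthogonal (F.neg_mem hβ) hγ
      (by rw [neg_latticeForm_left, hβγ, neg_zero]) he.map_mem hx
    have h2 : ⁅e, x⁆ = 0 := F.lie_eq_zero_of_orthogonal hβ hγ hβγ he.mem hx
    have h3 : φ x = x := by
      change φ₁ (φ₂ x) = x
      rw [hφ₂, h1, lie_zero, smul_zero, smul_zero, add_zero, add_zero, hφ₁, h2, lie_zero, smul_zero,
        smul_zero, add_zero, add_zero]
    rwa [h3]

/-- The composition of the Cayley transforms that belong to orthogonal roots. -/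
theorem exists_cayley_list (hinv : ∀ x y z : 𝔤, B ⁅x, y⁆ z = B x ⁅y, z⁆) {θ : 𝔤 ≃ₗ⁅ℂ⁆ 𝔤}
    {σ : (ι → ℤ) →ₗ[ℤ] (ι → ℤ)} (T : IsTwist A h θ σ) (l : List (ι → ℤ)) (hl : ∀ β ∈ l, β ∈ Φ)
    (hσ : ∀ β ∈ l, σ β = -β) (horth : l.Pairwise fun β γ ↦ latticeForm A β γ = 0) :
    ∃ h' : (ι → ℤ) →ₗ[ℤ] 𝔤, SimplyLacedFrame A B Φ h' ∧ IsTwist A h' θ (l.foldl (twistBy A) σ) ∧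
      (∀ β ∈ l, ∀ x ∈ weightVectors A h' β, θ x = -x) ∧
      ∀ γ ∈ Φ, (∀ β ∈ l, latticeForm A β γ = 0) →
        ∀ x ∈ weightVectors A h' γ, x ∈ weightVectors A h γ := by
  induction l generalizing h σ with
  | nil => exact ⟨h, F, T, by simp, fun _ _ _ _ hx ↦ hx⟩
  | cons β l ih =>
    rw [List.pairwise_cons] at horth
    obtain ⟨h₁, F₁, T₁, hm₁, hw₁⟩ := F.exists_cayley hinv T (hl β (by simp)) (hσ β (by simp))
    obtain ⟨h₂, F₂, T₂, hm₂, hw₂⟩ := ih F₁ T₁ (fun γ hγ ↦ hl γ (by simp [hγ])) (fun γ hγ ↦ by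
      rw [twistBy_apply, horth.1 γ hγ, zero_smul, add_zero, hσ γ (by simp [hγ])]) horth.2
    refine ⟨h₂, F₂, T₂, fun γ hγ x hx ↦ ?_, fun γ hγ hγl x hx ↦ ?_⟩
    · rcases List.mem_cons.mp hγ with rfl | hγ'
      · exact hm₁ x (hw₂ γ (hl γ (by simp)) (fun δ hδ ↦ by
          rw [latticeForm_comm F.symm, horth.1 δ hδ]) x hx)
      · exact hm₂ γ hγ' x hx
    · exact hw₁ γ hγ (hγl β (by simp)) x (hw₂ γ hγ (fun δ hδ ↦ hγl δ (by simp [hδ])) x hx)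

end SimplyLacedFrame

end CayleyTransform

/-! ### Involutions that fix the Cartan subalgebra -/

section Character

variable {ι : Type*} [Fintype ι] [DecidableEq ι] {𝔤 : Type*} [LieRing 𝔤] [LieAlgebra ℂ 𝔤]
  {A : Matrix ι ι ℤ} {B : LinearMap.BilinForm ℂ 𝔤} {Φ : Set (ι → ℤ)} {h : (ι → ℤ) →ₗ[ℤ] 𝔤}

/-- The automorphism `θ` acts on the root vectors of the root `v` by the sign `(-1) ^ ε v`. -/
def IsCharacter (A : Matrix ι ι ℤ) (Φ : Set (ι → ℤ)) (h : (ι → ℤ) →ₗ[ℤ] 𝔤) (θ : 𝔤 ≃ₗ⁅ℂ⁆ 𝔤)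
    (ε : (ι → ℤ) →ₗ[ℤ] ℤ) : Prop :=
  ∀ v ∈ Φ, ∀ x ∈ weightVectors A h v, θ x = ((ε v).negOnePow : ℤ) • x

theorem sum_smul_single (v : ι → ℤ) : ∑ i, v i • (Pi.single i 1 : ι → ℤ) = v := by
  ext j
  simp [Finset.sum_apply, Pi.single_apply]

theorem linearMap_apply_eq_sum (ε : (ι → ℤ) →ₗ[ℤ] ℤ) (v : ι → ℤ) :
    ε v = ∑ i, v i * ε (Pi.single i 1) := by
  conv_lhs => rw [← sum_smul_single v]
  simp only [map_sum, map_smul, smul_eq_mul]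

theorem IsCharacter.congr {θ : 𝔤 ≃ₗ⁅ℂ⁆ 𝔤} {ε ε' : (ι → ℤ) →ₗ[ℤ] ℤ} (hε : IsCharacter A Φ h θ ε)
    (hεε' : ∀ i, Even (ε (Pi.single i 1) - ε' (Pi.single i 1))) : IsCharacter A Φ h θ ε' := by
  intro v hv x hx
  have h1 : (ε' v).negOnePow = (ε v).negOnePow := by
    rw [eq_comm, Int.negOnePow_eq_iff, linearMap_apply_eq_sum ε, linearMap_apply_eq_sum ε',
      ← Finset.sum_sub_distrib]
    refine Finset.even_sum _ fun i _ ↦ ?_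
    rw [← mul_sub]
    exact (hεε' i).mul_left _
  rw [h1]
  exact hε v hv x hx

/-- The reflection that belongs to `β`. -/
def latticeReflection (A : Matrix ι ι ℤ) (β : ι → ℤ) : (ι → ℤ) →ₗ[ℤ] (ι → ℤ) :=
  LinearMap.id - (latticeForm A β).smulRight β

theorem latticeReflection_apply (β v : ι → ℤ) :
    latticeReflection A β v = v - latticeForm A β v • β := rfl

namespace SimplyLacedFrame

variable (F : SimplyLacedFrame A B Φ h)
include F

theorem latticeReflection_involutive {β : ι → ℤ} (hβ : β ∈ Φ) (v : ι → ℤ) :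
    latticeReflection A β (latticeReflection A β v) = v := by
  simp only [latticeReflection_apply, map_sub, map_smul, F.norm_root β hβ]
  module

theorem latticeForm_latticeReflection {β : ι → ℤ} (u v : ι → ℤ) :
    latticeForm A (latticeReflection A β u) v = latticeForm A u (latticeReflection A β v) := by
  simp only [latticeReflection_apply, map_sub, map_smul, LinearMap.sub_apply, LinearMap.smul_apply,
    smul_eq_mul, latticeForm_comm F.symm u β]
  ring

theorem latticeReflection_mem {β v : ι → ℤ} (hβ : β ∈ Φ) (hv : v ∈ Φ) :
    latticeReflection A β v ∈ Φ := by
  rw [latticeReflection_apply, latticeForm_comm F.symm]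
  exact F.reflect β hβ v hv

theorem mem_weightVectors_comp_latticeReflection {β : ι → ℤ} (hβ : β ∈ Φ) (v : ι → ℤ) (x : 𝔤) :
    x ∈ weightVectors A (h ∘ₗ latticeReflection A β) v ↔
      x ∈ weightVectors A h (latticeReflection A β v) := by
  constructor
  · intro hx w
    have := hx (latticeReflection A β w)
    rw [LinearMap.comp_apply, F.latticeReflection_involutive hβ,
      ← F.latticeForm_latticeReflection] at this
    exact this
  · intro hx w
    rw [LinearMap.comp_apply, hx, F.latticeForm_latticeReflection,
      F.latticeReflection_involutive hβ]

theorem comp_latticeReflection {β : ι → ℤ} (hβ : β ∈ Φ) :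
    SimplyLacedFrame A B Φ (h ∘ₗ latticeReflection A β) where
  symm := F.symm
  lie_h_h u v := F.lie_h_h _ _
  form_h u v := by
    rw [LinearMap.comp_apply, LinearMap.comp_apply, F.form_h, F.latticeForm_latticeReflection,
      F.latticeReflection_involutive hβ]
  norm_root := F.norm_root
  reflect := F.reflect
  sub_mem := F.sub_mem
  single_mem := F.single_mem
  exists_sl2 v hv := by
    obtain ⟨e, he, f, hf, hef⟩ := F.exists_sl2 _ (F.latticeReflection_mem hβ hv)
    exact ⟨e, (F.mem_weightVectors_comp_latticeReflection hβ v e).mpr he, f,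
      (F.mem_weightVectors_comp_latticeReflection hβ _ f).mpr (by rwa [map_neg]), hef⟩
  exists_smul v hv x hx y hy := by
    rw [F.mem_weightVectors_comp_latticeReflection hβ] at hx hy
    exact F.exists_smul _ (F.latticeReflection_mem hβ hv) x hx y hy
  eq_zero v hv hv0 x hx := by
    rw [F.mem_weightVectors_comp_latticeReflection hβ] at hx
    refine F.eq_zero _ (fun h1 ↦ hv ?_) (fun h1 ↦ hv0 ?_) x hx
    · have := F.latticeReflection_mem hβ h1
      rwa [F.latticeReflection_involutive hβ] at this
    · rw [← F.latticeReflection_involutive hβ v, h1, map_zero]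
  span K h0 h1 := by
    refine F.span K (fun v ↦ ?_) fun v hv x hx ↦ ?_
    · have := h0 (latticeReflection A β v)
      rwa [LinearMap.comp_apply, F.latticeReflection_involutive hβ] at this
    · refine h1 _ (F.latticeReflection_mem hβ hv)
        ((F.mem_weightVectors_comp_latticeReflection hβ _ x).mpr ?_)
      rwa [F.latticeReflection_involutive hβ]

variable {θ : 𝔤 ≃ₗ⁅ℂ⁆ 𝔤}

/-- Reflecting the coordinates in `β` changes `ε v` by `(β, v) ε β`, hence by `(β, v)` modulo 2.
Only the parity of `s` matters: it says whether to reflect. -/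
theorem exists_reflect {ε : (ι → ℤ) →ₗ[ℤ] ℤ} (hθ : ∀ v, θ (h v) = h v)
    (hε : IsCharacter A Φ h θ ε) {β : ι → ℤ} (hβ : β ∈ Φ) (hεβ : Odd (ε β)) (s : ℤ) :
    ∃ h' : (ι → ℤ) →ₗ[ℤ] 𝔤, SimplyLacedFrame A B Φ h' ∧ (∀ v, θ (h' v) = h' v) ∧
      IsCharacter A Φ h' θ (ε + s • latticeForm A β) := by
  rcases Int.even_or_odd s with hs | hs
  · refine ⟨h, F, hθ, hε.congr fun i ↦ ?_⟩
    simp only [LinearMap.add_apply, LinearMap.smul_apply, smul_eq_mul, sub_add_cancel_left,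
      even_neg]
    exact hs.mul_right _
  · refine ⟨h ∘ₗ latticeReflection A β, F.comp_latticeReflection hβ, fun v ↦ hθ _, ?_⟩
    intro v hv x hx
    rw [F.mem_weightVectors_comp_latticeReflection hβ] at hx
    rw [hε _ (F.latticeReflection_mem hβ hv) x hx]
    congr 2
    rw [Int.negOnePow_eq_iff, latticeReflection_apply]
    simp only [map_sub, map_smul, LinearMap.add_apply, LinearMap.smul_apply, smul_eq_mul]
    have h1 : ε v - latticeForm A β v * ε β - (ε v + s * latticeForm A β v) =
      -(latticeForm A β v * (ε β + s)) := by ring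
    rw [h1, even_neg]
    exact (hεβ.add_odd hs).mul_left _

theorem exists_reflect_list {ε : (ι → ℤ) →ₗ[ℤ] ℤ} (hθ : ∀ v, θ (h v) = h v)
    (hε : IsCharacter A Φ h θ ε) (l : List ((ι → ℤ) × ℤ)) (hl : ∀ p ∈ l, p.1 ∈ Φ)
    (hεl : ∀ p ∈ l, Odd (ε p.1)) (horth : l.Pairwise fun p q ↦ latticeForm A p.1 q.1 = 0) :
    ∃ h' : (ι → ℤ) →ₗ[ℤ] 𝔤, SimplyLacedFrame A B Φ h' ∧ (∀ v, θ (h' v) = h' v) ∧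
      IsCharacter A Φ h' θ (l.foldl (fun ε p ↦ ε + p.2 • latticeForm A p.1) ε) := by
  induction l generalizing h ε with
  | nil => exact ⟨h, F, hθ, hε⟩
  | cons p l ih =>
    rw [List.pairwise_cons] at horth
    obtain ⟨h₁, F₁, hθ₁, hε₁⟩ := F.exists_reflect hθ hε (hl p (by simp)) (hεl p (by simp)) p.2
    refine ih F₁ hθ₁ hε₁ (fun q hq ↦ hl q (by simp [hq])) (fun q hq ↦ ?_) horth.2
    -- Orthogonality keeps the later roots odd, so the reflections can be applied independently.
    rw [LinearMap.add_apply, LinearMap.smul_apply, horth.1 q hq, smul_zero, add_zero]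
    exact hεl q (by simp [hq])

/-- An involution acts on each simple root space by a sign. Opposite roots have equal signs because
`[e, f]` is fixed, and signs multiply along brackets. -/
theorem exists_isCharacter (hθ : ∀ v, θ (h v) = h v) (hθθ : ∀ x, θ (θ x) = x) :
    ∃ ε : (ι → ℤ) →ₗ[ℤ] ℤ, IsCharacter A Φ h θ ε := by
  have hstable : ∀ {v x}, x ∈ weightVectors A h v → θ x ∈ weightVectors A h v := by
    intro v x hx w
    rw [← hθ w, ← LieEquiv.map_lie, hx]
    exact map_smul θ _ _
  have hmz : ∀ (n : ℤ) x, θ (n • x) = n • θ x := fun n x ↦ map_zsmul θ n x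
  have hneg : ∀ {v : ι → ℤ} {n : ℤ}, v ∈ Φ →
      (∀ x ∈ weightVectors A h v, θ x = (n.negOnePow : ℤ) • x) →
      ∀ x ∈ weightVectors A h (-v), θ x = ((-n).negOnePow : ℤ) • x := by
    intro v n hv hn x hx
    obtain ⟨e, he, f, hf, hef⟩ := F.exists_sl2 v hv
    have hf0 : f ≠ 0 := by
      rintro rfl
      rw [lie_zero] at hef
      exact F.h_ne_zero hv hef.symm
    obtain ⟨c, hc⟩ := F.exists_smul _ (F.neg_mem hv) _ (hstable hf) f hf hf0
    have h1 : θ ⁅e, f⁆ = ⁅e, f⁆ := by rw [hef, hθ]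
    have hn1 : (((n.negOnePow : ℤˣ) : ℤ) : ℂ) * ((n.negOnePow : ℤˣ) : ℤ) = 1 := by
      rw [← Int.cast_mul, ← Units.val_mul, ← Int.negOnePow_add, Int.negOnePow_even _ ⟨n, rfl⟩]
      simp
    rw [LieEquiv.map_lie, hn e he, hc, lie_smul, smul_lie, ← Int.cast_smul_eq_zsmul ℂ,
      smul_smul, hef] at h1
    have h2 : (c * ((n.negOnePow : ℤˣ) : ℤ) - 1) • h v = 0 := by
      rw [sub_smul, h1, one_smul, sub_self]
    have h3 := (smul_eq_zero.mp h2).resolve_right (F.h_ne_zero hv)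
    have h4 : c = ((n.negOnePow : ℤˣ) : ℤ) := by
      linear_combination ((n.negOnePow : ℤˣ) : ℤ) * h3 - c * hn1
    obtain ⟨d, rfl⟩ := F.exists_smul _ (F.neg_mem hv) x hx f hf hf0
    have h5 : θ (d • f) = d • θ f := map_smul θ d f
    rw [h5, hc, h4, Int.negOnePow_neg, ← Int.cast_smul_eq_zsmul ℂ, smul_comm]
  have hsimple : ∀ i, ∃ n : ℤ, ∀ x ∈ weightVectors A h (Pi.single i 1),
      θ x = (n.negOnePow : ℤ) • x := by
    intro i
    obtain ⟨e, he, f, hf, hef⟩ := F.exists_sl2 _ (F.single_mem i)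
    have he0 : e ≠ 0 := by
      rintro rfl
      rw [zero_lie] at hef
      exact F.h_ne_zero (F.single_mem i) hef.symm
    obtain ⟨c, hc⟩ := F.exists_smul _ (F.single_mem i) _ (hstable he) e he he0
    have hmul : ∀ (d : ℂ) x, θ (d • x) = d • θ x := fun d x ↦ map_smul θ d x
    have h1 := hθθ e
    rw [hc, hmul, hc, smul_smul] at h1
    have h2 : (c * c - 1) • e = 0 := by rw [sub_smul, h1, one_smul, sub_self]
    have h3 : (c - 1) * (c + 1) = 0 := by
      linear_combination (smul_eq_zero.mp h2).resolve_right he0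
    rcases mul_eq_zero.mp h3 with h4 | h4
    · refine ⟨0, fun x hx ↦ ?_⟩
      obtain ⟨d, rfl⟩ := F.exists_smul _ (F.single_mem i) x hx e he he0
      rw [hmul, hc, sub_eq_zero.mp h4]
      simp
    · refine ⟨1, fun x hx ↦ ?_⟩
      obtain ⟨d, rfl⟩ := F.exists_smul _ (F.single_mem i) x hx e he he0
      rw [hmul, hc, eq_neg_of_add_eq_zero_left h4]
      simp
  choose n hn using hsimple
  let ε : (ι → ℤ) →ₗ[ℤ] ℤ := Fintype.linearCombination ℤ n
  have hε : ∀ i, ε (Pi.single i 1) = n i := fun i ↦ by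
    simp [ε, Fintype.linearCombination_apply_single]
  refine ⟨ε, fun v hv ↦ ?_⟩
  rw [← sum_smul_single v] at hv ⊢
  refine F.induction_of_eq_sum (fun i ↦ (Pi.single i 1 : ι → ℤ)) F.single_mem
    (fun v ↦ ∀ x ∈ weightVectors A h v, θ x = ((ε v).negOnePow : ℤ) • x) ?_ ?_ ?_ v hv
  · intro i
    rw [hε]
    exact hn i
  · intro i
    rw [map_neg, hε]
    exact hneg (F.single_mem i) (hn i)
  · intro u v hu hv huv _ _ hPu hPv x hx
    obtain ⟨y, hy, y', -, hy2⟩ := F.exists_sl2 v hv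
    have hy0 : y ≠ 0 := by
      rintro rfl
      rw [zero_lie] at hy2
      exact F.h_ne_zero hv hy2.symm
    obtain ⟨z, hz, rfl⟩ := F.exists_lie_eq hu hv huv hx hy hy0
    rw [LieEquiv.map_lie, hPu z hz, hPv y hy, map_add, Int.negOnePow_add, Units.val_mul, mul_smul,
      lie_zsmul, zsmul_lie, smul_comm]

/-- If `θ` fixes the Cartan subalgebra, and the roots on whose root vectors it acts trivially are
spanned by simple roots `γ`, then the fixed subalgebra is simple of level one. -/
theorem isComponent_of_isCharacter [FiniteDimensional ℂ 𝔤]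
    (hinv : ∀ x y z : 𝔤, B ⁅x, y⁆ z = B x ⁅y, z⁆) (hs : B.IsSymm) {V : Type*} [AddCommGroup V]
    [Module ℂ V] (R : AffineAlgebra 𝔤 B 1 V) {ε : (ι → ℤ) →ₗ[ℤ] ℤ}
    (hθ : ∀ v, θ (h v) = h v) (hε : IsCharacter A Φ h θ ε) (T : DynkinType)
    (hT : IsFiniteTypeMatrix T.cartanMatrix) (γ : Fin T.rank → ι → ℤ) (hγ : ∀ j, γ j ∈ Φ)
    (hγε : ∀ j, Even (ε (γ j)))
    (hγA : ∀ i j, latticeForm A (γ i) (γ j) = T.cartanMatrix i j)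
    (hspan : ∀ v, Even (ε v) → ∃ n : Fin T.rank → ℤ, v = ∑ j, n j • γ j) :
    R.IsComponent (fixedSubalgebra θ) T 1 := by
  choose e he f hf hef using fun j ↦ F.exists_sl2 _ (hγ j)
  have he0 : ∀ j, e j ≠ 0 := by
    intro j h0
    apply F.h_ne_zero (hγ j)
    rw [← hef, h0, zero_lie]
  have hf0 : ∀ j, f j ≠ 0 := by
    intro j h0
    apply F.h_ne_zero (hγ j)
    rw [← hef, h0, lie_zero]
  have hfix : ∀ {v x}, v ∈ Φ → Even (ε v) → x ∈ weightVectors A h v → θ x = x := by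
    intro v x hv hv' hx
    rw [hε v hv x hx, Int.negOnePow_even _ hv', Units.val_one, one_smul]
  have S : ChevalleySystem T.cartanMatrix (fun j ↦ h (γ j)) e f :=
    { h_ne_zero := fun j ↦ F.h_ne_zero (hγ j)
      lie_e_f := hef
      lie_e_f_ne := fun i j hij ↦ by
        refine F.eq_zero_of_norm ?_ (lie_mem_weightVectors (he i) (hf j))
        rw [← sub_eq_add_neg, F.norm_sub, F.norm_root _ (hγ i), F.norm_root _ (hγ j), hγA]
        have := hT.2.1 i j hij
        omega
      lie_h_h := fun i j ↦ F.lie_h_h _ _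
      lie_h_e := fun i j ↦ by rw [he i, hγA, Int.cast_smul_eq_zsmul]
      lie_h_f := fun i j ↦ by
        rw [hf i, neg_latticeForm_left, hγA, Int.cast_smul_eq_zsmul] }
  have hS : fixedSubalgebra θ = S.subalgebra := by
    apply le_antisymm
    · have key : ∀ v ∈ Φ, Even (ε v) → weightVectors A h v ≤ S.subalgebra.toSubmodule := by
        intro v hv hεv
        obtain ⟨n, rfl⟩ := hspan v hεv
        refine F.induction_of_eq_sum γ hγ
          (fun v ↦ weightVectors A h v ≤ S.subalgebra.toSubmodule) ?_ ?_ ?_ n hv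
        · intro j x hx
          obtain ⟨c, rfl⟩ := F.exists_smul _ (hγ j) x hx _ (he j) (he0 j)
          exact Submodule.smul_mem _ _ (S.e_mem j)
        · intro j x hx
          obtain ⟨c, rfl⟩ := F.exists_smul _ (F.neg_mem (hγ j)) x hx _ (hf j) (hf0 j)
          exact Submodule.smul_mem _ _ (S.f_mem j)
        · intro u v hu hv huv _ _ hPu hPv x hx
          obtain ⟨y, hy, y', -, hy2⟩ := F.exists_sl2 v hv
          have hy0 : y ≠ 0 := by
            rintro rfl
            rw [zero_lie] at hy2
            exact F.h_ne_zero hv hy2.symm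
          obtain ⟨z, hz, rfl⟩ := F.exists_lie_eq hu hv huv hx hy hy0
          exact S.subalgebra.lie_mem (hPu hz) (hPv hy)
      intro x hx
      let K : Submodule ℂ 𝔤 := S.subalgebra.toSubmodule.comap (LinearMap.id + (θ : 𝔤 →ₗ[ℂ] 𝔤))
      have h1 : K = ⊤ := by
        refine F.span K (fun v ↦ ?_) fun v hv x hx ↦ ?_
        · change h v + θ (h v) ∈ S.subalgebra
          rw [hθ, ← two_zsmul, ← map_zsmul]
          -- Twice any lattice vector has even parity, so twice every coroot, hence every coroot,
          -- lies in the subalgebra.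
          obtain ⟨n, hn⟩ := hspan ((2 : ℤ) • v) (by rw [map_smul]; exact even_two.mul_right _)
          rw [hn, map_sum]
          refine sum_mem fun j _ ↦ ?_
          rw [map_zsmul]
          exact zsmul_mem (S.h_mem j) _
        · change x + θ x ∈ S.subalgebra
          rcases Int.even_or_odd (ε v) with hεv | hεv
          · have h2 : x ∈ S.subalgebra := key v hv hεv hx
            rw [hfix hv hεv hx]
            exact add_mem h2 h2
          · rw [hε v hv x hx, Int.negOnePow_odd _ hεv, Units.val_neg, Units.val_one, neg_smul,
              one_smul, add_neg_cancel]
            exact zero_mem _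
      have h2 : x ∈ K := by rw [h1]; trivial
      have h3 : x + θ x ∈ S.subalgebra := h2
      rw [mem_fixedSubalgebra.mp hx, ← two_smul ℂ] at h3
      have := S.subalgebra.smul_mem (2⁻¹ : ℂ) h3
      rwa [smul_smul, inv_mul_cancel₀ two_ne_zero, one_smul] at this
    · refine LieSubalgebra.lieSpan_le.mpr ?_
      rintro _ (⟨j, rfl⟩ | ⟨j, rfl⟩)
      · exact hfix (hγ j) (hγε j) (he j)
      · exact hfix (F.neg_mem (hγ j)) (by rw [map_neg, even_neg]; exact hγε j) (hf j)
  rw [hS]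
  refine S.isComponent R hT hinv hs T (Equiv.refl _) (fun _ _ ↦ rfl) 1 one_ne_zero fun i _ ↦ ?_
  rw [F.form_h, F.norm_root _ (hγ i)]
  norm_num

end SimplyLacedFrame

end Character

/-! ### Certified roots and orthogonal systems of full rank -/

section RootStrings

variable {ι : Type*} [Fintype ι] [DecidableEq ι] {𝔤 : Type*} [LieRing 𝔤] [LieAlgebra ℂ 𝔤]
  {A : Matrix ι ι ℤ} {B : LinearMap.BilinForm ℂ 𝔤} {Φ : Set (ι → ℤ)} {h : (ι → ℤ) →ₗ[ℤ] 𝔤}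

/-- Adds simple roots to `v`, one after the other, if each sum is again a root. -/
def addRoots (A : Matrix ι ι ℤ) : List ι → (ι → ℤ) → Option (ι → ℤ)
  | [], v => some v
  | i :: l, v => if ∑ j, A i j * v j = -1 then addRoots A l (v + Pi.single i 1) else none

theorem latticeForm_single_left (A : Matrix ι ι ℤ) (i : ι) (v : ι → ℤ) :
    latticeForm A (Pi.single i 1) v = ∑ j, A i j * v j := by
  rw [latticeForm_apply, single_dotProduct, one_mul]
  rfl

theorem foldl_twistBy (l : List (ι → ℤ)) (σ : (ι → ℤ) →ₗ[ℤ] (ι → ℤ)) (v : ι → ℤ) :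
    l.foldl (twistBy A) σ v = σ v + (l.map fun β ↦ latticeForm A β v • β).sum := by
  induction l generalizing σ with
  | nil => simp
  | cons β l ih => rw [List.foldl_cons, ih, twistBy_apply, List.map_cons, List.sum_cons, add_assoc]

theorem foldl_add_latticeForm (l : List ((ι → ℤ) × ℤ)) (ε : (ι → ℤ) →ₗ[ℤ] ℤ) (v : ι → ℤ) :
    l.foldl (fun ε p ↦ ε + p.2 • latticeForm A p.1) ε v =
      ε v + (l.map fun p ↦ p.2 * latticeForm A p.1 v).sum := by
  induction l generalizing ε with
  | nil => simp
  | cons p l ih =>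
    rw [List.foldl_cons, ih, List.map_cons, List.sum_cons, LinearMap.add_apply,
      LinearMap.smul_apply, smul_eq_mul, add_assoc]

namespace SimplyLacedFrame

variable (F : SimplyLacedFrame A B Φ h)
include F

theorem add_mem {u v : ι → ℤ} (hu : u ∈ Φ) (hv : v ∈ Φ) (huv : latticeForm A u v = -1) :
    u + v ∈ Φ := by
  have := F.reflect u hu v hv
  rw [latticeForm_comm F.symm, huv] at this
  convert this using 1
  module

theorem mem_of_addRoots (l : List ι) {v w : ι → ℤ} (hv : v ∈ Φ) (hw : addRoots A l v = some w) :
    w ∈ Φ := by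
  induction l generalizing v with
  | nil =>
    rw [addRoots, Option.some_inj] at hw
    rwa [← hw]
  | cons i l ih =>
    rw [addRoots] at hw
    split_ifs at hw with hi
    refine ih ?_ hw
    refine F.add_mem hv (F.single_mem i) ?_
    rw [latticeForm_comm F.symm, latticeForm_single_left, hi]

theorem mem_of_addRoots_single (i : ι) (l : List ι) {w : ι → ℤ}
    (hw : addRoots A l (Pi.single i 1) = some w) : w ∈ Φ :=
  F.mem_of_addRoots l (F.single_mem i) hw

/-- If there are enough orthogonal roots, then an inverting involution is conjugate to an involution
that fixes the Cartan subalgebra. -/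
theorem exists_isCharacter_of_orthogonal (hinv : ∀ x y z : 𝔤, B ⁅x, y⁆ z = B x ⁅y, z⁆)
    {θ : 𝔤 ≃ₗ⁅ℂ⁆ 𝔤} (hθ : ∀ v, θ (h v) = -h v) (l : List (ι → ℤ)) (hl : ∀ β ∈ l, β ∈ Φ)
    (horth : l.Pairwise fun β γ ↦ latticeForm A β γ = 0)
    (hsum : ∀ i, (l.map fun β ↦ latticeForm A β (Pi.single i 1) • β).sum = Pi.single i 2) :
    ∃ h' : (ι → ℤ) →ₗ[ℤ] 𝔤, SimplyLacedFrame A B Φ h' ∧ (∀ v, θ (h' v) = h' v) ∧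
      ∃ ε, IsCharacter A Φ h' θ ε ∧ ∀ β ∈ l, Odd (ε β) := by
  have T : IsTwist A h θ (-LinearMap.id) :=
    ⟨fun v ↦ by rw [hθ]; simp, fun u v ↦ by simp, F.involutive hθ⟩
  obtain ⟨h', F', T', hm, -⟩ := F.exists_cayley_list hinv T l hl (fun _ _ ↦ by simp) horth
  -- Orthogonal roots of full rank satisfy `∑ (β, v) β = 2 v`, so `-v` has been turned into `v`.
  have h1 : l.foldl (twistBy A) (-LinearMap.id) = LinearMap.id := by
    refine LinearMap.pi_ext' fun i ↦ LinearMap.ext_ring ?_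
    change l.foldl (twistBy A) (-LinearMap.id) (Pi.single i 1) = Pi.single i 1
    rw [foldl_twistBy, hsum]
    ext j
    rcases eq_or_ne i j with rfl | hij <;> simp [*]
  have hθ' : ∀ v, θ (h' v) = h' v := fun v ↦ by rw [T'.map_h, h1]; rfl
  obtain ⟨ε, hε⟩ := F'.exists_isCharacter hθ' T'.map_map
  refine ⟨h', F', hθ', ε, hε, fun β hβ ↦ ?_⟩
  obtain ⟨e, he, f, -, hef⟩ := F'.exists_sl2 β (hl β hβ)
  have he0 : e ≠ 0 := by
    rintro rfl
    rw [zero_lie] at hef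
    exact F'.h_ne_zero (hl β hβ) hef.symm
  by_contra hodd
  have h2 := hm β hβ e he
  rw [hε β (hl β hβ) e he, Int.negOnePow_even _ (Int.not_odd_iff_even.mp hodd), Units.val_one,
    one_smul] at h2
  have h3 : (2 : ℂ) • e = 0 := by linear_combination (norm := module) h2
  exact he0 ((smul_eq_zero.mp h3).resolve_left two_ne_zero)

end SimplyLacedFrame

end RootStrings

/-! ### The type `E₇` -/

section ExceptionalSeven

/-- The highest root of `E₇`. -/
def highestRootSeven : Fin 7 → ℤ := ![2, 2, 3, 4, 3, 2, 1]

/-- Orthogonal roots of `E₇` in which the coefficient of the second simple root is odd. -/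
def orthogonalRootsSeven : List (Fin 7 → ℤ) :=
  [![0, 1, 0, 0, 0, 0, 0], ![0, 1, 1, 2, 1, 0, 0], ![1, 1, 1, 2, 1, 1, 0], ![1, 1, 2, 2, 2, 1, 0],
    ![1, 1, 1, 2, 2, 1, 1], ![0, 1, 1, 2, 2, 2, 1], ![1, 1, 2, 2, 1, 1, 1]]

/-- Simple roots of a subsystem of type `A₇` of `E₇`. -/
def simpleRootsSeven : Fin 7 → Fin 7 → ℤ :=
  ![-highestRootSeven, Pi.single 0 1, Pi.single 2 1, Pi.single 3 1, Pi.single 4 1, Pi.single 5 1,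
    Pi.single 6 1]

variable {𝔤 : Type*} [LieRing 𝔤] [LieAlgebra ℂ 𝔤] {B : LinearMap.BilinForm ℂ 𝔤}
  {Φ : Set (Fin 7 → ℤ)} {h : (Fin 7 → ℤ) →ₗ[ℤ] 𝔤}

theorem isFiniteTypeMatrix_A_seven : IsFiniteTypeMatrix (CartanMatrix.A 7) :=
  ⟨by decide, CartanMatrix.A_apply_le_zero_of_ne 7, ![7, 12, 15, 16, 15, 12, 7], by decide,
    by decide⟩

/-- Seven orthogonal roots make `θ` act by signs. After normalization the sign is the parity of the
coefficient of `α₂`, which is 2 in the highest root. Deleting this node from the extended diagram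
leaves `A₇`. -/
theorem SimplyLacedFrame.isComponent_seven [FiniteDimensional ℂ 𝔤]
    (F : SimplyLacedFrame CartanMatrix.E₇ B Φ h) (hinv : ∀ x y z : 𝔤, B ⁅x, y⁆ z = B x ⁅y, z⁆)
    (hs : B.IsSymm) {V : Type*} [AddCommGroup V] [Module ℂ V] (R : AffineAlgebra 𝔤 B 1 V)
    {θ : 𝔤 ≃ₗ⁅ℂ⁆ 𝔤} (hθ : ∀ v, θ (h v) = -h v) :
    R.IsComponent (fixedSubalgebra θ) (.A 7) 1 := by
  have hmem : ∀ β ∈ orthogonalRootsSeven, β ∈ Φ := by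
    simp only [orthogonalRootsSeven, List.forall_mem_cons, List.not_mem_nil, false_imp_iff,
      implies_true, and_true]
    exact ⟨F.mem_of_addRoots_single 1 [] (by decide),
      F.mem_of_addRoots_single 1 [3, 2, 4, 3] (by decide),
      F.mem_of_addRoots_single 1 [3, 2, 0, 4, 3, 5] (by decide),
      F.mem_of_addRoots_single 1 [3, 2, 0, 4, 3, 2, 5, 4] (by decide),
      F.mem_of_addRoots_single 1 [3, 2, 0, 4, 3, 5, 4, 6] (by decide),
      F.mem_of_addRoots_single 1 [3, 2, 4, 3, 5, 4, 6, 5] (by decide),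
      F.mem_of_addRoots_single 1 [3, 2, 0, 4, 3, 2, 5, 6] (by decide)⟩
  have horth : orthogonalRootsSeven.Pairwise fun β γ ↦ latticeForm CartanMatrix.E₇ β γ = 0 := by
    simp only [latticeForm_apply]
    decide
  obtain ⟨h', F', hθ', ε, hε, hodd⟩ := F.exists_isCharacter_of_orthogonal hinv hθ
    orthogonalRootsSeven hmem horth (by simp only [latticeForm_apply]; decide)
  let a : Fin 7 → ℤ := fun i ↦ ε (Pi.single i 1)
  -- The exponents solve a linear system modulo 2: corrected by the corresponding multiples of `(β,
  -- ·)`, the character becomes odd on `α₂` and even on the other simple roots. The solution uses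
  -- that `ε` is odd on all seven roots.
  let l : List ((Fin 7 → ℤ) × ℤ) := [(![0, 1, 0, 0, 0, 0, 0], a 0 + a 3),
    (![0, 1, 1, 2, 1, 0, 0], a 0 + a 2), (![1, 1, 1, 2, 1, 1, 0], a 2)]
  simp only [orthogonalRootsSeven, List.forall_mem_cons, List.not_mem_nil, false_imp_iff,
    implies_true, and_true] at hodd hmem
  obtain ⟨h'', F'', hθ'', hε''⟩ := F'.exists_reflect_list hθ' hε l
    (by simp [l, hmem.1, hmem.2.1, hmem.2.2.1]) (by simp [l, hodd.1, hodd.2.1, hodd.2.2.1])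
    (by simp only [l, latticeForm_apply, List.pairwise_cons, List.forall_mem_cons,
          List.not_mem_nil, false_imp_iff, implies_true, and_true, List.Pairwise.nil]
        decide)
  have hpar : IsCharacter CartanMatrix.E₇ Φ h'' θ (LinearMap.proj 1) := by
    refine hε''.congr fun i ↦ ?_
    have e0 : ∀ i, latticeForm CartanMatrix.E₇ ![0, 1, 0, 0, 0, 0, 0] (Pi.single i 1) =
      ![0, 2, 0, -1, 0, 0, 0] i := by simp only [latticeForm_apply]; decide
    have e1 : ∀ i, latticeForm CartanMatrix.E₇ ![0, 1, 1, 2, 1, 0, 0] (Pi.single i 1) =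
      ![-1, 0, 0, 1, 0, -1, 0] i := by simp only [latticeForm_apply]; decide
    have e2 : ∀ i, latticeForm CartanMatrix.E₇ ![1, 1, 1, 2, 1, 1, 0] (Pi.single i 1) =
      ![1, 0, -1, 1, -1, 1, -1] i := by simp only [latticeForm_apply]; decide
    have hp : ∀ j : Fin 7, ε (Pi.single j 1) = a j := fun _ ↦ rfl
    rw [foldl_add_latticeForm]
    simp only [l, List.map_cons, List.map_nil, List.sum_cons, List.sum_nil, e0, e1, e2, hp,
      LinearMap.proj_apply, Pi.single_apply]
    have hsum : ∀ v, ε v = ∑ j, v j * a j := linearMap_apply_eq_sum ε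
    simp only [hsum, Fin.sum_univ_seven, Matrix.cons_val] at hodd
    rw [Int.even_iff]
    simp only [Int.odd_iff] at hodd
    fin_cases i <;> simp <;> omega
  refine F''.isComponent_of_isCharacter hinv hs R hθ'' hpar (.A 7) isFiniteTypeMatrix_A_seven
    simpleRootsSeven ?_ ?_ ?_ ?_
  · have h1 : highestRootSeven ∈ Φ := F.mem_of_addRoots_single 1
      [3, 2, 0, 4, 3, 2, 5, 4, 3, 1, 6, 5, 4, 3, 2, 0] (by decide)
    intro j
    fin_cases j
    · exact F.neg_mem h1
    all_goals exact F.single_mem _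
  · intro j
    rw [LinearMap.proj_apply]
    revert j
    decide
  · simp only [latticeForm_apply]
    have h1 : ∀ p : Fin 7 × Fin 7, simpleRootsSeven p.1 ⬝ᵥ
        CartanMatrix.E₇.mulVec (simpleRootsSeven p.2) = CartanMatrix.A 7 p.1 p.2 := by decide
    exact fun i j ↦ h1 (i, j)
  · rintro v ⟨c, hc⟩
    -- The highest root has coefficient 2 at `α₂`, so `v 1 = 2c` fixes its multiple; the remaining
    -- coordinates are those of `v - c • highestRootSeven`.
    refine ⟨![-c, v 0 - 2 * c, v 2 - 3 * c, v 3 - 4 * c, v 4 - 3 * c, v 5 - 2 * c, v 6 - c], ?_⟩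
    have hc' : v 1 = c + c := hc
    refine Eq.trans ?_ (Fin.sum_univ_seven _).symm
    ext i
    simp only [simpleRootsSeven, highestRootSeven, Pi.add_apply, Pi.smul_apply, Matrix.cons_val,
      Pi.neg_apply, smul_eq_mul]
    fin_cases i <;> simp [hc'] <;> ring

end ExceptionalSeven

/-! ### The type `E₈` -/

section ExceptionalEight

/-- The highest root of `E₈`. -/
def highestRootEight : Fin 8 → ℤ := ![2, 3, 4, 6, 5, 4, 3, 2]

/-- Orthogonal roots of `E₈` in which the coefficient of the first simple root is odd. -/
def orthogonalRootsEight : List (Fin 8 → ℤ) :=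
  [![1, 0, 0, 0, 0, 0, 0, 0], ![1, 1, 2, 2, 1, 0, 0, 0], ![1, 1, 2, 2, 2, 2, 1, 0],
    ![1, 1, 2, 3, 2, 2, 1, 1], ![1, 2, 2, 3, 2, 2, 2, 1], ![1, 2, 2, 4, 3, 2, 1, 0],
    ![1, 1, 2, 3, 3, 2, 2, 1], ![1, 2, 2, 3, 3, 2, 1, 1]]

/-- Simple roots of a subsystem of type `D₈` of `E₈`. -/
def simpleRootsEight : Fin 8 → Fin 8 → ℤ :=
  ![-highestRootEight, Pi.single 7 1, Pi.single 6 1, Pi.single 5 1, Pi.single 4 1, Pi.single 3 1,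
    Pi.single 1 1, Pi.single 2 1]

variable {𝔤 : Type*} [LieRing 𝔤] [LieAlgebra ℂ 𝔤] {B : LinearMap.BilinForm ℂ 𝔤}
  {Φ : Set (Fin 8 → ℤ)} {h : (Fin 8 → ℤ) →ₗ[ℤ] 𝔤}

/-- The same argument with eight orthogonal roots and the node `α₁`, whose coefficient in the
highest root is 2. Deleting it from the extended diagram leaves `D₈`. -/
theorem SimplyLacedFrame.isComponent_eight [FiniteDimensional ℂ 𝔤]
    (F : SimplyLacedFrame CartanMatrix.E₈ B Φ h) (hinv : ∀ x y z : 𝔤, B ⁅x, y⁆ z = B x ⁅y, z⁆)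
    (hs : B.IsSymm) {V : Type*} [AddCommGroup V] [Module ℂ V] (R : AffineAlgebra 𝔤 B 1 V)
    {θ : 𝔤 ≃ₗ⁅ℂ⁆ 𝔤} (hθ : ∀ v, θ (h v) = -h v) :
    R.IsComponent (fixedSubalgebra θ) (.D 8) 1 := by
  have hmem : ∀ β ∈ orthogonalRootsEight, β ∈ Φ := by
    simp only [orthogonalRootsEight, List.forall_mem_cons, List.not_mem_nil, false_imp_iff,
      implies_true, and_true]
    exact ⟨F.mem_of_addRoots_single 0 [] (by decide),
      F.mem_of_addRoots_single 2 [0, 3, 1, 4, 3, 2] (by decide),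
      F.mem_of_addRoots_single 2 [0, 3, 1, 4, 3, 2, 5, 4, 6, 5] (by decide),
      F.mem_of_addRoots_single 2 [0, 3, 1, 4, 3, 2, 5, 4, 3, 6, 5, 7] (by decide),
      F.mem_of_addRoots_single 2 [0, 3, 1, 4, 3, 2, 5, 4, 3, 1, 6, 5, 7, 6] (by decide),
      F.mem_of_addRoots_single 2 [0, 3, 1, 4, 3, 2, 5, 4, 3, 1, 6, 5, 4, 3] (by decide),
      F.mem_of_addRoots_single 2 [0, 3, 1, 4, 3, 2, 5, 4, 3, 6, 5, 4, 7, 6] (by decide),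
      F.mem_of_addRoots_single 2 [0, 3, 1, 4, 3, 2, 5, 4, 3, 1, 6, 5, 4, 7] (by decide)⟩
  have horth : orthogonalRootsEight.Pairwise fun β γ ↦ latticeForm CartanMatrix.E₈ β γ = 0 := by
    simp only [latticeForm_apply]
    decide
  obtain ⟨h', F', hθ', ε, hε, hodd⟩ := F.exists_isCharacter_of_orthogonal hinv hθ
    orthogonalRootsEight hmem horth (by simp only [latticeForm_apply]; decide)
  let a : Fin 8 → ℤ := fun i ↦ ε (Pi.single i 1)
  -- Again a solution modulo 2, here moving `ε` to the parity of the coefficient of `α₁`.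
  let l : List ((Fin 8 → ℤ) × ℤ) := [(![1, 0, 0, 0, 0, 0, 0, 0], a 1 + a 2 + a 5),
    (![1, 1, 2, 2, 1, 0, 0, 0], a 3 + a 5), (![1, 1, 2, 2, 2, 2, 1, 0], a 1 + a 3),
    (![1, 1, 2, 3, 2, 2, 1, 1], a 1)]
  simp only [orthogonalRootsEight, List.forall_mem_cons, List.not_mem_nil, false_imp_iff,
    implies_true, and_true] at hodd hmem
  obtain ⟨h'', F'', hθ'', hε''⟩ := F'.exists_reflect_list hθ' hε l
    (by simp [l, hmem.1, hmem.2.1, hmem.2.2.1, hmem.2.2.2.1])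
    (by simp [l, hodd.1, hodd.2.1, hodd.2.2.1, hodd.2.2.2.1])
    (by simp only [l, latticeForm_apply, List.pairwise_cons, List.forall_mem_cons,
          List.not_mem_nil, false_imp_iff, implies_true, and_true, List.Pairwise.nil]
        decide)
  have hpar : IsCharacter CartanMatrix.E₈ Φ h'' θ (LinearMap.proj 0) := by
    refine hε''.congr fun i ↦ ?_
    have e0 : ∀ i, latticeForm CartanMatrix.E₈ ![1, 0, 0, 0, 0, 0, 0, 0] (Pi.single i 1) =
      ![2, 0, -1, 0, 0, 0, 0, 0] i := by simp only [latticeForm_apply]; decide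
    have e1 : ∀ i, latticeForm CartanMatrix.E₈ ![1, 1, 2, 2, 1, 0, 0, 0] (Pi.single i 1) =
      ![0, 0, 1, 0, 0, -1, 0, 0] i := by simp only [latticeForm_apply]; decide
    have e2 : ∀ i, latticeForm CartanMatrix.E₈ ![1, 1, 2, 2, 2, 2, 1, 0] (Pi.single i 1) =
      ![0, 0, 1, -1, 0, 1, 0, -1] i := by simp only [latticeForm_apply]; decide
    have e3 : ∀ i, latticeForm CartanMatrix.E₈ ![1, 1, 2, 3, 2, 2, 1, 1] (Pi.single i 1) =
      ![0, -1, 0, 1, -1, 1, -1, 1] i := by simp only [latticeForm_apply]; decide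
    have hp : ∀ j : Fin 8, ε (Pi.single j 1) = a j := fun _ ↦ rfl
    rw [foldl_add_latticeForm]
    simp only [l, List.map_cons, List.map_nil, List.sum_cons, List.sum_nil, e0, e1, e2, e3, hp,
      LinearMap.proj_apply, Pi.single_apply]
    have hsum : ∀ v, ε v = ∑ j, v j * a j := linearMap_apply_eq_sum ε
    simp only [hsum, Fin.sum_univ_eight, Matrix.cons_val] at hodd
    rw [Int.even_iff]
    simp only [Int.odd_iff] at hodd
    fin_cases i <;> simp <;> omega
  refine F''.isComponent_of_isCharacter hinv hs R hθ'' hpar (.D 8)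
    (isFiniteTypeMatrix_D 8 (by norm_num)) simpleRootsEight ?_ ?_ ?_ ?_
  · have h1 : highestRootEight ∈ Φ := F.mem_of_addRoots_single 2
      [0, 3, 1, 4, 3, 2, 5, 4, 3, 1, 6, 5, 4, 3, 2, 0, 7, 6, 5, 4, 3, 1, 2, 3, 4, 5, 6, 7]
      (by decide)
    intro j
    fin_cases j
    · exact F.neg_mem h1
    all_goals exact F.single_mem _
  · intro j
    rw [LinearMap.proj_apply]
    revert j
    decide
  · simp only [latticeForm_apply]
    have h1 : ∀ p : Fin 8 × Fin 8, simpleRootsEight p.1 ⬝ᵥ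
        CartanMatrix.E₈.mulVec (simpleRootsEight p.2) = CartanMatrix.D 8 p.1 p.2 := by decide
    exact fun i j ↦ h1 (i, j)
  · rintro v ⟨c, hc⟩
    refine ⟨![-c, v 7 - 2 * c, v 6 - 3 * c, v 5 - 4 * c, v 4 - 5 * c, v 3 - 6 * c, v 1 - 3 * c,
      v 2 - 4 * c], ?_⟩
    have hc' : v 0 = c + c := hc
    refine Eq.trans ?_ (Fin.sum_univ_eight _).symm
    ext i
    simp only [simpleRootsEight, highestRootEight, Pi.add_apply, Pi.smul_apply, Matrix.cons_val,
      Pi.neg_apply, smul_eq_mul]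
    fin_cases i <;> simp [hc'] <;> ring

end ExceptionalEight

/-! ### Involutions that permute the simple roots -/

section Folding

variable {ι : Type*} [Fintype ι] [DecidableEq ι] {𝔤 : Type*} [LieRing 𝔤] [LieAlgebra ℂ 𝔤]
  {A : Matrix ι ι ℤ} {B : LinearMap.BilinForm ℂ 𝔤} {Φ : Set (ι → ℤ)} {h : (ι → ℤ) →ₗ[ℤ] 𝔤}
  {θ : 𝔤 ≃ₗ⁅ℂ⁆ 𝔤} {σ : (ι → ℤ) →ₗ[ℤ] (ι → ℤ)}

/-- The linear map `x ↦ x + θ x`. -/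
def orbitSum (θ : 𝔤 ≃ₗ⁅ℂ⁆ 𝔤) : 𝔤 →ₗ[ℂ] 𝔤 := LinearMap.id + (θ : 𝔤 →ₗ[ℂ] 𝔤)

theorem orbitSum_apply (x : 𝔤) : orbitSum θ x = x + θ x := rfl

namespace IsTwist

variable (T : IsTwist A h θ σ)
include T

theorem orbitSum_map (x : 𝔤) : orbitSum θ (θ x) = orbitSum θ x := by
  rw [orbitSum_apply, orbitSum_apply, T.map_map, add_comm]

theorem map_orbitSum (x : 𝔤) : θ (orbitSum θ x) = orbitSum θ x := by
  have h1 : θ (x + θ x) = θ x + θ (θ x) := map_add θ _ _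
  rw [orbitSum_apply, h1, T.map_map, add_comm]

theorem lie_orbitSum (x y : 𝔤) : ⁅orbitSum θ x, orbitSum θ y⁆ = orbitSum θ (⁅x, y⁆ + ⁅x, θ y⁆) := by
  have h1 : θ (⁅x, y⁆ + ⁅x, θ y⁆) = ⁅θ x, θ y⁆ + ⁅θ x, y⁆ := by
    have := map_add θ ⁅x, y⁆ ⁅x, θ y⁆
    refine this.trans ?_
    rw [LieEquiv.map_lie, LieEquiv.map_lie, T.map_map]
  rw [orbitSum_apply (⁅x, y⁆ + ⁅x, θ y⁆), h1, orbitSum_apply, orbitSum_apply, lie_add, add_lie,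
    add_lie]
  abel

theorem orbitSum_h (v : ι → ℤ) : orbitSum θ (h v) = h (v + σ v) := by
  rw [orbitSum_apply, T.map_h, map_add]

theorem lie_orbitSum_h {v w : ι → ℤ} {x : 𝔤} (hx : x ∈ weightVectors A h w) :
    ⁅orbitSum θ (h v), orbitSum θ x⁆ = (latticeForm A w (v + σ v) : ℂ) • orbitSum θ x := by
  rw [← lie_skew, T.lie_orbitSum, T.map_h, ← lie_add, ← map_add, ← lie_skew, hx, map_neg, neg_neg,
    map_smul]

end IsTwist

namespace SimplyLacedFrame

variable (F : SimplyLacedFrame A B Φ h) (T : IsTwist A h θ σ)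
include F

theorem exists_ne_zero_mem {v : ι → ℤ} (hv : v ∈ Φ) : ∃ y ∈ weightVectors A h v, y ≠ 0 := by
  obtain ⟨e, he, f, -, hef⟩ := F.exists_sl2 v hv
  refine ⟨e, he, ?_⟩
  rintro rfl
  rw [zero_lie] at hef
  exact F.h_ne_zero hv hef.symm

include T

theorem twist_mem {v : ι → ℤ} (hv : v ∈ Φ) : σ v ∈ Φ := by
  by_contra hσ
  obtain ⟨e, he, he0⟩ := F.exists_ne_zero_mem hv
  have hσ0 : σ v ≠ 0 := by
    intro h0
    have h1 := T.map_h v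
    rw [h0, map_zero] at h1
    have h2 : θ (h v) = θ 0 := h1.trans (map_zero θ).symm
    exact F.h_ne_zero hv (θ.injective h2)
  have h1 := F.eq_zero _ hσ hσ0 _ (T.map_mem he)
  have h2 : θ e = θ 0 := h1.trans (map_zero θ).symm
  exact he0 (θ.injective h2)

/-- The map `σ²` does not change `h`, and `B` on coroots reproduces the lattice form; injectivity of
`h` is not needed. -/
theorem latticeForm_twist (u v : ι → ℤ) :
    latticeForm A (σ u) (σ v) = latticeForm A u v := by
  have h1 : h (σ (σ v)) = h v := by rw [← T.map_h, ← T.map_h, T.map_map]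
  have h2 := F.form_h u (σ (σ v))
  rw [h1, F.form_h] at h2
  rw [T.symm]
  exact_mod_cast h2.symm

theorem latticeForm_add_twist (u v : ι → ℤ) :
    latticeForm A (u + σ u) (v + σ v) = 2 * latticeForm A u (v + σ v) := by
  simp only [map_add, LinearMap.add_apply, T.symm u v, F.latticeForm_twist T]
  ring

/-- Otherwise `(v, -σ v) ≥ 2`, whereas distinct roots pair to at most 1. -/
theorem norm_add_twist_pos {v : ι → ℤ} (hv : v ∈ Φ) (hne : σ v ≠ -v) :
    0 < latticeForm A (v + σ v) (v + σ v) := by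
  rw [F.latticeForm_add_twist T, map_add, F.norm_root v hv]
  by_contra! hle
  have h1 := F.eq_one_of_pos hv (F.neg_mem (F.twist_mem T hv)) (by rw [map_neg]; omega)
    (fun h ↦ hne (by rw [h, neg_neg, ← h]))
  rw [map_neg] at h1
  omega

/-- One step of the generation of the fixed points of `θ` by root vectors. -/
theorem orbitSum_mem_of_sub {S : LieSubalgebra ℂ 𝔤} {v g : ι → ℤ} (hv : v ∈ Φ) (hg : g ∈ Φ)
    (hg' : latticeForm A g (σ g) = 0 ∨ σ g = g ∧ ∀ x ∈ weightVectors A h g, θ x = x)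
    (hvg : 0 < latticeForm A v g) (hvσ : 0 < latticeForm A v (g + σ g)) (hne : v ≠ g)
    (hS : ∀ y ∈ weightVectors A h g, orbitSum θ y ∈ S)
    (hS' : ∀ z ∈ weightVectors A h (v - g), orbitSum θ z ∈ S) {x : 𝔤}
    (hx : x ∈ weightVectors A h v) : orbitSum θ x ∈ S := by
  have h1 := F.eq_one_of_pos hv hg hvg hne
  have hu := F.sub_mem v hv g hg hvg hne
  have hug : latticeForm A (v - g) g = -1 := by
    rw [map_sub, LinearMap.sub_apply, h1, F.norm_root g hg]; norm_num
  obtain ⟨y, hy, hy0⟩ := F.exists_ne_zero_mem hg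
  obtain ⟨z, hz, rfl⟩ := F.exists_lie_eq hu hg hug (by rwa [sub_add_cancel]) hy hy0
  have h2 := S.lie_mem (hS' z hz) (hS y hy)
  rw [T.lie_orbitSum] at h2
  rcases hg' with h3 | ⟨-, h3⟩
  · have h4 : ⁅z, θ y⁆ = 0 := by
      refine F.eq_zero_of_norm ?_ (lie_mem_weightVectors hz (T.map_mem hy))
      rw [F.norm_add, F.norm_root _ hu, F.norm_root _ (F.twist_mem T hg), map_sub,
        LinearMap.sub_apply, h3]
      rw [map_add] at hvσ
      omega
    rwa [h4, add_zero] at h2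
  · rw [h3 y hy, ← two_smul ℂ, map_smul] at h2
    have := S.smul_mem (2⁻¹ : ℂ) h2
    rwa [smul_smul, inv_mul_cancel₀ two_ne_zero, one_smul] at this

/-- The folded version of `induction_of_eq_sum`. -/
theorem orbitSum_mem {S : LieSubalgebra ℂ 𝔤} (hne : ∀ v ∈ Φ, σ v ≠ -v) {κ : Type*} [Fintype κ]
    (γ : κ → ι → ℤ) (hγ : ∀ j, γ j ∈ Φ)
    (hγ' : ∀ j, latticeForm A (γ j) (σ (γ j)) = 0 ∨
      σ (γ j) = γ j ∧ (∀ x ∈ weightVectors A h (γ j), θ x = x) ∧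
        ∀ x ∈ weightVectors A h (-γ j), θ x = x)
    (hpos : ∀ j, ∀ y ∈ weightVectors A h (γ j), orbitSum θ y ∈ S)
    (hneg : ∀ j, ∀ y ∈ weightVectors A h (-γ j), orbitSum θ y ∈ S)
    {v : ι → ℤ} (hv : v ∈ Φ) (n : κ → ℤ) (hn : v + σ v = ∑ j, n j • (γ j + σ (γ j))) {x : 𝔤}
    (hx : x ∈ weightVectors A h v) : orbitSum θ x ∈ S := by
  classical
  induction hN : ∑ j, (n j).natAbs using Nat.strong_induction_on generalizing n v x with
  | _ N ih =>
  subst hN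
  -- The norm of `v + σ v` is positive, so some `±γ j` has a symmetrization pairing positively with
  -- `v`. Either this root or its image under `σ` can then be subtracted from `v`.
  have h1 : 0 < ∑ j, n j * latticeForm A v (γ j + σ (γ j)) := by
    have h2 := F.norm_add_twist_pos T hv (hne v hv)
    rw [F.latticeForm_add_twist T, hn, map_sum] at h2
    simp only [map_smul, smul_eq_mul] at h2
    omega
  obtain ⟨j, -, hj⟩ := Finset.exists_lt_of_sum_lt (s := Finset.univ) (f := fun _ ↦ (0 : ℤ))
    (by simpa using h1)
  obtain ⟨s, hs, hsv, hsn⟩ : ∃ s : ℤ, (s = 1 ∨ s = -1) ∧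
      0 < latticeForm A v (s • γ j + σ (s • γ j)) ∧ 0 < s * n j := by
    rcases pos_and_pos_or_neg_and_neg_of_mul_pos hj with ⟨h3, h4⟩ | ⟨h3, h4⟩
    · exact ⟨1, .inl rfl, by simpa using h4, by simpa using h3⟩
    · refine ⟨-1, .inr rfl, ?_, by simpa using h3⟩
      have h5 : (-1 : ℤ) • γ j + σ ((-1 : ℤ) • γ j) = -(γ j + σ (γ j)) := by
        rw [map_smul, ← smul_add, neg_one_smul]
      rw [h5, map_neg, map_add]
      omega
  have hstep : ∀ w : ι → ℤ, w ∈ Φ → w + σ w = v + σ v - (s • γ j + σ (s • γ j)) →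
      ∀ z ∈ weightVectors A h w, orbitSum θ z ∈ S := by
    intro w hw hwv z hz
    have h5 : w + σ w = ∑ k, (n k - if k = j then s else 0) • (γ k + σ (γ k)) := by
      simp only [sub_smul, Finset.sum_sub_distrib, ite_smul, zero_smul, Finset.sum_ite_eq',
        Finset.mem_univ, if_true]
      rw [hwv, hn, map_smul, ← smul_add]
    refine ih _ ?_ hw _ h5 hz rfl
    refine Finset.sum_lt_sum (fun k _ ↦ ?_) ⟨j, Finset.mem_univ j, ?_⟩
    · split_ifs with hk
      · subst hk
        rcases hs with rfl | rfl <;> omega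
      · simp
    · rw [if_pos rfl]
      rcases hs with rfl | rfl <;> omega
  generalize hg : s • γ j = g at *
  obtain ⟨hgΦ, hgS, hg'⟩ : g ∈ Φ ∧ (∀ y ∈ weightVectors A h g, orbitSum θ y ∈ S) ∧
      (latticeForm A g (σ g) = 0 ∨ σ g = g ∧ ∀ x ∈ weightVectors A h g, θ x = x) := by
    rcases hs with rfl | rfl
    · rw [one_smul] at hg
      subst hg
      exact ⟨hγ j, hpos j, (hγ' j).imp_right fun h ↦ ⟨h.1, h.2.1⟩⟩
    · rw [neg_one_smul] at hg
      subst hg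
      refine ⟨F.neg_mem (hγ j), hneg j, (hγ' j).imp (fun h ↦ ?_) fun h ↦ ⟨?_, h.2.2⟩⟩
      · rw [neg_latticeForm_left, map_neg, map_neg, h, neg_zero, neg_zero]
      · rw [map_neg, h.1]
  have hσσ : latticeForm A v (σ (σ g)) = latticeForm A v g := by
    rw [← T.symm, F.latticeForm_twist T]
  by_cases hvg : 0 < latticeForm A v g
  · by_cases hvg' : v = g
    · subst hvg'
      exact hgS x hx
    · exact F.orbitSum_mem_of_sub T hv hgΦ hg' hvg hsv hvg' hgS
        (hstep _ (F.sub_mem v hv g hgΦ hvg hvg') (by rw [map_sub]; abel)) hx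
  · have hvσ : 0 < latticeForm A v (σ g) := by rw [map_add] at hsv; omega
    have h0 : latticeForm A g (σ g) = 0 := by
      rcases hg' with h0 | ⟨h0, -⟩
      · exact h0
      · rw [h0] at hvσ
        exact absurd hvσ hvg
    have hσS : ∀ y ∈ weightVectors A h (σ g), orbitSum θ y ∈ S := by
      intro y hy
      obtain ⟨y', hy', hy0⟩ := F.exists_ne_zero_mem hgΦ
      have hy0' : θ y' ≠ 0 := fun h1 ↦ by
        have h2 : θ y' = θ 0 := h1.trans (map_zero θ).symm
        exact hy0 (θ.injective h2)
      obtain ⟨c, rfl⟩ := F.exists_smul _ (F.twist_mem T hgΦ) y hy _ (T.map_mem hy') hy0'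
      rw [map_smul, T.orbitSum_map]
      exact S.smul_mem c (hgS y' hy')
    by_cases hvg' : v = σ g
    · subst hvg'
      exact hσS x hx
    · have h2 : latticeForm A (σ g) (σ (σ g)) = 0 := by rw [F.latticeForm_twist T, h0]
      have h3 : 0 < latticeForm A v (σ g + σ (σ g)) := by
        rw [map_add, hσσ]
        rw [map_add] at hsv
        omega
      -- The two roots pair to `(σ g, σ g) = 2`, which distinct roots cannot do.
      have h4 : σ (σ g) = g := by
        by_contra hne'
        have h5 := F.eq_one_of_pos (F.twist_mem T (F.twist_mem T hgΦ)) hgΦ (by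
          rw [T.symm, F.latticeForm_twist T, F.norm_root g hgΦ]; norm_num) hne'
        rw [T.symm, F.latticeForm_twist T, F.norm_root g hgΦ] at h5
        omega
      exact F.orbitSum_mem_of_sub T hv (F.twist_mem T hgΦ) (.inl h2) hvσ h3 hvg' hσS
        (hstep _ (F.sub_mem v hv _ (F.twist_mem T hgΦ) hvσ hvg') (by rw [map_sub, h4]; abel)) hx

end SimplyLacedFrame

end Folding

/-! ### Chevalley generators of a folded subalgebra -/

section FoldedComponent

variable {ι : Type*} [Fintype ι] [DecidableEq ι] {𝔤 : Type*} [LieRing 𝔤] [LieAlgebra ℂ 𝔤]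
  {A : Matrix ι ι ℤ} {B : LinearMap.BilinForm ℂ 𝔤} {Φ : Set (ι → ℤ)} {h : (ι → ℤ) →ₗ[ℤ] 𝔤}
  {θ : 𝔤 ≃ₗ⁅ℂ⁆ 𝔤} {σ : (ι → ℤ) →ₗ[ℤ] (ι → ℤ)}

namespace SimplyLacedFrame

variable (F : SimplyLacedFrame A B Φ h) (T : IsTwist A h θ σ)
include F T

theorem map_neg_eq_smul {v : ι → ℤ} (hv : v ∈ Φ) (hσ : σ v = v) {a : ℂ} (ha : a * a = 1)
    (hfix : ∀ x ∈ weightVectors A h v, θ x = a • x) :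
    ∀ x ∈ weightVectors A h (-v), θ x = a • x := by
  intro x hx
  obtain ⟨e, he, f, hf, hef⟩ := F.exists_sl2 v hv
  have hf0 : f ≠ 0 := by
    rintro rfl
    rw [lie_zero] at hef
    exact F.h_ne_zero hv hef.symm
  have h1 := T.map_mem hf
  rw [map_neg, hσ] at h1
  obtain ⟨c, hc⟩ := F.exists_smul _ (F.neg_mem hv) _ h1 f hf hf0
  have h2 : θ ⁅e, f⁆ = ⁅e, f⁆ := by rw [hef, T.map_h, hσ]
  rw [LieEquiv.map_lie, hfix e he, hc, lie_smul, smul_lie, hef] at h2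
  have h3 : (c * a - 1) • h v = 0 := by
    linear_combination (norm := module) h2
  have h4 : c = a := by
    linear_combination a * (smul_eq_zero.mp h3).resolve_right (F.h_ne_zero hv) - c * ha
  obtain ⟨d, rfl⟩ := F.exists_smul _ (F.neg_mem hv) x hx f hf hf0
  have h5 : θ (d • f) = d • θ f := map_smul θ d f
  rw [h5, hc, h4, smul_comm]

theorem map_neg_eq_self {v : ι → ℤ} (hv : v ∈ Φ) (hσ : σ v = v)
    (hfix : ∀ x ∈ weightVectors A h v, θ x = x) : ∀ x ∈ weightVectors A h (-v), θ x = x := by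
  simpa using F.map_neg_eq_smul T hv hσ (a := 1) (by norm_num) (by simpa using hfix)

theorem map_neg_eq_neg {v : ι → ℤ} (hv : v ∈ Φ) (hσ : σ v = v)
    (hfix : ∀ x ∈ weightVectors A h v, θ x = -x) : ∀ x ∈ weightVectors A h (-v), θ x = -x := by
  simpa using F.map_neg_eq_smul T hv hσ (a := -1) (by norm_num) (by simpa using hfix)

/-- If the roots `γ`, some of them fixed by `σ` and the others orthogonal to their images, restrict
to simple roots of the fixed subalgebra, then the fixed subalgebra is simple. -/
theorem isComponent_of_folding [FiniteDimensional ℂ 𝔤]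
    (hinv : ∀ x y z : 𝔤, B ⁅x, y⁆ z = B x ⁅y, z⁆) (hs : B.IsSymm) {V : Type*} [AddCommGroup V]
    [Module ℂ V] (R : AffineAlgebra 𝔤 B 1 V) (hne : ∀ v ∈ Φ, σ v ≠ -v) (X : DynkinType)
    (hX : IsFiniteTypeMatrix X.cartanMatrix) (γ : Fin X.rank → ι → ℤ) (hγ : ∀ j, γ j ∈ Φ)
    (s : Fin X.rank → ℂ)
    (hγs : ∀ j, s j = 1 ∧ latticeForm A (γ j) (σ (γ j)) = 0 ∨
      s j = 1 / 2 ∧ σ (γ j) = γ j ∧ ∀ x ∈ weightVectors A h (γ j), θ x = x)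
    (hγA : ∀ i j, s j * (latticeForm A (γ i) (γ j + σ (γ j)) : ℂ) = (X.cartanMatrix i j : ℂ))
    (hγγ : ∀ i j, i ≠ j → latticeForm A (γ i) (γ j) ≤ 0 ∧ (latticeForm A (γ i) (σ (γ j)) ≤ 0 ∨
      ∀ x ∈ weightVectors A h (γ i - σ (γ j)), θ x = -x))
    (hspan : ∀ v, ∃ n : Fin X.rank → ℤ, v + σ v = ∑ j, n j • (γ j + σ (γ j)))
    (l : ℕ) (hl : l ≠ 0)
    (hlong : ∀ P : Fin X.rank → Prop,
      (∀ i j, P i → (X.cartanMatrix j i).natAbs ≤ (X.cartanMatrix i j).natAbs) →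
      (∀ i j, X.cartanMatrix i j = -1 → X.cartanMatrix j i = -1 → P i → P j) →
      ∀ i, P i → s i * s i * (latticeForm A (γ i + σ (γ i)) (γ i + σ (γ i)) : ℂ) = 2 * l) :
    R.IsComponent (fixedSubalgebra θ) X l := by
  choose e he f hf hef using fun j ↦ F.exists_sl2 _ (hγ j)
  have he0 : ∀ j, e j ≠ 0 := by
    intro j h0
    apply F.h_ne_zero (hγ j)
    rw [← hef, h0, zero_lie]
  have hf0 : ∀ j, f j ≠ 0 := by
    intro j h0
    apply F.h_ne_zero (hγ j)
    rw [← hef, h0, lie_zero]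
  have hs0 : ∀ j, s j ≠ 0 := by
    intro j
    rcases hγs j with h1 | h1 <;> rw [h1.1] <;> norm_num
  set N := orbitSum θ
  have hNh : ∀ j, N (h (γ j)) = h (γ j + σ (γ j)) := fun j ↦ T.orbitSum_h _
  have hNN : ∀ i j, ⁅N (h (γ i)), N (h (γ j))⁆ = 0 := fun i j ↦ by rw [hNh, hNh, F.lie_h_h]
  have hN0 : ∀ {x}, θ x = -x → N x = 0 := by
    intro x hx
    rw [orbitSum_apply, hx, add_neg_cancel]
  have hmθ : ∀ (c : ℂ) x, θ (c • x) = c • θ x := fun c x ↦ map_smul θ c x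
  have S : ChevalleySystem X.cartanMatrix (fun j ↦ s j • N (h (γ j))) (fun j ↦ s j • N (e j))
      (fun j ↦ s j • N (f j)) :=
    { h_ne_zero := fun j h0 ↦ by
        have h1 : h (γ j + σ (γ j)) = 0 := by
          rw [← hNh]
          exact (smul_eq_zero.mp h0).resolve_left (hs0 j)
        have h2 := F.form_h (γ j + σ (γ j)) (γ j + σ (γ j))
        have h3 := F.norm_add_twist_pos T (hγ j) (hne _ (hγ j))
        rw [h1, map_zero] at h2
        have h4 : latticeForm A (γ j + σ (γ j)) (γ j + σ (γ j)) = 0 := by exact_mod_cast h2.symm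
        omega
      lie_e_f := fun j ↦ by
        rw [smul_lie, lie_smul, T.lie_orbitSum, hef]
        rcases hγs j with ⟨h1, h2⟩ | ⟨h1, h2, h3⟩
        · have h4 : ⁅e j, θ (f j)⁆ = 0 := by
            refine F.eq_zero_of_norm ?_ (lie_mem_weightVectors (he j) (T.map_mem (hf j)))
            rw [map_neg, ← sub_eq_add_neg, F.norm_sub, h2, F.norm_root _ (hγ j),
              F.norm_root _ (F.twist_mem T (hγ j))]
            norm_num
          rw [h4, add_zero, h1, one_smul]
        · rw [F.map_neg_eq_self T (hγ j) h2 h3 _ (hf j), hef, ← two_smul ℂ, map_smul, h1]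
          module
      lie_e_f_ne := fun i j hij ↦ by
        rw [smul_lie, lie_smul, T.lie_orbitSum]
        obtain ⟨h1, h2⟩ := hγγ i j hij
        have h3 : ⁅e i, f j⁆ = 0 := by
          refine F.eq_zero_of_norm ?_ (lie_mem_weightVectors (he i) (hf j))
          rw [← sub_eq_add_neg, F.norm_sub, F.norm_root _ (hγ i), F.norm_root _ (hγ j)]
          omega
        have h4 : ⁅e i, θ (f j)⁆ ∈ weightVectors A h (γ i - σ (γ j)) := by
          have := lie_mem_weightVectors (he i) (T.map_mem (hf j))
          rwa [map_neg, ← sub_eq_add_neg] at this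
        -- The weight `γ i - σ (γ j)` may be a root; the symmetrized bracket still vanishes if `θ`
        -- is `-1` on its root vectors.
        have h5 : N ⁅e i, θ (f j)⁆ = 0 := by
          rcases h2 with h2 | h2
          · rw [F.eq_zero_of_norm ?_ h4, map_zero]
            rw [F.norm_sub, F.norm_root _ (hγ i), F.norm_root _ (F.twist_mem T (hγ j))]
            omega
          · exact hN0 (h2 _ h4)
        rw [h3, zero_add, h5, smul_zero, smul_zero]
      lie_h_h := fun i j ↦ by rw [smul_lie, lie_smul, hNN, smul_zero, smul_zero]
      lie_h_e := fun i j ↦ by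
        rw [smul_lie, lie_smul, T.lie_orbitSum_h (he i), smul_comm, smul_smul (s j), hγA,
          Int.cast_smul_eq_zsmul, smul_comm]
      lie_h_f := fun i j ↦ by
        rw [smul_lie, lie_smul, T.lie_orbitSum_h (hf i), neg_latticeForm_left, Int.cast_neg,
          neg_smul,
          smul_neg, smul_neg, smul_comm, smul_smul (s j), hγA, Int.cast_smul_eq_zsmul, smul_comm,
          neg_smul] }
  have hNS : ∀ {j x}, s j • N x ∈ S.subalgebra → N x ∈ S.subalgebra := by
    intro j x hx
    have := S.subalgebra.smul_mem (s j)⁻¹ hx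
    rwa [smul_smul, inv_mul_cancel₀ (hs0 j), one_smul] at this
  have hS : fixedSubalgebra θ = S.subalgebra := by
    apply le_antisymm
    · intro x hx
      let K : Submodule ℂ 𝔤 := S.subalgebra.toSubmodule.comap N
      have h1 : K = ⊤ := by
        refine F.span K (fun v ↦ ?_) fun v hv x hx ↦ ?_
        · change N (h v) ∈ S.subalgebra
          obtain ⟨n, hn⟩ := hspan v
          rw [T.orbitSum_h, hn, map_sum]
          refine sum_mem fun j _ ↦ ?_
          rw [map_zsmul, ← hNh]
          exact zsmul_mem (hNS (S.h_mem j)) _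
        · change N x ∈ S.subalgebra
          obtain ⟨n, hn⟩ := hspan v
          refine F.orbitSum_mem T hne γ hγ (fun j ↦ (hγs j).imp (fun h ↦ h.2) fun h ↦
            ⟨h.2.1, h.2.2, F.map_neg_eq_self T (hγ j) h.2.1 h.2.2⟩) ?_ ?_ hv n hn hx
          · intro j y hy
            obtain ⟨c, rfl⟩ := F.exists_smul _ (hγ j) y hy _ (he j) (he0 j)
            rw [map_smul]
            exact S.subalgebra.smul_mem c (hNS (S.e_mem j))
          · intro j y hy
            obtain ⟨c, rfl⟩ := F.exists_smul _ (F.neg_mem (hγ j)) y hy _ (hf j) (hf0 j)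
            rw [map_smul]
            exact S.subalgebra.smul_mem c (hNS (S.f_mem j))
      have h2 : x ∈ K := by rw [h1]; trivial
      have h3 : x + θ x ∈ S.subalgebra := h2
      rw [mem_fixedSubalgebra.mp hx, ← two_smul ℂ] at h3
      have := S.subalgebra.smul_mem (2⁻¹ : ℂ) h3
      rwa [smul_smul, inv_mul_cancel₀ two_ne_zero, one_smul] at this
    · refine LieSubalgebra.lieSpan_le.mpr ?_
      have h1 : ∀ (c : ℂ) x, c • N x ∈ fixedSubalgebra θ := by
        intro c x
        rw [mem_fixedSubalgebra, hmθ, T.map_orbitSum]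
      rintro _ (⟨j, rfl⟩ | ⟨j, rfl⟩) <;> exact h1 _ _
  rw [hS]
  refine S.isComponent_of_long R hX hinv hs X (Equiv.refl _) (fun _ _ ↦ rfl) l hl
    fun P h1 h2 i hi ↦ ?_
  rw [map_smul, LinearMap.map_smul₂, hNh, F.form_h, smul_eq_mul, smul_eq_mul, ← mul_assoc]
  exact hlong P h1 h2 i hi

end SimplyLacedFrame

end FoldedComponent

/-! ### The type `E₆` -/

section ExceptionalSix

/-- The automorphism of the Dynkin diagram of `E₆`, as a map of the root lattice. -/
def diagramMapSix : (Fin 6 → ℤ) →ₗ[ℤ] (Fin 6 → ℤ) := LinearMap.funLeft ℤ ℤ ![5, 1, 4, 3, 2, 0]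

/-- Orthogonal roots of `E₆` that are fixed by the automorphism of the diagram. -/
def orthogonalRootsSix : List (Fin 6 → ℤ) :=
  [Pi.single 1 1, ![0, 1, 1, 2, 1, 0], ![1, 1, 1, 2, 1, 1], ![1, 1, 2, 2, 2, 1]]

/-- Roots of `E₆` that restrict to simple roots of a subalgebra of type `C₄`. -/
def simpleRootsSix : Fin 4 → Fin 6 → ℤ :=
  ![-![1, 1, 2, 2, 1, 1], Pi.single 0 1, Pi.single 2 1, Pi.single 3 1]

variable {𝔤 : Type*} [LieRing 𝔤] [LieAlgebra ℂ 𝔤] {B : LinearMap.BilinForm ℂ 𝔤}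
  {Φ : Set (Fin 6 → ℤ)} {h : (Fin 6 → ℤ) →ₗ[ℤ] 𝔤}

theorem isFiniteTypeMatrix_C_four : IsFiniteTypeMatrix (CartanMatrix.C 4) :=
  ⟨by decide, CartanMatrix.C_off_diag_nonpos 4, ![5, 9, 12, 14], by decide, by decide⟩

namespace SimplyLacedFrame

variable (F : SimplyLacedFrame CartanMatrix.E₆ B Φ h) {θ : 𝔤 ≃ₗ⁅ℂ⁆ 𝔤}
include F

theorem orthogonalRootsSix_mem : ∀ β ∈ orthogonalRootsSix, β ∈ Φ := by
  simp only [orthogonalRootsSix, List.forall_mem_cons, List.not_mem_nil, false_imp_iff,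
    implies_true, and_true]
  exact ⟨F.single_mem 1, F.mem_of_addRoots_single 1 [3, 2, 4, 3] (by decide),
    F.mem_of_addRoots_single 1 [3, 2, 4, 3, 0, 5] (by decide),
    F.mem_of_addRoots_single 1 [3, 2, 4, 3, 0, 5, 2, 4] (by decide)⟩

/-- An inverting involution of `E₆` is conjugate to an involution that permutes the simple roots. -/
theorem exists_isTwist_six (hinv : ∀ x y z : 𝔤, B ⁅x, y⁆ z = B x ⁅y, z⁆)
    (hθ : ∀ v, θ (h v) = -h v) :
    ∃ h' : (Fin 6 → ℤ) →ₗ[ℤ] 𝔤, SimplyLacedFrame CartanMatrix.E₆ B Φ h' ∧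
      IsTwist CartanMatrix.E₆ h' θ diagramMapSix ∧
      (∀ x ∈ weightVectors CartanMatrix.E₆ h' (Pi.single 3 1), θ x = x) ∧
      ∀ x ∈ weightVectors CartanMatrix.E₆ h' ![1, 1, 2, 2, 2, 1], θ x = -x := by
  have T : IsTwist CartanMatrix.E₆ h θ (-LinearMap.id) :=
    ⟨fun v ↦ by rw [hθ]; simp, fun u v ↦ by simp, F.involutive hθ⟩
  have hmem := F.orthogonalRootsSix_mem
  have horth : orthogonalRootsSix.Pairwise fun β γ ↦ latticeForm CartanMatrix.E₆ β γ = 0 := by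
    simp only [latticeForm_apply]
    decide
  obtain ⟨h₁, F₁, T₁, hm, -⟩ :=
    F.exists_cayley_list hinv T orthogonalRootsSix hmem (fun _ _ ↦ by simp) horth
  -- Minus the product of the four reflections is the diagram automorphism.
  have h1 : orthogonalRootsSix.foldl (twistBy CartanMatrix.E₆) (-LinearMap.id) =
      diagramMapSix := by
    refine LinearMap.pi_ext' fun i ↦ LinearMap.ext_ring ?_
    change orthogonalRootsSix.foldl (twistBy CartanMatrix.E₆) (-LinearMap.id) (Pi.single i 1) =
      diagramMapSix (Pi.single i 1)
    rw [foldl_twistBy]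
    simp only [latticeForm_apply, LinearMap.neg_apply, LinearMap.id_apply]
    revert i
    decide
  rw [h1] at T₁
  simp only [orthogonalRootsSix, List.forall_mem_cons, List.not_mem_nil, false_imp_iff,
    implies_true, and_true] at hm hmem
  obtain ⟨hm₁, -, -, hm₄⟩ := hm
  have hmul : ∀ (d : ℂ) x, θ (d • x) = d • θ x := fun d x ↦ map_smul θ d x
  have hα := F₁.single_mem 3
  obtain ⟨e, he, he0⟩ := F₁.exists_ne_zero_mem hα
  obtain ⟨c, hc⟩ := F₁.exists_smul _ hα _
    (show θ e ∈ _ from (show diagramMapSix (Pi.single 3 1) = Pi.single 3 1 by decide) ▸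
      T₁.map_mem he) e he he0
  have h2 : c * c = 1 := by
    have h3 := T₁.map_map e
    rw [hc, hmul, hc, smul_smul] at h3
    have h4 : (c * c - 1) • e = 0 := by rw [sub_smul, h3, one_smul, sub_self]
    exact sub_eq_zero.mp ((smul_eq_zero.mp h4).resolve_right he0)
  rcases mul_self_eq_one_iff.mp h2 with rfl | rfl
  · refine ⟨h₁, F₁, T₁, fun x hx ↦ ?_, hm₄⟩
    obtain ⟨d, rfl⟩ := F₁.exists_smul _ hα x hx e he he0
    rw [hmul, hc, one_smul]
  -- If the sign on `α₄` is `-1`, reflect in `α₂`, whose sign is also `-1`: then `α₂ + α₄` takes the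
  -- place of `α₄`, with sign `+1`. The last orthogonal root is unmoved.
  · have hβ := F₁.single_mem 1
    have hmr := F₁.mem_weightVectors_comp_latticeReflection hβ
    refine ⟨h₁ ∘ₗ latticeReflection _ (Pi.single 1 1), F₁.comp_latticeReflection hβ,
      ⟨fun v ↦ ?_, T₁.symm, T₁.map_map⟩, fun x hx ↦ ?_, fun x hx ↦ ?_⟩
    · have h3 : diagramMapSix (Pi.single 1 1) = Pi.single 1 1 := by decide
      rw [LinearMap.comp_apply, LinearMap.comp_apply, T₁.map_h, latticeReflection_apply,
        latticeReflection_apply, map_sub, map_smul, ← T₁.symm, h3]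
    · rw [hmr] at hx
      have h3 : latticeReflection CartanMatrix.E₆ (Pi.single 1 1) (Pi.single 3 1) =
          Pi.single 1 1 + Pi.single 3 1 := by
        rw [latticeReflection_apply, latticeForm_apply]
        decide
      rw [h3] at hx
      obtain ⟨z, hz, rfl⟩ := F₁.exists_lie_eq hβ hα (by rw [latticeForm_apply]; decide) hx he he0
      rw [LieEquiv.map_lie, hm₁ z hz, hc, neg_lie, lie_smul, neg_one_smul, neg_neg]
    · rw [hmr] at hx
      have h3 : latticeReflection CartanMatrix.E₆ (Pi.single 1 1) ![1, 1, 2, 2, 2, 1] =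
          ![1, 1, 2, 2, 2, 1] := by
        rw [latticeReflection_apply, latticeForm_apply]
        decide
      rw [h3] at hx
      exact hm₄ x hx

/-- Folding by the diagram automorphism alone would give `F₄`. The sign `-1` on a fixed root removes
part of it, and a negative root in place of `α₂` completes the chain of simple roots of `C₄`. -/
theorem isComponent_six [FiniteDimensional ℂ 𝔤] (hinv : ∀ x y z : 𝔤, B ⁅x, y⁆ z = B x ⁅y, z⁆)
    (hs : B.IsSymm) {V : Type*} [AddCommGroup V] [Module ℂ V] (R : AffineAlgebra 𝔤 B 1 V)
    (hθ : ∀ v, θ (h v) = -h v) : R.IsComponent (fixedSubalgebra θ) (.C 4) 1 := by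
  obtain ⟨h', F', T, hfix, hneg⟩ := F.exists_isTwist_six hinv hθ
  have hβ : ![1, 1, 2, 2, 2, 1] ∈ Φ := F.orthogonalRootsSix_mem _ (by simp [orthogonalRootsSix])
  -- The factor `1/2` belongs to the fixed root, whose root vectors are doubled by symmetrization.
  let s : Fin 4 → ℂ := ![1, 1, 1, 1 / 2]
  refine F'.isComponent_of_folding T hinv hs R ?_ (.C 4) isFiniteTypeMatrix_C_four simpleRootsSix
    ?_ s ?_ ?_ ?_ ?_ 1 one_ne_zero ?_
  -- On vectors that the diagram map negates the norm is divisible by 4, so none of them is a root.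
  · intro v hv h0
    have h1 := F.norm_root v hv
    have h2 : ∀ i, v (![5, 1, 4, 3, 2, 0] i) = -v i := fun i ↦ congrFun h0 i
    have e0 : v 5 = -v 0 := h2 0
    have e1 : v 1 = -v 1 := h2 1
    have e2 : v 4 = -v 2 := h2 2
    have e3 : v 3 = -v 3 := h2 3
    have e1' : v 1 = 0 := by omega
    have e3' : v 3 = 0 := by omega
    rw [latticeForm_apply, dotProduct, Fin.sum_univ_six] at h1
    simp only [Matrix.mulVec, dotProduct, Fin.sum_univ_six] at h1
    simp only [CartanMatrix.E₆, Matrix.of_apply, Matrix.cons_val, e0, e1', e2, e3'] at h1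
    ring_nf at h1
    omega
  · intro j
    fin_cases j
    · exact F.neg_mem (F.mem_of_addRoots_single 1 [3, 2, 4, 3, 0, 5, 2] (by decide))
    all_goals exact F.single_mem _
  · intro j
    rw [latticeForm_apply]
    fin_cases j
    · exact .inl ⟨rfl, by decide⟩
    · exact .inl ⟨rfl, by decide⟩
    · exact .inl ⟨rfl, by decide⟩
    · exact .inr ⟨rfl, by decide, hfix⟩
  -- The identity is doubled to clear the half in `s` and become decidable over the integers.
  · have h1 : ∀ p : Fin 4 × Fin 4, (![2, 2, 2, 1] p.2 : ℤ) * (simpleRootsSix p.1 ⬝ᵥ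
        CartanMatrix.E₆.mulVec (simpleRootsSix p.2 + diagramMapSix (simpleRootsSix p.2))) =
        2 * CartanMatrix.C 4 p.1 p.2 := by decide
    have h2 : ∀ j : Fin 4, s j = (![2, 2, 2, 1] j : ℤ) / 2 := by
      intro j
      fin_cases j <;> simp [s]
    have h4 : ∀ i j : Fin 4, s j * ((latticeForm CartanMatrix.E₆ (simpleRootsSix i)
        (simpleRootsSix j + diagramMapSix (simpleRootsSix j)) : ℤ) : ℂ) =
        ((CartanMatrix.C 4 i j : ℤ) : ℂ) := by
      intro i j
      have h3 := congrArg (Int.cast : ℤ → ℂ) (h1 (i, j))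
      rw [Int.cast_mul, Int.cast_mul] at h3
      rw [h2, latticeForm_apply]
      push_cast at h3 ⊢
      linear_combination (1 / 2 : ℂ) * h3
    exact h4
  · have h1 : ∀ p : Fin 4 × Fin 4, p.1 ≠ p.2 →
        simpleRootsSix p.1 ⬝ᵥ CartanMatrix.E₆.mulVec (simpleRootsSix p.2) ≤ 0 ∧
        (simpleRootsSix p.1 ⬝ᵥ CartanMatrix.E₆.mulVec (diagramMapSix (simpleRootsSix p.2)) ≤ 0 ∨
          simpleRootsSix p.1 - diagramMapSix (simpleRootsSix p.2) = ![1, 1, 2, 2, 2, 1] ∨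
          simpleRootsSix p.1 - diagramMapSix (simpleRootsSix p.2) = -![1, 1, 2, 2, 2, 1]) := by
      decide
    intro i j hij
    obtain ⟨h2, h3⟩ := h1 (i, j) hij
    rw [latticeForm_apply, latticeForm_apply]
    refine ⟨h2, h3.imp_right ?_⟩
    rintro (h4 | h4)
    · rw [h4]
      exact hneg
    · rw [h4]
      exact F'.map_neg_eq_neg T hβ (by decide) hneg
  · intro v
    -- The coefficient of `α₂` occurs only in the first root, which fixes its multiple; the other
    -- coefficients follow.
    refine ⟨![-v 1, v 0 + v 5 - 2 * v 1, v 2 + v 4 - 3 * v 1, v 3 - 2 * v 1], ?_⟩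
    refine Eq.trans ?_ (Fin.sum_univ_four _).symm
    ext i
    simp only [simpleRootsSix, Pi.add_apply, Pi.smul_apply, Matrix.cons_val, Pi.neg_apply,
      smul_eq_mul, diagramMapSix, LinearMap.funLeft_apply]
    fin_cases i <;> simp <;> ring
  · intro P h1 h2 i hi
    -- The double edge shows that node 2 is short, and simple edges carry this to nodes 1 and 0.
    have h3 : ¬P (2 : Fin 4) := fun h3 ↦
      absurd (h1 (2 : Fin 4) (3 : Fin 4) h3) (by decide)
    have h4 : ¬P (1 : Fin 4) := fun h4 ↦ h3 (h2 (1 : Fin 4) (2 : Fin 4) (by decide) (by decide) h4)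
    have h5 : ¬P (0 : Fin 4) := fun h5 ↦ h4 (h2 (0 : Fin 4) (1 : Fin 4) (by decide) (by decide) h5)
    change Fin 4 at i
    fin_cases i
    · exact absurd hi h5
    · exact absurd hi h4
    · exact absurd hi h3
    -- The long coroot has norm `(1/2)² · 8 = 2`, so the level is 1.
    · have h6 : simpleRootsSix 3 + diagramMapSix (simpleRootsSix 3) = Pi.single 3 2 := by decide
      change (1 / 2 : ℂ) * (1 / 2) * ((latticeForm CartanMatrix.E₆ (simpleRootsSix 3 +
        diagramMapSix (simpleRootsSix 3)) (simpleRootsSix 3 + diagramMapSix (simpleRootsSix 3)) :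
        ℤ) : ℂ) = _
      rw [h6, latticeForm_apply, show Pi.single 3 2 ⬝ᵥ CartanMatrix.E₆.mulVec (Pi.single 3 2) = 8 by
        decide]
      norm_num

end SimplyLacedFrame

end ExceptionalSix

/-! ### Decompositions for the exceptional types -/

section Exceptional

variable {𝔤 : Type*} [LieRing 𝔤] [LieAlgebra ℂ 𝔤] [FiniteDimensional ℂ 𝔤] [IsKilling ℂ 𝔤]
  {H : LieSubalgebra ℂ 𝔤} [H.IsCartanSubalgebra] {B : LinearMap.BilinForm ℂ 𝔤}
  (hB : IsNormalizedForm H B) {V : Type*} [AddCommGroup V] [Module ℂ V]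
  (R : AffineAlgebra 𝔤 B 1 V) {θ : 𝔤 ≃ₗ⁅ℂ⁆ 𝔤} (hθ : ∀ h ∈ H, θ h = -h)

include hB in
theorem state_injective_of_isOfType {T : DynkinType} (hA : T.cartanMatrix.IsSymm)
    (hT : IsOfType H T) : Function.Injective R.state := by
  obtain ⟨b, ε, hb⟩ := hT
  exact state_injective (eq_zero_of_forall_form_eq_zero H hA b ε hb hB)

include hB hθ

theorem hasDecomposition_of_E₆ (hT : IsOfType H .E₆) :
    HasDecomposition R (fixedSubalgebra θ) [(.C 4, 1)] := by
  obtain ⟨b, ε, hb⟩ := hT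
  exact .of_isComponent ((simplyLacedFrame H (A := CartanMatrix.E₆) (by decide) b ε hb
    hB).isComponent_six hB.invariant hB.symm R (map_frameMap H hθ b ε))

theorem hasDecomposition_of_E₇ (hT : IsOfType H .E₇) :
    HasDecomposition R (fixedSubalgebra θ) [(.A 7, 1)] := by
  obtain ⟨b, ε, hb⟩ := hT
  exact .of_isComponent ((simplyLacedFrame H (A := CartanMatrix.E₇) (by decide) b ε hb
    hB).isComponent_seven hB.invariant hB.symm R (map_frameMap H hθ b ε))

theorem hasDecomposition_of_E₈ (hT : IsOfType H .E₈) :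
    HasDecomposition R (fixedSubalgebra θ) [(.D 8, 1)] := by
  obtain ⟨b, ε, hb⟩ := hT
  exact .of_isComponent ((simplyLacedFrame H (A := CartanMatrix.E₈) (by decide) b ε hb
    hB).isComponent_eight hB.invariant hB.symm R (map_frameMap H hθ b ε))

end Exceptional

end AffineFixedPoints

end

open LieAlgebra LieAlgebra.IsKilling AffineFixedPoints in
theorem theorem4 {𝔤 : Type*} [LieRing 𝔤] [LieAlgebra ℂ 𝔤] [FiniteDimensional ℂ 𝔤]
    [IsKilling ℂ 𝔤] (H : LieSubalgebra ℂ 𝔤) [H.IsCartanSubalgebra]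
    (B : LinearMap.BilinForm ℂ 𝔤) (hB : IsNormalizedForm H B)
    {V : Type*} [AddCommGroup V] [Module ℂ V] (R : AffineAlgebra 𝔤 B 1 V)
    (θ : 𝔤 ≃ₗ⁅ℂ⁆ 𝔤) (hθ : ∀ h ∈ H, θ h = -h)
    (Θ : V →ₗ[ℂ] V) (hΘ : R.IsInducedBy Θ θ) :
    (IsOfType H (.A 1) → R.HasRootSystem (R.fixedWeightOne Θ) 1 []) ∧
    (IsOfType H (.A 2) → R.HasRootSystem (R.fixedWeightOne Θ) 0 [(.A 1, 4)]) ∧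
    (∀ m : ℕ, 2 ≤ m → IsOfType H (.A (2 * m)) →
      R.HasRootSystem (R.fixedWeightOne Θ) 0 [(.B m, 2)]) ∧
    (∀ m : ℕ, 2 ≤ m → IsOfType H (.A (2 * m - 1)) →
      R.HasRootSystem (R.fixedWeightOne Θ) 0 (typeD m 2)) ∧
    (∀ m : ℕ, 2 ≤ m → IsOfType H (.D (2 * m)) →
      R.HasRootSystem (R.fixedWeightOne Θ) 0 (typeD m 1 ++ typeD m 1)) ∧
    (∀ m : ℕ, 2 ≤ m → IsOfType H (.D (2 * m + 1)) →
      R.HasRootSystem (R.fixedWeightOne Θ) 0 [(.B m, 1), (.B m, 1)]) ∧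
    (IsOfType H .E₆ → R.HasRootSystem (R.fixedWeightOne Θ) 0 [(.C 4, 1)]) ∧
    (IsOfType H .E₇ → R.HasRootSystem (R.fixedWeightOne Θ) 0 [(.A 7, 1)]) ∧
    (IsOfType H .E₈ → R.HasRootSystem (R.fixedWeightOne Θ) 0 [(.D 8, 1)]) := by
  have hinj {T : DynkinType} (hA : T.cartanMatrix.IsSymm) (hT : IsOfType H T) :
      Function.Injective R.state := state_injective_of_isOfType hB R hA hT
  refine ⟨fun hT ↦ ?_, fun hT ↦ ?_, fun m hm hT ↦ ?_, fun m hm hT ↦ ?_, fun m hm hT ↦ ?_,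
    fun m hm hT ↦ ?_, fun hT ↦ ?_, fun hT ↦ ?_, fun hT ↦ ?_⟩
  · obtain ⟨x, hx, hspan⟩ := fixedSubalgebra_eq_span_of_A_one H hB hθ hT
    exact hasRootSystem_of_abelian (hinj (T := .A _) (isSymm_cartanMatrix_A _) hT) hΘ x hx hspan
  · exact ((hasDecomposition_of_A H hB hθ R hT).1 rfl).hasRootSystem
      (hinj (T := .A _) (isSymm_cartanMatrix_A _) hT) hΘ
  · exact ((hasDecomposition_of_A H hB hθ R hT).2.1 m hm rfl).hasRootSystem
      (hinj (T := .A _) (isSymm_cartanMatrix_A _) hT) hΘ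
  · exact ((hasDecomposition_of_A H hB hθ R hT).2.2 m hm rfl).hasRootSystem
      (hinj (T := .A _) (isSymm_cartanMatrix_A _) hT) hΘ
  · exact ((hasDecomposition_of_D H hB hθ R (by omega) hT).1 m hm rfl).hasRootSystem
      (hinj (T := .D _) (isSymm_cartanMatrix_D _) hT) hΘ
  · exact ((hasDecomposition_of_D H hB hθ R (by omega) hT).2 m hm rfl).hasRootSystem
      (hinj (T := .D _) (isSymm_cartanMatrix_D _) hT) hΘ
  · exact (hasDecomposition_of_E₆ hB R hθ hT).hasRootSystem
      (hinj (T := .E₆) (by decide) hT) hΘ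
  · exact (hasDecomposition_of_E₇ hB R hθ hT).hasRootSystem
      (hinj (T := .E₇) (by decide) hT) hΘ
  · exact (hasDecomposition_of_E₈ hB R hθ hT).hasRootSystem
      (hinj (T := .E₈) (by decide) hT) hΘ
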